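/- **Notation.** For $A\subset\mathbb{R}^p$ let $\mathcal{S}_A(v)=\sup\{w^\top v: w\in A\}$ be its support function. A set $A^K\subset\mathbb{R}^p$ is *$K$-generated* if it is the intersection of $K$ half-spaces; $\mathcal{V}(A^K)$ denotes the set of the $K$ outward unit normal vectors of these half-spaces, so that $A^K=\bigcap_{v\in\mathcal{V}(A^K)}\{w: w^\top v\le \mathcal{S}_{A^K}(v)\}$, and for $\epsilon\ge 0$ put $A^{K,\epsilon}=\bigcap_{v\in\mathcal{V}(A^K)}\{w: w^\top v\le \mathcal{S}_{A^K}(v)+\epsilon\}$. For $n,p\geq1$, $a\ge0$ and $d>0$, let $\mathcal{A}^{\rm si}(a,d)$ be the class of all sets $A\subset\mathbb{R}^p$ for which there is a $K$-generated set $A^K=A^K(A)$ with $K\le (pn)^d$ and $A^K\subset A\subset A^{K,\epsilon}$, $\epsilon=a/n$; one such $A^K(A)$ is fixed for each $A$. For $\gamma>0$ and a real random variable $\xi$ let $\|\xi\|_{\psi_\gamma}=\inf\{\lambda>0:\mathbb{E}[\exp\{(|\xi|/\lambda)^{\gamma}\}-1]\le 1\}$. Let $X_1,\dots,X_n$ be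 square-integrable, mean-zero random vectors in $\mathbb{R}^p$, $S_{n,x}=n^{-1/2}\sum_{t=1}^nX_t$, $\Xi=\mathrm{Cov}(S_{n,x})$, $G\sim N(0,\Xi)$, $V_n(v)=\mathrm{Var}(n^{-1/2}\sum_{t=1}^n v^\top X_t)$, and, for a class $\mathcal{A}$ of Borel sets, $\rho_n(\mathcal{A})=\sup_{A\in\mathcal{A}}|\mathbb{P}(S_{n,x}\in A)-\mathbb{P}(G\in A)|$. A *dependency graph* of $X_1,\dots,X_n$ is an undirected graph on $[n]=\{1,\dots,n\}$, with edge set $E_n$, all loops $(t,t)$ being counted as edges, such that $\{X_t\}_{t\in I}$ and $\{X_s\}_{s\in J}$ are independent whenever $I,J\subset[n]$ and no $(t,s)\in I\times J$ belongs to $E_n$. Let $\mathcal{N}_t=\{s:(t,s)\in E_n\}$, $D_n=\max_t|\mathcal{N}_t|$ and $D_n^*=\max_t|\bigcup_{\ell\in\mathcal{N}_t}\mathcal{N}_\ell|$. **Theorem 5.** Let $\kappa>0$, $\gamma_1\ge1$, $K_4>0$ and $d_0>0$. There is a constant $c>0$ depending only on $(\kappa,\gamma_1,K_4,d_0)$ such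 that the following holds for all $n\ge1$, $p\ge2$ with $p\ge n^\kappa$, all $a\ge 0$, $d\ge d_0$, $B_n\ge1$, all $X_1,\dots,X_n$ as above and every class $\mathcal{A}\subset\mathcal{A}^{\rm si}(a,d)$ of Borel sets such that, for every $A\in\mathcal{A}$ and every $v\in\mathcal{V}\{A^K(A)\}$, $\|v^\top X_t\|_{\psi_{\gamma_1}}\le B_n$ for all $t\in[n]$, and $V_n(v)\ge K_4$. (i) For every dependency graph of $X_1,\dots,X_n$, with maximum degrees $D_n$ and $D_n^*$, $$\rho_n(\mathcal{A})\le c\left\{\frac{a(d\log p)^{1/2}}{n}+\frac{B_n(D_nD_n^*)^{1/3}(d\log p)^{7/6}}{n^{1/6}}\right\}.$$ (ii) If $X_1,\dots,X_n$ is $m$-dependent for an integer $m\ge0$, that is, $\{X_i\}_{i\le t}$ and $\{X_j\}_{j>t+m}$ are independent for every $t$, then $$\rho_n(\mathcal{A})\le c\left\{\frac{a(d\log p)^{1/2}}{n}+\frac{B_n(m\vee1)^{2/3}(d\log p)^{7/6}}{n^{1/6}}\right\}.$$ -/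

import Mathlib

open MeasureTheory ProbabilityTheory
open scoped ENNReal RealInnerProductSpace

noncomputable section

namespace HDCLT

/-- `ℝ^p` with the Euclidean inner product. -/
abbrev Vec (p : ℕ) : Type := EuclideanSpace ℝ (Fin p)

section Probability

variable {Ω : Type*} [MeasurableSpace Ω]

/-- The norm `‖ξ‖_{ψ_γ} = inf {l > 0 : E[exp((|ξ|/l)^γ) - 1] ≤ 1}`, with values in `[0, ∞]`
(the infimum of the empty set is `∞`). -/
def psiNorm (γ : ℝ) (ξ : Ω → ℝ) (μ : Measure Ω) : ℝ≥0∞ :=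
  ⨅ (l : ℝ) (_ : 0 < l ∧
    ∫⁻ ω, ENNReal.ofReal (Real.exp ((|ξ ω| / l) ^ γ) - 1) ∂μ ≤ 1), ENNReal.ofReal l

variable {n p : ℕ}

/-- The normalized sum `S_n = n^{-1/2} ∑_t X_t`. -/
def normSum (X : Fin n → Ω → Vec p) (ω : Ω) : Vec p :=
  (√(n : ℝ))⁻¹ • ∑ t, X t ω

/-- The long-run covariance matrix `Ξ = Cov(S_n)`. -/
def longRunCov (X : Fin n → Ω → Vec p) (μ : Measure Ω) : Matrix (Fin p) (Fin p) ℝ :=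
  Matrix.of fun i j => cov[fun ω => normSum X ω i, fun ω => normSum X ω j; μ]

/-- The long-run variance in direction `v`: `V_n(v) = Var(n^{-1/2} ∑_t vᵀ X_t)`. -/
def longRunVar (X : Fin n → Ω → Vec p) (μ : Measure Ω) (v : Vec p) : ℝ :=
  Var[fun ω => (√(n : ℝ))⁻¹ * ∑ t, ⟪v, X t ω⟫; μ]

/-- `ρ_n(𝒜) = sup_{A ∈ 𝒜} |P(S_n ∈ A) - P(G ∈ A)|` with `G ∼ N(0, Ξ)`. -/
def rho (X : Fin n → Ω → Vec p) (μ : Measure Ω) (𝒜 : Set (Set (Vec p))) : ℝ :=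
  ⨆ A : 𝒜, |μ.real {ω | normSum X ω ∈ (A : Set (Vec p))} -
    (multivariateGaussian (0 : Vec p) (longRunCov X μ)).real (A : Set (Vec p))|

/-- `G` is a dependency graph of `X_1, …, X_n`: the families `{X_i}_{i ∈ I}` and `{X_j}_{j ∈ J}`
are independent whenever `I` and `J` are disjoint and no edge joins `I` to `J`.
(The convention that every node is joined to itself is put into `closedNbhd` below.) -/
def IsDependencyGraph (G : SimpleGraph (Fin n)) (X : Fin n → Ω → Vec p) (μ : Measure Ω) : Prop :=
  ∀ I J : Finset (Fin n), (∀ i ∈ I, ∀ j ∈ J, i ≠ j ∧ ¬ G.Adj i j) →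
    IndepFun (fun ω (i : I) => X i ω) (fun ω (j : J) => X j ω) μ

/-- `X_1, …, X_n` is `m`-dependent: for every `t`, the families `{X_i}_{i ≤ t}` and
`{X_j}_{j > t + m}` are independent. -/
def IsMDependent (m : ℕ) (X : Fin n → Ω → Vec p) (μ : Measure Ω) : Prop :=
  ∀ t : Fin n, IndepFun (fun ω (i : {i : Fin n // i ≤ t}) => X i ω)
    (fun ω (j : {j : Fin n // (t : ℕ) + m < j}) => X j ω) μ

end Probability

section Graph

variable {n : ℕ}

/-- The neighbours `N_t` of `t` in the graph with all loops added. -/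
def closedNbhd (G : SimpleGraph (Fin n)) (t : Fin n) : Set (Fin n) :=
  {s | s = t ∨ G.Adj t s}

/-- `D_n = max_t |N_t|`. -/
def maxDeg (G : SimpleGraph (Fin n)) : ℕ :=
  Finset.univ.sup fun t => (closedNbhd G t).ncard

/-- `D_n^* = max_t |⋃_{l ∈ N_t} N_l|`. -/
def maxDeg₂ (G : SimpleGraph (Fin n)) : ℕ :=
  Finset.univ.sup fun t => (⋃ l ∈ closedNbhd G t, closedNbhd G l).ncard

end Graph

section Convex

variable {p : ℕ}

/-- The support function `v ↦ sup {wᵀ v : w ∈ A}`. -/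
def supportFun (A : Set (Vec p)) (v : Vec p) : EReal :=
  ⨆ w ∈ A, ((⟪w, v⟫ : ℝ) : EReal)

/-- `P` is the intersection of half-spaces whose outward unit normal vectors form the finite
set `V`. -/
def IsGeneratedBy (P : Set (Vec p)) (V : Finset (Vec p)) : Prop :=
  (∀ v ∈ V, ‖v‖ = 1) ∧ ∃ b : Vec p → ℝ, P = {w | ∀ v ∈ V, ⟪w, v⟫ ≤ b v}

/-- The enlarged polytope `P^ε = ⋂_{v ∈ V} {w : wᵀ v ≤ S_P(v) + ε}`. -/
def enlarge (P : Set (Vec p)) (V : Finset (Vec p)) (ε : ℝ) : Set (Vec p) :=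
  {w | ∀ v ∈ V, ((⟪w, v⟫ : ℝ) : EReal) ≤ supportFun P v + (ε : EReal)}

/-- A generated set is recovered from the values of its support function on the normals. -/
theorem IsGeneratedBy.eq_enlarge_zero {P : Set (Vec p)} {V : Finset (Vec p)}
    (h : IsGeneratedBy P V) : P = enlarge P V 0 := by
  obtain ⟨-, b, hb⟩ := h
  have hsup : ∀ v ∈ V, supportFun P v ≤ (b v : EReal) := fun v hv =>
    iSup₂_le fun w hw => by
      rw [hb] at hw
      exact EReal.coe_le_coe_iff.2 (hw v hv)
  ext w
  refine ⟨fun hw v _ => ?_, fun hw => ?_⟩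
  · rw [EReal.coe_zero, add_zero]
    exact le_iSup₂ (f := fun w (_ : w ∈ P) => ((⟪w, v⟫ : ℝ) : EReal)) w hw
  · rw [hb]
    intro v hv
    have h1 := hw v hv
    rw [EReal.coe_zero, add_zero] at h1
    exact EReal.coe_le_coe_iff.1 (h1.trans (hsup v hv))

/-- `A` is a simple convex set of the class `𝒜^si(a, d)`, witnessed by `A^K = P` and
`𝒱(A^K) = V`: the set `P` is generated by `K = |V| ≤ (pn)^d` half-spaces with unit normals `V`
and approximates `A` with precision `ε = a/n`, that is, `P ⊆ A ⊆ P^ε`. -/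
def IsSimpleApprox (n : ℕ) (a d : ℝ) (A P : Set (Vec p)) (V : Finset (Vec p)) : Prop :=
  IsGeneratedBy P V ∧ (V.card : ℝ) ≤ ((p : ℝ) * n) ^ d ∧ P ⊆ A ∧ A ⊆ enlarge P V (a / n)

end Convex

end HDCLT

end

open HDCLT

/-! In the coordinates given by the normals of its approximating polytope, every nontrivial set of
the class lies between two lower orthants that differ by a shift a/n. So it suffices to have two
things for K ≤ (pn)^d coordinates: a bound for the Kolmogorov distance over orthants between the
locally dependent sum S and a Gaussian vector G with the same covariance, and Nazarov's inequality
P(G ≤ y + δ) ≤ P(G ≤ y) + C √L δ with L ≥ log K, which pays both for the shift and for smoothing.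

The orthant indicator is replaced by `smoothInd`, a cutoff of φ times the log-sum-exp with parameter
β. Since softmax weights sum to one, its third derivative is at most a constant times φβ² times
weighted sums of cubes, with no factor of the dimension, and it vanishes unless the smooth maximum
lies in a thin shell (`abs_smoothInd₃_le`). Along the path sin θ · S + cos θ · G, Gaussian
integration by parts and Stein's method produce the same trace of the Hessian against the
covariance. The two cancel and leave a third-order error (`abs_integral_smoothInd₁_interp_le`). Only
the neighbourhood of one summand or of a pair is ever removed from the sum, at most 2D summands, so
the error carries D².

The error is proportional to the probability that the interpolated vector lies in a shell. This is
at most a difference of two orthant probabilities, hence at most an anti-concentration term plus 2R,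
where R is the largest orthant distance along the whole path (`measureReal_shell_le`). When the
coefficient is at most 1/4, the inequality for R closes on itself
(`abs_measureReal_scaledSum_sub_le`). With φ³ of order √n / (B³D²L²), the smoothing cost √L/φ is B
D^(2/3) L^(7/6) n^(-1/6), and D² ≤ D D* gives (i).

Nazarov's inequality is proved by differentiating P(U ≤ a + h) in h. The derivative is controlled by
a sum over faces of density times the probability of a residual event. Mills' ratio compares these
terms with probabilities of disjoint events (`StdGaussian.sum_faces_le_one`).

For (ii), m-dependence makes the band graph of width m a dependency graph
(`IsMDependent.isDependencyGraph`), and its degrees are of order m. -/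

noncomputable section

set_option linter.unusedSectionVars false

namespace HDCLT


/-! ### The one-dimensional cutoff and its derivatives. -/

section Cutoff

/-- A smooth cutoff, equal to `1` on `(-∞, 0]` and to `0` on `[1, ∞)`. -/
def cutoff (x : ℝ) : ℝ := Real.smoothTransition (1 - x)

theorem contDiff_cutoff : ContDiff ℝ 4 cutoff :=
  (Real.smoothTransition.contDiff (n := 4)).comp (contDiff_const.sub contDiff_id)

theorem cutoff_nonneg (x : ℝ) : 0 ≤ cutoff x := Real.smoothTransition.nonneg _

theorem cutoff_le_one (x : ℝ) : cutoff x ≤ 1 := Real.smoothTransition.le_one _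

theorem cutoff_of_nonpos {x : ℝ} (hx : x ≤ 0) : cutoff x = 1 :=
  Real.smoothTransition.one_of_one_le (by linarith)

theorem cutoff_of_one_le {x : ℝ} (hx : 1 ≤ x) : cutoff x = 0 :=
  Real.smoothTransition.zero_of_nonpos (by linarith)

theorem hasDerivAt_iteratedDeriv_cutoff {k : ℕ} (hk : k < 4) (x : ℝ) :
    HasDerivAt (iteratedDeriv k cutoff) (iteratedDeriv (k + 1) cutoff x) x := by
  have h := contDiff_cutoff.differentiable_iteratedDeriv k (by exact_mod_cast hk)
  rw [iteratedDeriv_succ]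
  exact (h x).hasDerivAt

/-- The cutoff is constant near such a point; the strict inequalities supply the neighbourhood. This
vanishing later confines the derivatives of the smooth indicator to a shell. -/
theorem iteratedDeriv_cutoff_eq_zero {k : ℕ} (hk : 1 ≤ k) {x : ℝ} (hx : x < 0 ∨ 1 < x) :
    iteratedDeriv k cutoff x = 0 := by
  have key : ∀ c : ℝ, cutoff =ᶠ[nhds x] (fun _ => c) → iteratedDeriv k cutoff x = 0 := by
    intro c hc
    have h := hc.iteratedDeriv_eq k
    rw [h, iteratedDeriv_const, if_neg (by omega)]
  rcases hx with hx | hx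
  · apply key 1
    filter_upwards [Iio_mem_nhds hx] with y hy
    exact cutoff_of_nonpos (le_of_lt hy)
  · apply key 0
    filter_upwards [Ioi_mem_nhds hx] with y hy
    exact cutoff_of_one_le (le_of_lt hy)

theorem exists_bound_iteratedDeriv_cutoff :
    ∃ M : ℝ, 1 ≤ M ∧ ∀ k ∈ ({1, 2, 3} : Finset ℕ), ∀ x,
      |iteratedDeriv k cutoff x| ≤ if 0 ≤ x ∧ x ≤ 1 then M else 0 := by
  have hb : ∀ k : ℕ, k ≤ 4 → ∃ C : ℝ, ∀ x ∈ Set.Icc (0 : ℝ) 1, ‖iteratedDeriv k cutoff x‖ ≤ C :=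
    fun k hk => isCompact_Icc.exists_bound_of_continuousOn
      (contDiff_cutoff.continuous_iteratedDeriv k (by exact_mod_cast hk)).continuousOn
  choose! C hC using hb
  refine ⟨max 1 (max (C 1) (max (C 2) (C 3))), le_max_left _ _, fun k hk x => ?_⟩
  split_ifs with hx
  · have h4 : k ≤ 4 := by fin_cases hk <;> norm_num
    have := hC k h4 x hx
    rw [Real.norm_eq_abs] at this
    refine this.trans ?_
    fin_cases hk <;> simp
  · rw [iteratedDeriv_cutoff_eq_zero (by fin_cases hk <;> norm_num), abs_zero]
    by_contra! h
    exact hx h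

/-- A common bound for the first three derivatives of `cutoff`. -/
def cutoffBound : ℝ := exists_bound_iteratedDeriv_cutoff.choose

theorem one_le_cutoffBound : 1 ≤ cutoffBound := exists_bound_iteratedDeriv_cutoff.choose_spec.1

theorem abs_iteratedDeriv_cutoff_le {k : ℕ} (hk : k ∈ ({1, 2, 3} : Finset ℕ)) (x : ℝ) :
    |iteratedDeriv k cutoff x| ≤ if 0 ≤ x ∧ x ≤ 1 then cutoffBound else 0 :=
  exists_bound_iteratedDeriv_cutoff.choose_spec.2 k hk x

end Cutoff

/-! ### Softmax weights and the smooth maximum. -/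

section Softmax

variable {ι : Type*} [Fintype ι]

/-- The softmax weight of the coordinate `j`. -/
def smw (β : ℝ) (x : ι → ℝ) (j : ι) : ℝ := Real.exp (β * x j) / ∑ k, Real.exp (β * x k)

/-- The average of `a` for the softmax weights at `x`. -/
def avg (β : ℝ) (x a : ι → ℝ) : ℝ := ∑ j, smw β x j * a j

/-- The smooth maximum `β⁻¹ log ∑ exp (β x_j)`. -/
def lse (β : ℝ) (x : ι → ℝ) : ℝ := β⁻¹ * Real.log (∑ k, Real.exp (β * x k))

theorem smw_nonneg (β : ℝ) (x : ι → ℝ) (j : ι) : 0 ≤ smw β x j := by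
  unfold smw; positivity

theorem avg_add (β : ℝ) (x a b : ι → ℝ) : avg β x (a + b) = avg β x a + avg β x b := by
  simp [avg, mul_add, Finset.sum_add_distrib]

theorem avg_smul (β : ℝ) (x : ι → ℝ) (r : ℝ) (a : ι → ℝ) :
    avg β x (r • a) = r * avg β x a := by
  simp only [avg, Pi.smul_apply, smul_eq_mul, Finset.mul_sum]
  exact Finset.sum_congr rfl fun j _ => by ring

theorem avg_mono (β : ℝ) (x : ι → ℝ) {a b : ι → ℝ} (h : ∀ j, a j ≤ b j) :
    avg β x a ≤ avg β x b :=
  Finset.sum_le_sum fun j _ => mul_le_mul_of_nonneg_left (h j) (smw_nonneg β x j)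

theorem abs_avg_le (β : ℝ) (x a : ι → ℝ) : |avg β x a| ≤ avg β x (fun j => |a j|) := by
  refine (Finset.abs_sum_le_sum_abs _ _).trans (le_of_eq ?_)
  exact Finset.sum_congr rfl fun j _ => by rw [abs_mul, abs_of_nonneg (smw_nonneg β x j)]

theorem continuous_smw (β : ℝ) (j : ι) : Continuous fun x : ι → ℝ => smw β x j := by
  unfold smw
  refine Continuous.div (by fun_prop) (by fun_prop) fun x => ?_
  exact (Finset.sum_pos (fun k _ => Real.exp_pos _) ⟨j, Finset.mem_univ j⟩).ne'

theorem hasDerivAt_sum_exp (β : ℝ) {x : ℝ → ι → ℝ} {x' : ι → ℝ} {t : ℝ} (hx : HasDerivAt x x' t) :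
    HasDerivAt (fun t => ∑ k, Real.exp (β * x t k)) (∑ k, Real.exp (β * x t k) * (β * x' k)) t :=
  HasDerivAt.fun_sum fun k _ => (((hasDerivAt_pi.1 hx) k).const_mul β).exp

theorem lse_zero (β : ℝ) : lse β (fun _ : ι => 0) = β⁻¹ * Real.log (Fintype.card ι) := by
  simp [lse]

variable [Nonempty ι]

theorem sum_exp_pos (β : ℝ) (x : ι → ℝ) : 0 < ∑ k, Real.exp (β * x k) :=
  Finset.sum_pos (fun _ _ => Real.exp_pos _) Finset.univ_nonempty

theorem sum_smw (β : ℝ) (x : ι → ℝ) : ∑ j, smw β x j = 1 := by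
  unfold smw
  rw [← Finset.sum_div, div_self (sum_exp_pos β x).ne']

theorem smw_le_one (β : ℝ) (x : ι → ℝ) (j : ι) : smw β x j ≤ 1 := by
  rw [← sum_smw β x]
  exact Finset.single_le_sum (fun k _ => smw_nonneg β x k) (Finset.mem_univ j)

theorem avg_const (β : ℝ) (x : ι → ℝ) (r : ℝ) : avg β x (fun _ => r) = r := by
  rw [avg, ← Finset.sum_mul, sum_smw, one_mul]

theorem avg_pow_three_le (β : ℝ) (x : ι → ℝ) {a : ι → ℝ} (h : ∀ j, 0 ≤ a j) :
    avg β x a ^ 3 ≤ avg β x (fun j => a j ^ 3) :=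
  Real.pow_arith_mean_le_arith_mean_pow _ _ _ (fun j _ => smw_nonneg β x j) (sum_smw β x)
    (fun j _ => h j) 3

theorem abs_avg_pow_three_le (β : ℝ) (x a : ι → ℝ) :
    |avg β x a| ^ 3 ≤ avg β x (fun j => |a j| ^ 3) :=
  (pow_le_pow_left₀ (abs_nonneg _) (abs_avg_le β x a) 3).trans
    (avg_pow_three_le β x fun _ => abs_nonneg _)

theorem continuous_lse (β : ℝ) : Continuous fun x : ι → ℝ => lse β x := by
  unfold lse
  refine continuous_const.mul (Continuous.log (by fun_prop) fun x => (sum_exp_pos β x).ne')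

theorem hasDerivAt_lse {β : ℝ} (hβ : β ≠ 0) {x : ℝ → ι → ℝ} {x' : ι → ℝ} {t : ℝ}
    (hx : HasDerivAt x x' t) : HasDerivAt (fun t => lse β (x t)) (avg β (x t) x') t := by
  have h := ((hasDerivAt_sum_exp β hx).log (sum_exp_pos β (x t)).ne').const_mul β⁻¹
  refine h.congr_deriv ?_
  simp only [avg, smw, Finset.sum_div, Finset.mul_sum]
  exact Finset.sum_congr rfl fun j _ => by field_simp

theorem hasDerivAt_smw (β : ℝ) {x : ℝ → ι → ℝ} {x' : ι → ℝ} {t : ℝ}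
    (hx : HasDerivAt x x' t) (j : ι) :
    HasDerivAt (fun t => smw β (x t) j) (β * smw β (x t) j * (x' j - avg β (x t) x')) t := by
  have h := ((((hasDerivAt_pi.1 hx) j).const_mul β).exp).fun_div (hasDerivAt_sum_exp β hx)
    (sum_exp_pos β (x t)).ne'
  refine h.congr_deriv ?_
  have hE := (sum_exp_pos β (x t)).ne'
  have : ∑ k, Real.exp (β * x t k) * (β * x' k)
      = β * avg β (x t) x' * ∑ k, Real.exp (β * x t k) := by
    rw [avg, mul_assoc, Finset.sum_mul, Finset.mul_sum]
    refine Finset.sum_congr rfl fun k _ => ?_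
    rw [smw]
    field_simp
  rw [this, smw]
  field_simp

/-- Differentiating a softmax average gives β times a covariance under the weights. The higher
derivatives of the smooth maximum are therefore cumulants, polynomials in averages. -/
theorem hasDerivAt_avg (β : ℝ) {x : ℝ → ι → ℝ} {x' : ι → ℝ} {t : ℝ}
    (hx : HasDerivAt x x' t) (a : ι → ℝ) :
    HasDerivAt (fun t => avg β (x t) a)
      (β * (avg β (x t) (a * x') - avg β (x t) a * avg β (x t) x')) t := by
  have h := HasDerivAt.fun_sum (u := Finset.univ)
    fun j _ => (hasDerivAt_smw β hx j).mul_const (a j)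
  refine h.congr_deriv ?_
  simp only [mul_sub, sub_mul, Finset.sum_sub_distrib]
  congr 1
  · simp only [avg, Finset.mul_sum, Pi.mul_apply]
    exact Finset.sum_congr rfl fun j _ => by ring
  · change _ = β * ((∑ k, smw β (x t) k * a k) * avg β (x t) x')
    rw [Finset.sum_mul, Finset.mul_sum]
    exact Finset.sum_congr rfl fun j _ => by ring

/-- The numerator and the normalizing sum each change by a factor of at most exp (βδ), hence the 2.
For δ = β⁻¹ the weights at nearby points are comparable up to a constant. -/
theorem smw_add_le {β δ : ℝ} (hβ : 0 ≤ β) {z : ι → ℝ} (hz : ∀ j, |z j| ≤ δ) (x : ι → ℝ) (j : ι) :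
    smw β (x + z) j ≤ Real.exp (2 * (β * δ)) * smw β x j := by
  have h1 : Real.exp (β * (x + z) j) ≤ Real.exp (β * δ) * Real.exp (β * x j) := by
    rw [← Real.exp_add]
    apply Real.exp_le_exp.2
    have := mul_le_mul_of_nonneg_left ((le_abs_self _).trans (hz j)) hβ
    simp only [Pi.add_apply]; linarith
  have h2 : Real.exp (-(β * δ)) * ∑ k, Real.exp (β * x k) ≤ ∑ k, Real.exp (β * (x + z) k) := by
    rw [Finset.mul_sum]
    refine Finset.sum_le_sum fun k _ => ?_
    rw [← Real.exp_add]
    apply Real.exp_le_exp.2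
    have := mul_le_mul_of_nonneg_left ((neg_le_abs _).trans (hz k)) hβ
    simp only [Pi.add_apply]; linarith
  unfold smw
  calc _ ≤ Real.exp (β * δ) * Real.exp (β * x j) /
        (Real.exp (-(β * δ)) * ∑ k, Real.exp (β * x k)) :=
        div_le_div₀ (by positivity) h1 (mul_pos (Real.exp_pos _) (sum_exp_pos β x)) h2
    _ = _ := by
      rw [two_mul, Real.exp_add, Real.exp_neg]
      field_simp

theorem lse_mono {β : ℝ} (hβ : 0 < β) {x y : ι → ℝ} (h : ∀ j, x j ≤ y j) : lse β x ≤ lse β y := by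
  unfold lse
  refine mul_le_mul_of_nonneg_left (Real.log_le_log (sum_exp_pos β x) ?_) (inv_nonneg.2 hβ.le)
  exact Finset.sum_le_sum fun k _ => Real.exp_le_exp.2 (mul_le_mul_of_nonneg_left (h k) hβ.le)

theorem lse_add_const {β : ℝ} (hβ : 0 < β) (x : ι → ℝ) (r : ℝ) :
    lse β (fun j => x j + r) = lse β x + r := by
  unfold lse
  have : ∑ k, Real.exp (β * (x k + r)) = Real.exp (β * r) * ∑ k, Real.exp (β * x k) := by
    rw [Finset.mul_sum]
    refine Finset.sum_congr rfl fun k _ => ?_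
    rw [← Real.exp_add]; ring_nf
  rw [this, Real.log_mul (Real.exp_pos _).ne' (sum_exp_pos β x).ne', Real.log_exp]
  field_simp
  ring

theorem le_lse {β : ℝ} (hβ : 0 < β) (x : ι → ℝ) (j : ι) : x j ≤ lse β x := by
  unfold lse
  rw [le_inv_mul_iff₀ hβ, Real.le_log_iff_exp_le (sum_exp_pos β x)]
  exact Finset.single_le_sum (f := fun k => Real.exp (β * x k))
    (fun k _ => (Real.exp_pos _).le) (Finset.mem_univ j)

/-- With `le_lse` this places the smooth maximum within β⁻¹ log K of the true maximum, the error
that φ and β have to balance. -/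
theorem lse_le_of_forall_le {β : ℝ} (hβ : 0 < β) {x : ι → ℝ} {r : ℝ} (h : ∀ j, x j ≤ r) :
    lse β x ≤ r + β⁻¹ * Real.log (Fintype.card ι) := by
  refine (lse_mono hβ (y := fun _ : ι => 0 + r) fun j => by simpa using h j).trans ?_
  rw [lse_add_const hβ (fun _ => 0) r, lse_zero]
  linarith

/-- Monotonicity and equivariance under constant shifts make the smooth maximum 1-Lipschitz for the
sup norm. -/
theorem lse_add_le {β δ : ℝ} (hβ : 0 < β) {z : ι → ℝ} (hz : ∀ j, |z j| ≤ δ) (x : ι → ℝ) :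
    |lse β (x + z) - lse β x| ≤ δ := by
  have h1 := lse_mono hβ (x := x + z) (y := fun j => x j + δ) fun j => by
    simpa using (le_abs_self _).trans (hz j)
  have h2 := lse_mono hβ (x := fun j => x j + -δ) (y := x + z) fun j => by
    have := (neg_le_abs _).trans (hz j)
    simp only [Pi.add_apply]; linarith
  rw [lse_add_const hβ] at h1 h2
  rw [abs_le]
  constructor <;> linarith

end Softmax

/-! ### The smooth orthant indicator and its first three derivatives. -/

section SmoothIndicator

variable {ι : Type*} [Fintype ι]

/-- The smooth indicator `cutoff (φ F_β)` of a lower orthant, where `F_β` is the smooth maximum. -/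
def smoothInd (φ β : ℝ) (x : ι → ℝ) : ℝ := cutoff (φ * lse β x)

/-- The first derivative of `smoothInd φ β` at `x`. -/
def smoothInd₁ (φ β : ℝ) (x a : ι → ℝ) : ℝ :=
  iteratedDeriv 1 cutoff (φ * lse β x) * (φ * avg β x a)

/-- The second derivative of `smoothInd φ β` at `x`. -/
def smoothInd₂ (φ β : ℝ) (x a b : ι → ℝ) : ℝ :=
  iteratedDeriv 2 cutoff (φ * lse β x) * (φ * avg β x b) * (φ * avg β x a) +
    iteratedDeriv 1 cutoff (φ * lse β x) *
      (φ * (β * (avg β x (a * b) - avg β x a * avg β x b)))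

/-- The third derivative of `smoothInd φ β` at `x`. -/
def smoothInd₃ (φ β : ℝ) (x a b c : ι → ℝ) : ℝ :=
  iteratedDeriv 3 cutoff (φ * lse β x) *
      (φ ^ 3 * (avg β x a * avg β x b * avg β x c)) +
    iteratedDeriv 2 cutoff (φ * lse β x) * (φ ^ 2 * β *
      ((avg β x (b * c) * avg β x a - avg β x a * avg β x b * avg β x c) +
        (avg β x (a * c) * avg β x b - avg β x a * avg β x b * avg β x c) +
        (avg β x (a * b) * avg β x c - avg β x a * avg β x b * avg β x c))) +
    iteratedDeriv 1 cutoff (φ * lse β x) * (φ * β ^ 2 *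
      (avg β x (a * b * c) - avg β x (a * b) * avg β x c -
        avg β x (a * c) * avg β x b - avg β x (b * c) * avg β x a +
        2 * (avg β x a * avg β x b * avg β x c)))

section Linear

variable (φ β : ℝ) (x a b c d : ι → ℝ) (r : ℝ)

theorem smoothInd₁_add : smoothInd₁ φ β x (a + b) = smoothInd₁ φ β x a + smoothInd₁ φ β x b := by
  simp only [smoothInd₁, avg_add]; ring

theorem smoothInd₁_smul : smoothInd₁ φ β x (r • a) = r * smoothInd₁ φ β x a := by
  simp only [smoothInd₁, avg_smul]; ring

theorem smoothInd₂_comm : smoothInd₂ φ β x a b = smoothInd₂ φ β x b a := by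
  simp only [smoothInd₂, mul_comm a b]; ring

theorem smoothInd₂_add :
    smoothInd₂ φ β x a (b + c) = smoothInd₂ φ β x a b + smoothInd₂ φ β x a c := by
  simp only [smoothInd₂, mul_add, avg_add]; ring

theorem smoothInd₂_smul : smoothInd₂ φ β x a (r • b) = r * smoothInd₂ φ β x a b := by
  simp only [smoothInd₂, mul_smul_comm, avg_smul]; ring

theorem smoothInd₃_comm : smoothInd₃ φ β x a b c = smoothInd₃ φ β x a c b := by
  simp only [smoothInd₃, mul_comm c b, mul_right_comm a c b]; ring

theorem smoothInd₃_add :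
    smoothInd₃ φ β x a b (c + d) = smoothInd₃ φ β x a b c + smoothInd₃ φ β x a b d := by
  simp only [smoothInd₃, mul_add, avg_add]; ring

theorem smoothInd₃_smul : smoothInd₃ φ β x a b (r • c) = r * smoothInd₃ φ β x a b c := by
  simp only [smoothInd₃, mul_smul_comm, avg_smul]; ring

/-- The first derivative as a linear map. -/
def smoothInd₁Lin : (ι → ℝ) →ₗ[ℝ] ℝ where
  toFun := smoothInd₁ φ β x
  map_add' := smoothInd₁_add φ β x
  map_smul' r a := smoothInd₁_smul φ β x a r

/-- The second derivative as a linear map in its last argument. -/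
def smoothInd₂Lin : (ι → ℝ) →ₗ[ℝ] ℝ where
  toFun := smoothInd₂ φ β x a
  map_add' := smoothInd₂_add φ β x a
  map_smul' r b := smoothInd₂_smul φ β x a b r

/-- The third derivative as a linear map in its last argument. -/
def smoothInd₃Lin : (ι → ℝ) →ₗ[ℝ] ℝ where
  toFun := smoothInd₃ φ β x a b
  map_add' := smoothInd₃_add φ β x a b
  map_smul' r c := smoothInd₃_smul φ β x a b c r

theorem smoothInd₁_sum {κ : Type*} (s : Finset κ) (y : κ → ι → ℝ) :
    smoothInd₁ φ β x (r • ∑ i ∈ s, y i) = r * ∑ i ∈ s, smoothInd₁ φ β x (y i) := by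
  have := map_sum (smoothInd₁Lin φ β x) y s
  rw [smoothInd₁_smul]; congr 1

theorem smoothInd₂_sum {κ : Type*} (s : Finset κ) (y : κ → ι → ℝ) :
    smoothInd₂ φ β x a (r • ∑ i ∈ s, y i) = r * ∑ i ∈ s, smoothInd₂ φ β x a (y i) := by
  have := map_sum (smoothInd₂Lin φ β x a) y s
  rw [smoothInd₂_smul]; congr 1

theorem smoothInd₃_sum {κ : Type*} (s : Finset κ) (y : κ → ι → ℝ) :
    smoothInd₃ φ β x a b (r • ∑ i ∈ s, y i) = r * ∑ i ∈ s, smoothInd₃ φ β x a b (y i) := by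
  have := map_sum (smoothInd₃Lin φ β x a b) y s
  rw [smoothInd₃_smul]; congr 1

/-- Coordinates separate the point where the Hessian is taken from the directions it is applied to,
so that expectations factor under independence. -/
theorem smoothInd₂_eq_sum [DecidableEq ι] : smoothInd₂ φ β x a b =
    ∑ j, ∑ k, smoothInd₂ φ β x (Pi.single j 1) (Pi.single k 1) * (a j * b k) := by
  -- The scalar 1 gives the expansion the shape r • ∑ required by `smoothInd₂_sum`.
  have expand : ∀ u : ι → ℝ, u = (1 : ℝ) • ∑ j, u j • (Pi.single j 1 : ι → ℝ) := by
    intro u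
    ext k
    simp [Finset.sum_apply, Pi.single_apply]
  conv_lhs => rw [expand b, smoothInd₂_sum, one_mul]
  rw [Finset.sum_comm]
  refine Finset.sum_congr rfl fun k _ => ?_
  rw [smoothInd₂_smul, smoothInd₂_comm]
  conv_lhs => rw [expand a, smoothInd₂_sum, one_mul, Finset.mul_sum]
  refine Finset.sum_congr rfl fun j _ => ?_
  rw [smoothInd₂_smul, smoothInd₂_comm]
  ring

end Linear

variable [Nonempty ι]

theorem hasDerivAt_iteratedDeriv_cutoff_lse {φ β : ℝ} (hβ : β ≠ 0) {x : ℝ → ι → ℝ} {x' : ι → ℝ}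
    {t : ℝ} (hx : HasDerivAt x x' t) {k : ℕ} (hk : k < 4) :
    HasDerivAt (fun t => iteratedDeriv k cutoff (φ * lse β (x t)))
      (iteratedDeriv (k + 1) cutoff (φ * lse β (x t)) * (φ * avg β (x t) x')) t :=
  (hasDerivAt_iteratedDeriv_cutoff hk _).comp t ((hasDerivAt_lse hβ hx).const_mul φ)

theorem hasDerivAt_smoothInd (φ : ℝ) {β : ℝ} (hβ : β ≠ 0) {x : ℝ → ι → ℝ} {x' : ι → ℝ}
    {t : ℝ} (hx : HasDerivAt x x' t) :
    HasDerivAt (fun t => smoothInd φ β (x t)) (smoothInd₁ φ β (x t) x') t := by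
  have h := hasDerivAt_iteratedDeriv_cutoff_lse (φ := φ) hβ hx (k := 0) (by norm_num)
  rw [iteratedDeriv_zero] at h
  exact h

theorem hasDerivAt_smoothInd₁ (φ : ℝ) {β : ℝ} (hβ : β ≠ 0) {x : ℝ → ι → ℝ} {x' : ι → ℝ}
    {t : ℝ} (hx : HasDerivAt x x' t) (a : ι → ℝ) :
    HasDerivAt (fun t => smoothInd₁ φ β (x t) a) (smoothInd₂ φ β (x t) a x') t := by
  have h := (hasDerivAt_iteratedDeriv_cutoff_lse (φ := φ) hβ hx (k := 1) (by norm_num)).mul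
    ((hasDerivAt_avg β hx a).const_mul φ)
  exact h

theorem hasDerivAt_smoothInd₂ (φ : ℝ) {β : ℝ} (hβ : β ≠ 0) {x : ℝ → ι → ℝ} {x' : ι → ℝ}
    {t : ℝ} (hx : HasDerivAt x x' t) (a b : ι → ℝ) :
    HasDerivAt (fun t => smoothInd₂ φ β (x t) a b) (smoothInd₃ φ β (x t) a b x') t := by
  have h2 := hasDerivAt_iteratedDeriv_cutoff_lse (φ := φ) hβ hx (k := 2) (by norm_num)
  have h1 := hasDerivAt_iteratedDeriv_cutoff_lse (φ := φ) hβ hx (k := 1) (by norm_num)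
  have ha := hasDerivAt_avg β hx a
  have hb := hasDerivAt_avg β hx b
  have hab := hasDerivAt_avg β hx (a * b)
  have h := ((h2.mul (hb.const_mul φ)).mul (ha.const_mul φ)).add
    (h1.mul ((((hab.sub (ha.mul hb)).const_mul β)).const_mul φ))
  refine h.congr_deriv ?_
  simp only [smoothInd₃, Pi.mul_apply, Pi.sub_apply]
  ring

end SmoothIndicator


/-! ### Dimension-free bounds for the derivatives. -/

section DerivativeBounds

variable {ι : Type*} [Fintype ι]

/-- The weighted sum of cubes `∑ w_j |a_j|³`. -/
def cub (w a : ι → ℝ) : ℝ := ∑ j, w j * |a j| ^ 3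

theorem cub_nonneg {w : ι → ℝ} (hw : ∀ j, 0 ≤ w j) (a : ι → ℝ) : 0 ≤ cub w a :=
  Finset.sum_nonneg fun j _ => mul_nonneg (hw j) (by positivity)

theorem cub_mono {w w' : ι → ℝ} (hw : ∀ j, w j ≤ w' j) (a : ι → ℝ) : cub w a ≤ cub w' a :=
  Finset.sum_le_sum fun j _ => mul_le_mul_of_nonneg_right (hw j) (by positivity)

theorem cub_smul (r : ℝ) (w a : ι → ℝ) : cub (r • w) a = r * cub w a := by
  simp [cub, Finset.mul_sum, mul_assoc]

/-- The points at which the smooth maximum lies in `[-k/φ, (1+k)/φ]`. -/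
def shell (φ β : ℝ) (k : ℝ) : Set (ι → ℝ) := {x | -k ≤ φ * lse β x ∧ φ * lse β x ≤ 1 + k}

/-- The product is at most the cube of the largest factor. This turns mixed third-order terms into
cubes of single vectors, so only third moments of one summand at a time are needed. -/
theorem mul_mul_le_cubes {x y z : ℝ} (hx : 0 ≤ x) (hy : 0 ≤ y) (hz : 0 ≤ z) :
    x * y * z ≤ x ^ 3 + y ^ 3 + z ^ 3 := by
  have h : ∀ u v w : ℝ, 0 ≤ u → 0 ≤ v → 0 ≤ w → v ≤ u → w ≤ u → u * v * w ≤ u ^ 3 := by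
    intro u v w hu hv hw h1 h2
    calc u * v * w ≤ u * u * u := by gcongr
      _ = u ^ 3 := by ring
  have hx3 := pow_nonneg hx 3
  have hy3 := pow_nonneg hy 3
  have hz3 := pow_nonneg hz 3
  rcases le_total x y with h1 | h1 <;> rcases le_total y z with h2 | h2 <;>
    rcases le_total x z with h3 | h3
  · have := h z x y hz hx hy h3 h2; nlinarith
  · have := h z x y hz hx hy (h1.trans h2) h2; nlinarith
  · have := h y x z hy hx hz h1 h2; nlinarith
  · have := h y x z hy hx hz h1 h2; nlinarith
  · have := h z x y hz hx hy h3 h2; nlinarith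
  · have := h x y z hx hy hz h1 h3; nlinarith
  · have := h x y z hx hy hz h1 (h2.trans h1); nlinarith
  · have := h x y z hx hy hz h1 h3; nlinarith

theorem abs_mul_mul_le_cubes (x y z : ℝ) :
    |x * y * z| ≤ |x| ^ 3 + |y| ^ 3 + |z| ^ 3 := by
  rw [abs_mul, abs_mul]
  exact mul_mul_le_cubes (abs_nonneg x) (abs_nonneg y) (abs_nonneg z)

theorem avg_abs_cube (β : ℝ) (x a : ι → ℝ) : avg β x (fun j => |a j| ^ 3) = cub (smw β x) a := rfl

theorem abs_avg_mul_mul_le (β : ℝ) (x a b c : ι → ℝ) :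
    |avg β x (a * b * c)| ≤ cub (smw β x) a + cub (smw β x) b + cub (smw β x) c := by
  simp only [← avg_abs_cube, ← avg_add]
  exact (abs_avg_le β x _).trans (avg_mono β x fun j => abs_mul_mul_le_cubes _ _ _)

variable [Nonempty ι]

theorem abs_avg_le_norm (β : ℝ) (x a : ι → ℝ) : |avg β x a| ≤ ‖a‖ := by
  refine (abs_avg_le β x a).trans ?_
  refine (avg_mono β x (b := fun _ => ‖a‖) fun j => norm_le_pi_norm a j).trans ?_
  rw [avg_const]

/-- The outer average is pulled inside as a constant function, which reduces to the triple product;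
Jensen's inequality handles the cube of that constant. -/
theorem abs_avg_mul_avg_le (β : ℝ) (x a b c : ι → ℝ) :
    |avg β x (a * b) * avg β x c| ≤ cub (smw β x) a + cub (smw β x) b + cub (smw β x) c := by
  have h := abs_avg_mul_mul_le β x a b (fun _ => avg β x c)
  have h1 : a * b * (fun _ => avg β x c) = avg β x c • (a * b) := by
    ext j; simp [mul_comm]
  rw [h1, avg_smul, mul_comm] at h
  refine h.trans (add_le_add le_rfl ?_)
  rw [← avg_abs_cube, avg_const, ← avg_abs_cube]
  exact abs_avg_pow_three_le β x c

theorem abs_avg_avg_avg_le (β : ℝ) (x a b c : ι → ℝ) :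
    |avg β x a * avg β x b * avg β x c| ≤
      cub (smw β x) a + cub (smw β x) b + cub (smw β x) c :=
  (abs_mul_mul_le_cubes _ _ _).trans
    (add_le_add (add_le_add (abs_avg_pow_three_le β x a) (abs_avg_pow_three_le β x b))
      (abs_avg_pow_three_le β x c))

theorem abs_smoothInd₁_le {φ : ℝ} (hφ : 0 ≤ φ) (β : ℝ) (x a : ι → ℝ) :
    |smoothInd₁ φ β x a| ≤ cutoffBound * φ * ‖a‖ := by
  have hM : (0 : ℝ) ≤ cutoffBound := zero_le_one.trans one_le_cutoffBound
  have h := abs_iteratedDeriv_cutoff_le (k := 1) (by simp) (φ * lse β x)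
  have h' : |iteratedDeriv 1 cutoff (φ * lse β x)| ≤ cutoffBound :=
    h.trans (by split_ifs <;> linarith)
  rw [smoothInd₁, abs_mul, abs_mul, abs_of_nonneg hφ, mul_assoc]
  gcongr
  exact abs_avg_le_norm β x a

theorem abs_smoothInd₂_le {φ β : ℝ} (hφ : 0 ≤ φ) (hφβ : φ ≤ β) (x a b : ι → ℝ) :
    |smoothInd₂ φ β x a b| ≤ 3 * cutoffBound * φ * β * (‖a‖ * ‖b‖) := by
  have hM : (0 : ℝ) ≤ cutoffBound := zero_le_one.trans one_le_cutoffBound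
  have hβ : 0 ≤ β := hφ.trans hφβ
  have h1 : |iteratedDeriv 1 cutoff (φ * lse β x)| ≤ cutoffBound :=
    (abs_iteratedDeriv_cutoff_le (k := 1) (by simp) _).trans (by split_ifs <;> linarith)
  have h2 : |iteratedDeriv 2 cutoff (φ * lse β x)| ≤ cutoffBound :=
    (abs_iteratedDeriv_cutoff_le (k := 2) (by simp) _).trans (by split_ifs <;> linarith)
  have ha := abs_avg_le_norm β x a
  have hb := abs_avg_le_norm β x b
  have hab : |avg β x a * avg β x b| ≤ ‖a‖ * ‖b‖ := by
    rw [abs_mul]; gcongr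
  have hab' : |avg β x (a * b)| ≤ ‖a‖ * ‖b‖ :=
    (abs_avg_le_norm β x _).trans (norm_mul_le a b)
  have e : smoothInd₂ φ β x a b =
      iteratedDeriv 2 cutoff (φ * lse β x) * (φ * φ * (avg β x a * avg β x b)) +
      iteratedDeriv 1 cutoff (φ * lse β x) *
        (φ * β * (avg β x (a * b) - avg β x a * avg β x b)) := by
    rw [smoothInd₂]; ring
  have t1 : |iteratedDeriv 2 cutoff (φ * lse β x) * (φ * φ * (avg β x a * avg β x b))| ≤
      cutoffBound * (φ * β * (‖a‖ * ‖b‖)) := by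
    rw [abs_mul, abs_mul (φ * φ), abs_of_nonneg (mul_nonneg hφ hφ)]
    gcongr
  have t2 : |iteratedDeriv 1 cutoff (φ * lse β x) *
        (φ * β * (avg β x (a * b) - avg β x a * avg β x b))| ≤
      cutoffBound * (φ * β * (‖a‖ * ‖b‖ + ‖a‖ * ‖b‖)) := by
    rw [abs_mul, abs_mul (φ * β), abs_of_nonneg (mul_nonneg hφ hβ)]
    gcongr
    exact (abs_sub _ _).trans (add_le_add hab' hab)
  rw [e]
  refine (abs_add_le _ _).trans ((add_le_add t1 t2).trans (le_of_eq (by ring)))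

/-- Every term contains a derivative of the cutoff, whence the shell, and a polynomial in averages
bounded by weighted cubes. The hypothesis φ ≤ β lets φβ² dominate φ³ and φ²β, and 13 = 1 + 6 + 6
counts the averages in the three groups of terms. -/
theorem abs_smoothInd₃_le {φ β : ℝ} (hφ : 0 ≤ φ) (hφβ : φ ≤ β) (x a b c : ι → ℝ) :
    |smoothInd₃ φ β x a b c| ≤ 13 * cutoffBound * φ * β ^ 2 *
      ((shell φ β 0).indicator 1 x *
        (cub (smw β x) a + cub (smw β x) b + cub (smw β x) c)) := by
  have hM : (0 : ℝ) ≤ cutoffBound := zero_le_one.trans one_le_cutoffBound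
  have hβ : 0 ≤ β := hφ.trans hφβ
  have hk : ∀ k ∈ ({1, 2, 3} : Finset ℕ), |iteratedDeriv k cutoff (φ * lse β x)| ≤
      cutoffBound * (shell φ β 0).indicator 1 x := by
    intro k hk
    refine (abs_iteratedDeriv_cutoff_le hk (φ * lse β x)).trans (le_of_eq ?_)
    have : (x ∈ (shell φ β 0 : Set (ι → ℝ))) ↔ (0 ≤ φ * lse β x ∧ φ * lse β x ≤ 1) := by
      simp [shell]
    by_cases hx : x ∈ (shell φ β 0 : Set (ι → ℝ))
    · rw [if_pos (this.1 hx), Set.indicator_of_mem hx]; simp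
    · rw [if_neg (fun h => hx (this.2 h)), Set.indicator_of_notMem hx]; simp
  have h1 := hk 1 (by simp)
  have h2 := hk 2 (by simp)
  have h3 := hk 3 (by simp)
  set T := cub (smw β x) a + cub (smw β x) b + cub (smw β x) c with hT
  set I : ℝ := (shell φ β 0).indicator 1 x with hI
  have hI0 : 0 ≤ I := Set.indicator_nonneg (fun _ _ => zero_le_one) x
  have p := abs_avg_avg_avg_le β x a b c
  have q1 := abs_avg_mul_avg_le β x a b c
  have q2 := abs_avg_mul_avg_le β x a c b
  have q3 := abs_avg_mul_avg_le β x b c a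
  have r := abs_avg_mul_mul_le β x a b c
  rw [← hT] at p q1 r
  replace q2 : |avg β x (a * c) * avg β x b| ≤ T := q2.trans (le_of_eq (by rw [hT]; ring))
  replace q3 : |avg β x (b * c) * avg β x a| ≤ T := q3.trans (le_of_eq (by rw [hT]; ring))
  have hT0 : 0 ≤ T := (abs_nonneg _).trans p
  set P := avg β x a * avg β x b * avg β x c
  set Q1 := avg β x (a * b) * avg β x c
  set Q2 := avg β x (a * c) * avg β x b
  set Q3 := avg β x (b * c) * avg β x a
  set R := avg β x (a * b * c)
  rw [abs_le] at p q1 q2 q3 r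
  have s2 : |(Q3 - P) + (Q2 - P) + (Q1 - P)| ≤ 6 * T := abs_le.2 ⟨by linarith, by linarith⟩
  have s1 : |R - Q1 - Q2 - Q3 + 2 * P| ≤ 6 * T := abs_le.2 ⟨by linarith, by linarith⟩
  have hp3 : φ ^ 3 ≤ φ * β ^ 2 := by
    calc φ ^ 3 = φ * φ ^ 2 := by ring
      _ ≤ _ := by gcongr
  have hp2 : φ ^ 2 * β ≤ φ * β ^ 2 := by
    calc φ ^ 2 * β = φ * φ * β := by ring
      _ ≤ φ * β * β := by gcongr
      _ = _ := by ring
  have t3 : |iteratedDeriv 3 cutoff (φ * lse β x) * (φ ^ 3 * P)| ≤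
      cutoffBound * I * (φ * β ^ 2 * T) := by
    rw [abs_mul, abs_mul (φ ^ 3), abs_of_nonneg (by positivity : (0 : ℝ) ≤ φ ^ 3)]
    gcongr
    exact abs_le.2 p
  have t2 : |iteratedDeriv 2 cutoff (φ * lse β x) * (φ ^ 2 * β *
      ((Q3 - P) + (Q2 - P) + (Q1 - P)))| ≤ cutoffBound * I * (φ * β ^ 2 * (6 * T)) := by
    rw [abs_mul, abs_mul (φ ^ 2 * β), abs_of_nonneg (by positivity : (0 : ℝ) ≤ φ ^ 2 * β)]
    gcongr
  have t1 : |iteratedDeriv 1 cutoff (φ * lse β x) * (φ * β ^ 2 *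
      (R - Q1 - Q2 - Q3 + 2 * P))| ≤ cutoffBound * I * (φ * β ^ 2 * (6 * T)) := by
    rw [abs_mul, abs_mul (φ * β ^ 2), abs_of_nonneg (by positivity : (0 : ℝ) ≤ φ * β ^ 2)]
    gcongr
  calc _ ≤ cutoffBound * I * (φ * β ^ 2 * T) + cutoffBound * I * (φ * β ^ 2 * (6 * T)) +
        cutoffBound * I * (φ * β ^ 2 * (6 * T)) :=
        (abs_add_three _ _ _).trans (add_le_add (add_le_add t3 t2) t1)
    _ = _ := by ring

/-- A shift of size β⁻¹ moves φ times the smooth maximum by at most φ/β ≤ 1, so one unit of extra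
width on each side absorbs it. -/
theorem indicator_shell_add_le {φ β k : ℝ} (hφ : 0 < φ) (hφβ : φ ≤ β) {z : ι → ℝ}
    (hz : ∀ j, |z j| ≤ β⁻¹) (x : ι → ℝ) :
    (shell φ β k).indicator (1 : (ι → ℝ) → ℝ) (x + z) ≤ (shell φ β (k + 1)).indicator 1 x := by
  have hβ : 0 < β := hφ.trans_le hφβ
  have h := abs_le.1 (lse_add_le hβ hz x)
  have h1 : φ * β⁻¹ ≤ 1 := by
    rw [← div_eq_mul_inv]; exact (div_le_one hβ).2 hφβ
  by_cases hx : x + z ∈ (shell φ β k : Set (ι → ℝ))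
  · rw [Set.indicator_of_mem hx, Set.indicator_of_mem]
    · simp
    · obtain ⟨ha, hb⟩ := hx
      have u1 := mul_le_mul_of_nonneg_left h.1 hφ.le
      have u2 := mul_le_mul_of_nonneg_left h.2 hφ.le
      constructor <;> linarith
  · rw [Set.indicator_of_notMem hx]
    exact Set.indicator_nonneg (fun _ _ => zero_le_one) x

theorem indicator_shell_mul_smw_add_le {φ β k : ℝ} (hφ : 0 < φ) (hφβ : φ ≤ β) {z : ι → ℝ}
    (hz : ∀ j, |z j| ≤ β⁻¹) (x : ι → ℝ) (j : ι) :
    (shell φ β k).indicator (1 : (ι → ℝ) → ℝ) (x + z) * smw β (x + z) j ≤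
      Real.exp 2 * ((shell φ β (k + 1)).indicator 1 x * smw β x j) := by
  have hβ : 0 < β := hφ.trans_le hφβ
  have h1 := indicator_shell_add_le (k := k) hφ hφβ hz x
  have h2 := smw_add_le hβ.le hz x j
  rw [mul_inv_cancel₀ hβ.ne', mul_one] at h2
  calc _ ≤ (shell φ β (k + 1)).indicator (1 : (ι → ℝ) → ℝ) x * (Real.exp 2 * smw β x j) :=
        mul_le_mul h1 h2 (smw_nonneg _ _ _) (Set.indicator_nonneg (fun _ _ => zero_le_one) x)
    _ = _ := by ring

/-- The third derivative near `x`, bounded by weights that depend on `x` only. -/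
theorem abs_smoothInd₃_add_le {φ β : ℝ} (hφ : 0 < φ) (hφβ : φ ≤ β) {z : ι → ℝ}
    (hz : ∀ j, |z j| ≤ β⁻¹) {x w : ι → ℝ}
    (hw : ∀ j, Real.exp 2 * ((shell φ β 1).indicator 1 x * smw β x j) ≤ w j) (a b c : ι → ℝ) :
    |smoothInd₃ φ β (x + z) a b c| ≤
      13 * cutoffBound * φ * β ^ 2 * (cub w a + cub w b + cub w c) := by
  have hM : (0 : ℝ) ≤ cutoffBound := zero_le_one.trans one_le_cutoffBound
  refine (abs_smoothInd₃_le hφ.le hφβ (x + z) a b c).trans ?_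
  refine mul_le_mul_of_nonneg_left ?_ (by positivity)
  rw [mul_add, mul_add]
  have key : ∀ u, (shell φ β 0).indicator 1 (x + z) * cub (smw β (x + z)) u ≤ cub w u := by
    intro u
    rw [← cub_smul]
    refine cub_mono (fun j => (le_trans ?_ (hw j))) u
    have := indicator_shell_mul_smw_add_le (k := 0) hφ hφβ hz x j
    rw [zero_add] at this
    exact this
  exact add_le_add (add_le_add (key a) (key b)) (key c)

/-- This crude bound serves the rare event on which some summand is large: there nearby weights are
not comparable, and all of them are replaced by one. -/
theorem abs_smoothInd₃_le_of_one_le {φ β : ℝ} (hφ : 0 ≤ φ) (hφβ : φ ≤ β) {w : ι → ℝ}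
    (hw : ∀ j, 1 ≤ w j) (x a b c : ι → ℝ) :
    |smoothInd₃ φ β x a b c| ≤
      13 * cutoffBound * φ * β ^ 2 * (cub w a + cub w b + cub w c) := by
  have hM : (0 : ℝ) ≤ cutoffBound := zero_le_one.trans one_le_cutoffBound
  refine (abs_smoothInd₃_le hφ hφβ x a b c).trans ?_
  refine mul_le_mul_of_nonneg_left ?_ (by positivity)
  have h1 : (shell φ β 0).indicator (1 : (ι → ℝ) → ℝ) x ≤ 1 :=
    Set.indicator_le_self' (by simp) x
  have key : ∀ u, cub (smw β x) u ≤ cub w u := fun u =>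
    cub_mono (fun j => (smw_le_one β x j).trans (hw j)) u
  have pos : ∀ u, 0 ≤ cub (smw β x) u := cub_nonneg (smw_nonneg β x)
  calc _ ≤ 1 * (cub (smw β x) a + cub (smw β x) b + cub (smw β x) c) :=
        mul_le_mul_of_nonneg_right h1 (add_nonneg (add_nonneg (pos a) (pos b)) (pos c))
    _ ≤ _ := by linarith [key a, key b, key c]

end DerivativeBounds

/-! ### Taylor expansion when summands are removed. -/

section Taylor

variable {ι : Type*} [Fintype ι]

theorem hasDerivAt_add_smul (x z : ι → ℝ) (t : ℝ) : HasDerivAt (fun t : ℝ => x + t • z) z t := by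
  simpa using ((hasDerivAt_id t).smul_const z).const_add x

variable [Nonempty ι]

theorem abs_smoothInd₂_sub_le {β : ℝ} (φ : ℝ) (hβ : β ≠ 0) {x z a b : ι → ℝ} {T : ℝ}
    (hT : ∀ t ∈ Set.Icc (0 : ℝ) 1, |smoothInd₃ φ β (x + t • z) a b z| ≤ T)
    {s t : ℝ} (hs : s ∈ Set.Icc (0 : ℝ) 1) (ht : t ∈ Set.Icc (0 : ℝ) 1) :
    |smoothInd₂ φ β (x + t • z) a b - smoothInd₂ φ β (x + s • z) a b| ≤ T := by
  have h := (convex_Icc (0 : ℝ) 1).norm_image_sub_le_of_norm_hasDerivWithin_le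
    (f := fun t : ℝ => smoothInd₂ φ β (x + t • z) a b)
    (fun t _ => (hasDerivAt_smoothInd₂ φ hβ (hasDerivAt_add_smul x z t) a b).hasDerivWithinAt)
    (fun t ht => hT t ht) hs ht
  have hT0 : 0 ≤ T := (abs_nonneg _).trans (hT s hs)
  have : ‖t - s‖ ≤ 1 := by
    rw [Real.norm_eq_abs, abs_le]
    constructor <;> linarith [hs.1, hs.2, ht.1, ht.2]
  exact h.trans (mul_le_of_le_one_right hT0 this)

/-- The mean value inequality is applied to the first derivative minus its linear part t · f''. The
Hessian sits at the endpoint x + z because Stein's identity needs it at the full sum. -/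
theorem abs_smoothInd₁_sub_sub_le {β : ℝ} (φ : ℝ) (hβ : β ≠ 0) {x z a : ι → ℝ} {T : ℝ}
    (hT : ∀ t ∈ Set.Icc (0 : ℝ) 1, |smoothInd₃ φ β (x + t • z) a z z| ≤ T) :
    |smoothInd₁ φ β (x + z) a - smoothInd₁ φ β x a - smoothInd₂ φ β (x + z) a z| ≤ T := by
  have h0 : (0 : ℝ) ∈ Set.Icc (0 : ℝ) 1 := ⟨le_rfl, zero_le_one⟩
  have h1 : (1 : ℝ) ∈ Set.Icc (0 : ℝ) 1 := ⟨zero_le_one, le_rfl⟩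
  have h := (convex_Icc (0 : ℝ) 1).norm_image_sub_le_of_norm_hasDerivWithin_le
    (f := fun t : ℝ => smoothInd₁ φ β (x + t • z) a - t * smoothInd₂ φ β (x + z) a z)
    (f' := fun t => smoothInd₂ φ β (x + t • z) a z - smoothInd₂ φ β (x + z) a z)
    (fun t _ => ((hasDerivAt_smoothInd₁ φ hβ (hasDerivAt_add_smul x z t) a).sub
      (by simpa using (hasDerivAt_id t).mul_const (smoothInd₂ φ β (x + z) a z))).hasDerivWithinAt)
    (C := T) (fun t ht => by
      have := abs_smoothInd₂_sub_le φ hβ hT h1 ht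
      rw [one_smul] at this
      exact this) h0 h1
  simp only [one_smul, one_mul, zero_smul, zero_mul, sub_zero, add_zero, norm_one, mul_one] at h
  rw [Real.norm_eq_abs] at h
  refine le_trans (le_of_eq ?_) h
  congr 1; ring

/-- Change of the second derivative when part of a sum is removed. -/
theorem abs_smoothInd₂_sub_le_sum {κ : Type*} {φ β c A : ℝ} (hβ : β ≠ 0) (hc : 0 ≤ c)
    {x w : ι → ℝ} {R : Finset κ} {y : κ → ι → ℝ}
    (hA : ∀ t ∈ Set.Icc (0 : ℝ) 1, ∀ a b d : ι → ℝ,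
      |smoothInd₃ φ β (x - t • c • ∑ i ∈ R, y i) a b d| ≤ A * (cub w a + cub w b + cub w d))
    (a b : ι → ℝ) :
    |smoothInd₂ φ β x a b - smoothInd₂ φ β (x - c • ∑ i ∈ R, y i) a b| ≤
      c * A * ∑ i ∈ R, (cub w a + cub w b + cub w (y i)) := by
  set z := c • ∑ i ∈ R, y i with hz
  have h := abs_smoothInd₂_sub_le (x := x - z) (z := z) φ hβ (a := a) (b := b)
    -- The factor c and the sum over R come from expanding the displacement z in the last slot of
    -- the third derivative.
    (T := c * A * ∑ i ∈ R, (cub w a + cub w b + cub w (y i))) (fun t ht => by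
      have e : x - z + t • z = x - (1 - t) • z := by rw [sub_smul, one_smul]; abel
      rw [e]
      nth_rewrite 2 [hz]
      rw [smoothInd₃_sum, abs_mul, abs_of_nonneg hc, mul_assoc, Finset.mul_sum]
      refine mul_le_mul_of_nonneg_left ((Finset.abs_sum_le_sum_abs _ _).trans ?_) hc
      exact Finset.sum_le_sum fun i _ => hA (1 - t) ⟨by linarith [ht.2], by linarith [ht.1]⟩ a b _)
    (s := 0) (t := 1) ⟨le_rfl, zero_le_one⟩ ⟨zero_le_one, le_rfl⟩
  simpa using h

/-- Second-order expansion of the first derivative when part of a sum is removed. -/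
theorem abs_smoothInd₁_sub_sub_le_sum {κ : Type*} {φ β c A : ℝ} (hβ : β ≠ 0) (hc : 0 ≤ c)
    {x w : ι → ℝ} {R : Finset κ} {y : κ → ι → ℝ}
    (hA : ∀ t ∈ Set.Icc (0 : ℝ) 1, ∀ a b d : ι → ℝ,
      |smoothInd₃ φ β (x - t • c • ∑ i ∈ R, y i) a b d| ≤ A * (cub w a + cub w b + cub w d))
    (a : ι → ℝ) :
    |smoothInd₁ φ β x a - smoothInd₁ φ β (x - c • ∑ i ∈ R, y i) a -
        c * ∑ i ∈ R, smoothInd₂ φ β x a (y i)| ≤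
      c ^ 2 * A * ∑ i ∈ R, ∑ k ∈ R, (cub w a + cub w (y i) + cub w (y k)) := by
  set z := c • ∑ i ∈ R, y i with hz
  have h := abs_smoothInd₁_sub_sub_le (x := x - z) (z := z) φ hβ (a := a)
    (T := c ^ 2 * A * ∑ i ∈ R, ∑ k ∈ R, (cub w a + cub w (y i) + cub w (y k))) (fun t ht => by
      have e : x - z + t • z = x - (1 - t) • z := by rw [sub_smul, one_smul]; abel
      have e2 : smoothInd₃ φ β (x - (1 - t) • z) a z z =
          c * ∑ i ∈ R, (c * ∑ k ∈ R, smoothInd₃ φ β (x - (1 - t) • z) a (y i) (y k)) := by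
        conv_lhs => arg 6; rw [hz]
        rw [smoothInd₃_sum]
        congr 1
        refine Finset.sum_congr rfl fun i _ => ?_
        -- Symmetry brings the other copy of z into the last slot, so that it too can be expanded.
        rw [smoothInd₃_comm]
        conv_lhs => arg 6; rw [hz]
        rw [smoothInd₃_sum]
      rw [e, e2, abs_mul, abs_of_nonneg hc, sq, mul_assoc, mul_assoc]
      refine mul_le_mul_of_nonneg_left ((Finset.abs_sum_le_sum_abs _ _).trans ?_) hc
      rw [← mul_assoc, Finset.mul_sum]
      refine Finset.sum_le_sum fun i _ => ?_
      rw [abs_mul, abs_of_nonneg hc, mul_assoc, Finset.mul_sum]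
      refine mul_le_mul_of_nonneg_left ((Finset.abs_sum_le_sum_abs _ _).trans ?_) hc
      exact Finset.sum_le_sum fun k _ =>
        hA (1 - t) ⟨by linarith [ht.2], by linarith [ht.1]⟩ a _ _)
  rw [sub_add_cancel] at h
  have e3 : smoothInd₂ φ β x a z = c * ∑ i ∈ R, smoothInd₂ φ β x a (y i) := smoothInd₂_sum ..
  rwa [e3] at h

end Taylor


/-! ### Exponential moments and the event that a summand is large. -/

section Moments

theorem cube_le_exp {B x : ℝ} (hB : 0 < B) (hx : 0 ≤ x) : x ^ 3 ≤ 6 * B ^ 3 * Real.exp (x / B) := by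
  have h := Real.pow_div_factorial_le_exp (x / B) (by positivity) 3
  rw [div_pow] at h
  have e : (Nat.factorial 3 : ℝ) = 6 := by norm_num [Nat.factorial]
  rw [e, div_div, div_le_iff₀ (by positivity)] at h
  linarith

theorem sq_le_exp {B x : ℝ} (hB : 0 < B) (hx : 0 ≤ x) : x ^ 2 ≤ 2 * B ^ 2 * Real.exp (x / B) := by
  have h := Real.pow_div_factorial_le_exp (x / B) (by positivity) 2
  rw [div_pow] at h
  have e : (Nat.factorial 2 : ℝ) = 2 := by norm_num [Nat.factorial]
  rw [e, div_div, div_le_iff₀ (by positivity)] at h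
  linarith

/-- Half of the exponential rate of y pays for the small factor exp (-τ/(2B)). The
arithmetic-geometric mean inequality then splits the product of exponentials, so x and y need not be
independent; 24 is half of 6 · 2³. -/
theorem cube_le_exp_of_lt {B x y τ : ℝ} (hB : 0 < B) (hx : 0 ≤ x) (hy : τ < y) :
    x ^ 3 ≤ 24 * B ^ 3 * Real.exp (-(τ / (2 * B))) * (Real.exp (x / B) + Real.exp (y / B)) := by
  have h1 := cube_le_exp (B := 2 * B) (by positivity) hx
  have h2 : Real.exp (x / (2 * B)) ≤ Real.exp (-(τ / (2 * B))) *
      (Real.exp (x / (2 * B)) * Real.exp (y / (2 * B))) := by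
    rw [← Real.exp_add, ← Real.exp_add]
    apply Real.exp_le_exp.2
    have := div_le_div_of_nonneg_right hy.le (by positivity : (0 : ℝ) ≤ 2 * B)
    linarith
  have h3 : ∀ u : ℝ, Real.exp (u / B) = Real.exp (u / (2 * B)) ^ 2 := by
    intro u
    rw [← Real.exp_nat_mul]; congr 1; push_cast; field_simp
  rw [h3 x, h3 y]
  have h4 := two_mul_le_add_sq (Real.exp (x / (2 * B))) (Real.exp (y / (2 * B)))
  have hE := Real.exp_pos (-(τ / (2 * B)))
  calc x ^ 3 ≤ 6 * (2 * B) ^ 3 * Real.exp (x / (2 * B)) := h1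
    _ ≤ 6 * (2 * B) ^ 3 * (Real.exp (-(τ / (2 * B))) *
      (Real.exp (x / (2 * B)) * Real.exp (y / (2 * B)))) := by gcongr
    _ = 24 * B ^ 3 * Real.exp (-(τ / (2 * B))) *
        (2 * Real.exp (x / (2 * B)) * Real.exp (y / (2 * B))) := by ring
    _ ≤ _ := by gcongr

theorem one_le_exp_of_lt {B y τ : ℝ} (hB : 0 < B) (hτ : 0 ≤ τ) (hy : τ < y) :
    1 ≤ Real.exp (-(τ / (2 * B))) * Real.exp (y / B) := by
  rw [← Real.exp_add, Real.one_le_exp_iff]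
  have h1 : τ / (2 * B) ≤ τ / B := by gcongr; linarith
  have h2 : τ / B ≤ y / B := by gcongr
  linarith

variable {Ω : Type*} [MeasurableSpace Ω] {μ : Measure Ω} {ι κ : Type*}

/-- All coordinates have exponential moments at the scale `B`. -/
structure SubExp (B : ℝ) (Y : κ → Ω → ι → ℝ) (μ : Measure Ω) : Prop where
  pos : 0 < B
  measurable : ∀ t, Measurable (Y t)
  integrable : ∀ t j, Integrable (fun ω => Real.exp (|Y t ω j| / B)) μ
  le : ∀ t j, ∫ ω, Real.exp (|Y t ω j| / B) ∂μ ≤ 6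

variable {B τ : ℝ} {Y : κ → Ω → ι → ℝ}

theorem SubExp.measurable_eval (hY : SubExp B Y μ) (t : κ) (j : ι) :
    Measurable fun ω => Y t ω j := (measurable_pi_apply j).comp (hY.measurable t)

theorem SubExp.integrable_cube (hY : SubExp B Y μ) (t : κ) (j : ι) :
    Integrable (fun ω => |Y t ω j| ^ 3) μ := by
  have hm := hY.measurable_eval t j
  refine ((hY.integrable t j).const_mul (6 * B ^ 3)).mono'
    (by fun_prop) (ae_of_all _ fun ω => ?_)
  rw [Real.norm_eq_abs, abs_of_nonneg (by positivity)]
  exact cube_le_exp hY.pos (abs_nonneg _)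

theorem SubExp.integral_cube_le (hY : SubExp B Y μ) (t : κ) (j : ι) :
    ∫ ω, |Y t ω j| ^ 3 ∂μ ≤ 36 * B ^ 3 := by
  have hB := hY.pos
  calc ∫ ω, |Y t ω j| ^ 3 ∂μ ≤ ∫ ω, 6 * B ^ 3 * Real.exp (|Y t ω j| / B) ∂μ :=
        integral_mono (hY.integrable_cube t j) ((hY.integrable t j).const_mul _)
          fun ω => cube_le_exp hB (abs_nonneg _)
    _ = 6 * B ^ 3 * ∫ ω, Real.exp (|Y t ω j| / B) ∂μ := integral_const_mul _ _
    _ ≤ 6 * B ^ 3 * 6 := by gcongr; exact hY.le t j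
    _ = _ := by ring

theorem SubExp.integrable_sq (hY : SubExp B Y μ) (t : κ) (j : ι) :
    Integrable (fun ω => Y t ω j ^ 2) μ := by
  have hm := hY.measurable_eval t j
  refine ((hY.integrable t j).const_mul (2 * B ^ 2)).mono'
    (by fun_prop) (ae_of_all _ fun ω => ?_)
  rw [Real.norm_eq_abs, abs_of_nonneg (by positivity), ← sq_abs]
  exact sq_le_exp hY.pos (abs_nonneg _)

theorem SubExp.memLp_two (hY : SubExp B Y μ) (t : κ) (j : ι) :
    MemLp (fun ω => Y t ω j) 2 μ :=
  (memLp_two_iff_integrable_sq (hY.measurable_eval t j).aestronglyMeasurable).2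
    (hY.integrable_sq t j)

theorem SubExp.integrable_mul (hY : SubExp B Y μ) (t s : κ) (j k : ι) :
    Integrable (fun ω => Y t ω j * Y s ω k) μ :=
  (hY.memLp_two t j).integrable_mul (hY.memLp_two s k)

theorem SubExp.integrable_eval [IsFiniteMeasure μ] (hY : SubExp B Y μ) (t : κ) (j : ι) :
    Integrable (fun ω => Y t ω j) μ := (hY.memLp_two t j).integrable (by norm_num)

/-- The event that some coordinate of some summand exceeds `τ`. -/
def largeEvent (τ : ℝ) (Y : κ → Ω → ι → ℝ) : Set Ω := {ω | ∃ t j, τ < |Y t ω j|}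

variable [Fintype ι] [Fintype κ]

theorem SubExp.measurableSet_largeEvent (hY : SubExp B Y μ) :
    MeasurableSet (largeEvent τ Y) := by
  have : largeEvent τ Y = ⋃ t, ⋃ j, {ω | τ < |Y t ω j|} := by ext; simp [largeEvent]
  rw [this]
  exact MeasurableSet.iUnion fun t => MeasurableSet.iUnion fun j =>
    measurableSet_lt measurable_const (hY.measurable_eval t j).abs

/-- The size of the error made on `largeEvent`. -/
def tailError (ι κ : Type*) [Fintype ι] [Fintype κ] (B τ : ℝ) : ℝ :=
  -- One factor `Fintype.card ι` comes from the union bound over coordinates, the other from summing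
  -- the weights, each of which is increased by one on `largeEvent`.
  Fintype.card κ * Fintype.card ι ^ 2 * Real.exp (-(τ / (2 * B)))

/-- The indicator is dominated by a sum over all pairs (u, k) that could cause the large event, and
288 = 24 · (6 + 6). -/
theorem SubExp.integral_indicator_cube_le (hY : SubExp B Y μ) (t : κ) (j : ι) :
    ∫ ω, (largeEvent τ Y).indicator 1 ω * |Y t ω j| ^ 3 ∂μ ≤
      288 * B ^ 3 * (Fintype.card κ * Fintype.card ι * Real.exp (-(τ / (2 * B)))) := by
  have hB := hY.pos
  set E := Real.exp (-(τ / (2 * B))) with hE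
  have hint : Integrable (fun ω => ∑ u, ∑ k, 24 * B ^ 3 * E *
      (Real.exp (|Y t ω j| / B) + Real.exp (|Y u ω k| / B))) μ :=
    integrable_finsetSum _ fun u _ => integrable_finsetSum _ fun k _ =>
      ((hY.integrable t j).add (hY.integrable u k)).const_mul _
  calc ∫ ω, (largeEvent τ Y).indicator 1 ω * |Y t ω j| ^ 3 ∂μ
      ≤ ∫ ω, ∑ u, ∑ k, 24 * B ^ 3 * E *
        (Real.exp (|Y t ω j| / B) + Real.exp (|Y u ω k| / B)) ∂μ := by
        refine integral_mono_of_nonneg (ae_of_all _ fun ω => ?_) hint (ae_of_all _ fun ω => ?_)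
        · exact mul_nonneg (Set.indicator_nonneg (fun _ _ => zero_le_one) ω) (by positivity)
        · have hnn : ∀ u k, 0 ≤ 24 * B ^ 3 * E *
              (Real.exp (|Y t ω j| / B) + Real.exp (|Y u ω k| / B)) := by
            intro u k; positivity
          by_cases hω : ω ∈ largeEvent τ Y
          · obtain ⟨u, k, huk⟩ := id hω
            simp only [Set.indicator_of_mem hω, Pi.one_apply, one_mul]
            calc _ ≤ _ := cube_le_exp_of_lt hB (abs_nonneg _) huk
              _ ≤ ∑ k, 24 * B ^ 3 * E * (Real.exp (|Y t ω j| / B) + Real.exp (|Y u ω k| / B)) :=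
                Finset.single_le_sum (f := fun k => 24 * B ^ 3 * E *
                  (Real.exp (|Y t ω j| / B) + Real.exp (|Y u ω k| / B)))
                  (fun k _ => hnn u k) (Finset.mem_univ k)
              _ ≤ _ := Finset.single_le_sum (f := fun u => ∑ k, 24 * B ^ 3 * E *
                  (Real.exp (|Y t ω j| / B) + Real.exp (|Y u ω k| / B)))
                  (fun u _ => Finset.sum_nonneg fun k _ => hnn u k) (Finset.mem_univ u)
          · simp only [Set.indicator_of_notMem hω, zero_mul]
            exact Finset.sum_nonneg fun u _ => Finset.sum_nonneg fun k _ => hnn u k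
    _ = ∑ u, ∑ k, 24 * B ^ 3 * E *
        ((∫ ω, Real.exp (|Y t ω j| / B) ∂μ) + ∫ ω, Real.exp (|Y u ω k| / B) ∂μ) := by
        have hadd : ∀ u k, Integrable (fun ω => 24 * B ^ 3 * E *
            (Real.exp (|Y t ω j| / B) + Real.exp (|Y u ω k| / B))) μ := fun u k =>
          ((hY.integrable t j).add (hY.integrable u k)).const_mul _
        rw [integral_finsetSum _ fun u _ => integrable_finsetSum _ fun k _ => hadd u k]
        refine Finset.sum_congr rfl fun u _ => ?_
        rw [integral_finsetSum _ fun k _ => hadd u k]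
        refine Finset.sum_congr rfl fun k _ => ?_
        rw [integral_const_mul, integral_add (hY.integrable t j) (hY.integrable u k)]
    _ ≤ ∑ u : κ, ∑ k : ι, 24 * B ^ 3 * E * (6 + 6) := by
        gcongr
        · exact hY.le t j
        · exact hY.le _ _
    _ = _ := by simp; ring

theorem SubExp.integral_indicator_le [IsFiniteMeasure μ] (hY : SubExp B Y μ) (hτ : 0 ≤ τ) :
    ∫ ω, (largeEvent τ Y).indicator 1 ω ∂μ ≤
      6 * (Fintype.card κ * Fintype.card ι * Real.exp (-(τ / (2 * B)))) := by
  have hB := hY.pos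
  set E := Real.exp (-(τ / (2 * B))) with hE
  have hint : Integrable (fun ω => ∑ u, ∑ k, E * Real.exp (|Y u ω k| / B)) μ :=
    integrable_finsetSum _ fun u _ => integrable_finsetSum _ fun k _ =>
      (hY.integrable u k).const_mul _
  calc ∫ ω, (largeEvent τ Y).indicator 1 ω ∂μ
      ≤ ∫ ω, ∑ u, ∑ k, E * Real.exp (|Y u ω k| / B) ∂μ := by
        refine integral_mono_of_nonneg (ae_of_all _ fun ω => ?_) hint (ae_of_all _ fun ω => ?_)
        · exact Set.indicator_nonneg (fun _ _ => zero_le_one) ω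
        · have hnn : ∀ u k, 0 ≤ E * Real.exp (|Y u ω k| / B) := by
            intro u k; positivity
          by_cases hω : ω ∈ largeEvent τ Y
          · obtain ⟨u, k, huk⟩ := id hω
            simp only [Set.indicator_of_mem hω, Pi.one_apply]
            calc _ ≤ _ := one_le_exp_of_lt hB hτ huk
              _ ≤ ∑ k, E * Real.exp (|Y u ω k| / B) :=
                Finset.single_le_sum (f := fun k => E * Real.exp (|Y u ω k| / B))
                  (fun k _ => hnn u k) (Finset.mem_univ k)
              _ ≤ _ := Finset.single_le_sum (f := fun u => ∑ k, E * Real.exp (|Y u ω k| / B))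
                  (fun u _ => Finset.sum_nonneg fun k _ => hnn u k) (Finset.mem_univ u)
          · simp only [Set.indicator_of_notMem hω]
            exact Finset.sum_nonneg fun u _ => Finset.sum_nonneg fun k _ => hnn u k
    _ = ∑ u, ∑ k, E * ∫ ω, Real.exp (|Y u ω k| / B) ∂μ := by
        rw [integral_finsetSum _ fun u _ => integrable_finsetSum _ fun k _ =>
          (hY.integrable u k).const_mul _]
        refine Finset.sum_congr rfl fun u _ => ?_
        rw [integral_finsetSum _ fun k _ => (hY.integrable u k).const_mul _]
        exact Finset.sum_congr rfl fun k _ => integral_const_mul _ _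
    _ ≤ ∑ u : κ, ∑ k : ι, E * 6 := by
        gcongr
        exact hY.le _ _
    _ = _ := by simp; ring

end Moments

/-! ### Decoupling a summand from the weights of the full sum. -/

section Decoupling

variable {Ω : Type*} [MeasurableSpace Ω] {μ : Measure Ω} [IsProbabilityMeasure μ]
  {ι κ : Type*} [Fintype ι] [Nonempty ι] [Fintype κ] [DecidableEq κ]
  {B τ : ℝ} {Y : κ → Ω → ι → ℝ} {φ β c : ℝ} {x₀ : ι → ℝ} {N : κ → Finset κ} {D : ℕ}

/-- `Y` is centered, and every pair of summands is independent of the sum of the summands outside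
of its neighbourhood `N t ∪ N s`. -/
structure LocallyDependent (N : κ → Finset κ) (Y : κ → Ω → ι → ℝ) (μ : Measure Ω) : Prop where
  centered : ∀ t j, ∫ ω, Y t ω j ∂μ = 0
  indep_sum : ∀ t, IndepFun (Y t) (fun ω => ∑ s ∈ (N t)ᶜ, Y s ω) μ
  indep_sum_pair : ∀ t s,
    IndepFun (fun ω => (Y t ω, Y s ω)) (fun ω => ∑ r ∈ (N t ∪ N s)ᶜ, Y r ω) μ
  indep : ∀ t s, s ∉ N t → IndepFun (Y t) (Y s) μ

theorem measurableSet_shell (φ β k : ℝ) : MeasurableSet (shell φ β k : Set (ι → ℝ)) := by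
  have h : Measurable fun x : ι → ℝ => φ * lse β x := ((continuous_lse β).measurable).const_mul φ
  exact (measurableSet_le measurable_const h).inter (measurableSet_le h measurable_const)

/-- The shifted partial sum without the summands in `R`. -/
def partialSum (x₀ : ι → ℝ) (c : ℝ) (Y : κ → Ω → ι → ℝ) (R : Finset κ) (ω : Ω) : ι → ℝ :=
  x₀ + c • ∑ r ∈ Rᶜ, Y r ω

theorem partialSum_eq_sub (R : Finset κ) (ω : Ω) :
    partialSum x₀ c Y R ω = partialSum x₀ c Y ∅ ω - c • ∑ r ∈ R, Y r ω := by
  have := Finset.sum_add_sum_compl R (fun r => Y r ω)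
  simp only [partialSum, Finset.compl_empty, ← this, smul_add]
  abel

theorem SubExp.measurable_partialSum (hY : SubExp B Y μ) (R : Finset κ) :
    Measurable (partialSum x₀ c Y R) := by
  have h := hY.measurable
  unfold partialSum
  fun_prop

/-- Random weights dominating the third derivative along the removal of a few summands. -/
def domWeight (φ β τ : ℝ) (x₀ : ι → ℝ) (c : ℝ) (Y : κ → Ω → ι → ℝ) (ω : Ω) (j : ι) : ℝ :=
  Real.exp 2 * ((shell φ β 1).indicator 1 (partialSum x₀ c Y ∅ ω) *
    smw β (partialSum x₀ c Y ∅ ω) j) + (largeEvent τ Y).indicator 1 ω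

theorem abs_smul_sum_le {R : Finset κ} {M : ℕ} (hR : R.card ≤ M) (hc : 0 ≤ c) (hτ : 0 ≤ τ)
    {ω : Ω} (hω : ω ∉ largeEvent τ Y) (j : ι) : |(c • ∑ r ∈ R, Y r ω) j| ≤ c * (M * τ) := by
  have h : ∀ t, |Y t ω j| ≤ τ := by
    intro t
    by_contra! h
    exact hω ⟨t, j, h⟩
  rw [Pi.smul_apply, smul_eq_mul, abs_mul, abs_of_nonneg hc, Finset.sum_apply]
  refine mul_le_mul_of_nonneg_left ((Finset.abs_sum_le_sum_abs _ _).trans ?_) hc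
  refine (Finset.sum_le_sum fun t _ => h t).trans ?_
  rw [Finset.sum_const, nsmul_eq_mul]
  gcongr

/-- Off `largeEvent`, removing at most M summands moves each coordinate by at most β⁻¹, so weights
at the full sum suffice along the whole segment. On `largeEvent` every weight is at least one and
the crude bound applies. -/
theorem abs_smoothInd₃_partialSum_le (hφ : 0 < φ) (hφβ : φ ≤ β) (hc : 0 ≤ c) (hτ : 0 ≤ τ)
    {M : ℕ} (hτβ : c * (M * τ) ≤ β⁻¹) {R : Finset κ} (hR : R.card ≤ M) (ω : Ω)
    (t : ℝ) (ht : t ∈ Set.Icc (0 : ℝ) 1) (a b d : ι → ℝ) :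
    |smoothInd₃ φ β (partialSum x₀ c Y ∅ ω - t • c • ∑ i ∈ R, Y i ω) a b d| ≤
      13 * cutoffBound * φ * β ^ 2 * (cub (domWeight φ β τ x₀ c Y ω) a +
        cub (domWeight φ β τ x₀ c Y ω) b + cub (domWeight φ β τ x₀ c Y ω) d) := by
  have hI0 : ∀ j, 0 ≤ (shell φ β 1).indicator 1 (partialSum x₀ c Y ∅ ω) *
      smw β (partialSum x₀ c Y ∅ ω) j := fun j =>
    mul_nonneg (Set.indicator_nonneg (fun _ _ => zero_le_one) _) (smw_nonneg _ _ _)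
  by_cases hω : ω ∈ largeEvent τ Y
  · refine abs_smoothInd₃_le_of_one_le hφ.le hφβ (fun j => ?_) _ a b d
    rw [domWeight, Set.indicator_of_mem hω, Pi.one_apply]
    have := mul_nonneg (Real.exp_pos 2).le (hI0 j)
    linarith
  · rw [sub_eq_add_neg]
    refine abs_smoothInd₃_add_le hφ hφβ (fun j => ?_) (fun j => ?_) a b d
    · have h := abs_smul_sum_le hR hc hτ hω j
      rw [Pi.neg_apply, abs_neg, Pi.smul_apply, smul_eq_mul, abs_mul, abs_of_nonneg ht.1]
      calc _ ≤ 1 * |(c • ∑ r ∈ R, Y r ω) j| := by gcongr; exact ht.2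
        _ ≤ _ := by rw [one_mul]; exact h.trans hτβ
    · rw [domWeight, Set.indicator_of_notMem hω, add_zero]

/-- The bound for the expected weighted cubes of a summand. -/
def cubBound (φ β τ B : ℝ) (x₀ : ι → ℝ) (c : ℝ) (Y : κ → Ω → ι → ℝ) (μ : Measure Ω) : ℝ :=
  15000 * B ^ 3 * (μ.real {ω | partialSum x₀ c Y ∅ ω ∈ shell φ β 3} + tailError ι κ B τ)

theorem measurable_domWeight (hY : SubExp B Y μ) (j : ι) :
    Measurable fun ω => domWeight φ β τ x₀ c Y ω j := by
  have h1 := hY.measurable_partialSum (x₀ := x₀) (c := c) ∅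
  have h2 : Measurable ((shell φ β 1).indicator (1 : (ι → ℝ) → ℝ)) :=
    measurable_one.indicator (measurableSet_shell φ β 1)
  have h3 := (continuous_smw β j).measurable
  have h4 : Measurable ((largeEvent τ Y).indicator (1 : Ω → ℝ)) :=
    measurable_one.indicator hY.measurableSet_largeEvent
  exact (((h2.comp h1).mul (h3.comp h1)).const_mul _).add h4

theorem indicator_one_mem_Icc {α : Type*} (s : Set α) (x : α) :
    s.indicator (1 : α → ℝ) x ∈ Set.Icc (0 : ℝ) 1 :=
  ⟨Set.indicator_nonneg (fun _ _ => zero_le_one) x, Set.indicator_le_self' (by simp) x⟩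

theorem domWeight_nonneg (ω : Ω) (j : ι) : 0 ≤ domWeight φ β τ x₀ c Y ω j :=
  add_nonneg (mul_nonneg (Real.exp_pos 2).le
    (mul_nonneg (indicator_one_mem_Icc _ _).1 (smw_nonneg _ _ _))) (indicator_one_mem_Icc _ _).1

theorem domWeight_le (ω : Ω) (j : ι) : domWeight φ β τ x₀ c Y ω j ≤ Real.exp 2 + 1 := by
  refine add_le_add (mul_le_of_le_one_right (Real.exp_pos 2).le ?_) (indicator_one_mem_Icc _ _).2
  exact mul_le_one₀ (indicator_one_mem_Icc _ _).2 (smw_nonneg _ _ _) (smw_le_one _ _ _)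

theorem integrable_cub_domWeight (hY : SubExp B Y μ) (u : κ) :
    Integrable (fun ω => cub (domWeight φ β τ x₀ c Y ω) (Y u ω)) μ :=
  integrable_finsetSum _ fun j _ => (hY.integrable_cube u j).bdd_mul
    (measurable_domWeight hY j).aestronglyMeasurable (c := Real.exp 2 + 1) (ae_of_all _ fun ω => by
      rw [Real.norm_eq_abs, abs_of_nonneg (domWeight_nonneg ω j)]
      exact domWeight_le ω j)

theorem integrable_domWeight (hY : SubExp B Y μ) (j : ι) :
    Integrable (fun ω => domWeight φ β τ x₀ c Y ω j) μ :=
  (integrable_const (Real.exp 2 + 1)).mono' (measurable_domWeight hY j).aestronglyMeasurable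
    (ae_of_all _ fun ω => by
      rw [Real.norm_eq_abs, abs_of_nonneg (domWeight_nonneg ω j)]
      exact domWeight_le ω j)

theorem exp_two_lt : Real.exp 2 < 7.4 := by
  have h : Real.exp 2 = Real.exp 1 ^ 2 := by rw [← Real.exp_nat_mul]; norm_num
  rw [h]
  have h1 := Real.exp_one_lt_d9
  have h0 := Real.exp_pos 1
  nlinarith

/-- The weights depend on the full sum, and hence on Y u. Passing to the sum V without the
neighbourhood of u makes them independent of Y u, at the price of a constant and a wider shell. The
expectation then factors and the weights sum to one. Passing back from V to the full sum W widens
the shell once more, from 1 to 2 to 3 in total. -/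
theorem integral_cub_domWeight_le (hY : SubExp B Y μ) (hN : LocallyDependent N Y μ)
    (hφ : 0 < φ) (hφβ : φ ≤ β) (hc : 0 ≤ c) (hτ : 0 ≤ τ)
    {M : ℕ} (hτβ : c * (M * τ) ≤ β⁻¹) (hD : ∀ t, (N t).card ≤ M) (u : κ) :
    ∫ ω, cub (domWeight φ β τ x₀ c Y ω) (Y u ω) ∂μ ≤ cubBound φ β τ B x₀ c Y μ := by
  have hB := hY.pos
  set W := partialSum x₀ c Y ∅ with hW
  set V := partialSum x₀ c Y (N u) with hV
  set Q : Ω → ℝ := (largeEvent τ Y).indicator 1 with hQ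
  set I : ℝ → (ι → ℝ) → ℝ := fun k => (shell φ β k).indicator 1 with hI
  set E := Real.exp 2 with hE
  have hE0 : 0 < E := Real.exp_pos 2
  have hE1 : E ≤ 7.4 := exp_two_lt.le
  have hQm : Measurable Q := measurable_one.indicator hY.measurableSet_largeEvent
  have hIm : ∀ k, Measurable (I k) := fun k => measurable_one.indicator (measurableSet_shell φ β k)
  have hWm : Measurable W := hY.measurable_partialSum ∅
  have hVm : Measurable V := hY.measurable_partialSum (N u)
  have hQI : ∀ ω, Q ω ∈ Set.Icc (0 : ℝ) 1 := indicator_one_mem_Icc _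
  have hII : ∀ k x, I k x ∈ Set.Icc (0 : ℝ) 1 := fun k x => indicator_one_mem_Icc _ _
  have hzV : ∀ ω ∉ largeEvent τ Y, ∀ j, |(c • ∑ r ∈ N u, Y r ω) j| ≤ β⁻¹ := fun ω hω j =>
    (abs_smul_sum_le (hD u) hc hτ hω j).trans hτβ
  have hWV : ∀ ω, W ω = V ω + c • ∑ r ∈ N u, Y r ω := fun ω => by
    rw [hV, partialSum_eq_sub, sub_add_cancel]
  have hVW : ∀ ω, V ω = W ω + -(c • ∑ r ∈ N u, Y r ω) := fun ω => by
    rw [hV, partialSum_eq_sub, sub_eq_add_neg]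
  -- On `largeEvent` the comparison of W with V fails, but the left side is at most one and Q equals
  -- one.
  have h1 : ∀ ω j, I 1 (W ω) * smw β (W ω) j ≤ E * (I 2 (V ω) * smw β (V ω) j) + Q ω := by
    intro ω j
    by_cases hω : ω ∈ largeEvent τ Y
    · have : Q ω = 1 := by simp [hQ, hω]
      rw [this]
      have := mul_nonneg hE0.le (mul_nonneg (hII 2 (V ω)).1 (smw_nonneg β (V ω) j))
      have := mul_le_one₀ (hII 1 (W ω)).2 (smw_nonneg β (W ω) j) (smw_le_one β (W ω) j)
      linarith
    · have h := indicator_shell_mul_smw_add_le (k := 1) hφ hφβ (hzV ω hω) (V ω) j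
      rw [← hWV, one_add_one_eq_two] at h
      exact h.trans (le_add_of_nonneg_right (hQI ω).1)
  have h2 : ∀ ω, I 2 (V ω) ≤ I 3 (W ω) + Q ω := by
    intro ω
    by_cases hω : ω ∈ largeEvent τ Y
    · have : Q ω = 1 := by simp [hQ, hω]
      rw [this]
      linarith [(hII 2 (V ω)).2, (hII 3 (W ω)).1]
    · have h := indicator_shell_add_le (k := 2) hφ hφβ
        (z := -(c • ∑ r ∈ N u, Y r ω)) (fun j => by
          rw [Pi.neg_apply, abs_neg]; exact hzV ω hω j) (W ω)
      rw [← hVW] at h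
      norm_num at h
      exact h.trans (le_add_of_nonneg_right (hQI ω).1)
  have hcube := fun j => hY.integrable_cube u j
  have hg : ∀ j, Measurable fun x : ι → ℝ => I 2 x * smw β x j := fun j =>
    (hIm 2).mul (continuous_smw β j).measurable
  have hg1 : ∀ j x, I 2 x * smw β x j ∈ Set.Icc (0 : ℝ) 1 := fun j x =>
    ⟨mul_nonneg (hII 2 x).1 (smw_nonneg _ _ _),
      mul_le_one₀ (hII 2 x).2 (smw_nonneg _ _ _) (smw_le_one _ _ _)⟩
  have hnorm : ∀ {r : ℝ}, r ∈ Set.Icc (0 : ℝ) 1 → ‖r‖ ≤ 1 := fun hr => by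
    rw [Real.norm_eq_abs, abs_of_nonneg hr.1]; exact hr.2
  have hint1 : ∀ j, Integrable (fun ω => I 2 (V ω) * smw β (V ω) j * |Y u ω j| ^ 3) μ := fun j =>
    (hcube j).bdd_mul ((hg j).comp hVm).aestronglyMeasurable (ae_of_all _ fun ω => hnorm (hg1 j _))
  have hint2 : ∀ j, Integrable (fun ω => Q ω * |Y u ω j| ^ 3) μ := fun j =>
    (hcube j).bdd_mul hQm.aestronglyMeasurable (ae_of_all _ fun ω => hnorm (hQI ω))
  have hintQ : Integrable Q μ := (integrable_const (1 : ℝ)).mono' hQm.aestronglyMeasurable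
    (ae_of_all _ fun ω => hnorm (hQI ω))
  have hintI : Integrable (fun ω => I 3 (W ω)) μ :=
    (integrable_const (1 : ℝ)).mono' ((hIm 3).comp hWm).aestronglyMeasurable
    (ae_of_all _ fun ω => hnorm (hII 3 _))
  have hintg : ∀ j, Integrable (fun ω => I 2 (V ω) * smw β (V ω) j) μ := fun j =>
    (integrable_const (1 : ℝ)).mono' ((hg j).comp hVm).aestronglyMeasurable
    (ae_of_all _ fun ω => hnorm (hg1 j _))
  -- the decoupled term
  have hdec : ∑ j, ∫ ω, I 2 (V ω) * smw β (V ω) j * |Y u ω j| ^ 3 ∂μ ≤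
      36 * B ^ 3 * ∫ ω, I 2 (V ω) ∂μ := by
    have hind : ∀ j, ∫ ω, I 2 (V ω) * smw β (V ω) j * |Y u ω j| ^ 3 ∂μ =
        (∫ ω, I 2 (V ω) * smw β (V ω) j ∂μ) * ∫ ω, |Y u ω j| ^ 3 ∂μ := by
      intro j
      have hm1 : Measurable fun x : ι → ℝ => I 2 (x₀ + c • x) * smw β (x₀ + c • x) j :=
        (hg j).comp (by fun_prop)
      have hm2 : Measurable fun x : ι → ℝ => |x j| ^ 3 := by fun_prop
      have := (hN.indep_sum u).symm.comp hm1 hm2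
      exact this.integral_fun_mul_eq_mul_integral (hintg j).aestronglyMeasurable
        (hcube j).aestronglyMeasurable
    calc _ ≤ ∑ j, (∫ ω, I 2 (V ω) * smw β (V ω) j ∂μ) * (36 * B ^ 3) := by
          refine Finset.sum_le_sum fun j _ => ?_
          rw [hind j]
          exact mul_le_mul_of_nonneg_left (hY.integral_cube_le u j)
            (integral_nonneg fun ω => (hg1 j _).1)
      _ = (∫ ω, ∑ j, I 2 (V ω) * smw β (V ω) j ∂μ) * (36 * B ^ 3) := by
          rw [integral_finsetSum _ fun j _ => hintg j, Finset.sum_mul]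
      _ = _ := by
          simp only [← Finset.mul_sum, sum_smw, mul_one]
          ring
  have hV3 : ∫ ω, I 2 (V ω) ∂μ ≤ (∫ ω, I 3 (W ω) ∂μ) + ∫ ω, Q ω ∂μ := by
    rw [← integral_add hintI hintQ]
    refine integral_mono ((integrable_const (1 : ℝ)).mono'
      ((hIm 2).comp hVm).aestronglyMeasurable (ae_of_all _ fun ω => hnorm (hII 2 _)))
      (hintI.add hintQ) h2
  have hI3 : ∫ ω, I 3 (W ω) ∂μ = μ.real {ω | W ω ∈ shell φ β 3} := by
    exact integral_indicator_one (s := {ω | W ω ∈ shell φ β 3}) (hWm (measurableSet_shell φ β 3))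
  set p := μ.real {ω | W ω ∈ shell φ β 3} with hp
  set e := tailError ι κ B τ with he
  have hp0 : 0 ≤ p := measureReal_nonneg
  have he0 : 0 ≤ e := by rw [he, tailError]; positivity
  have hcard : (1 : ℝ) ≤ Fintype.card ι := by exact_mod_cast Fintype.card_pos
  have he' : Fintype.card κ * Fintype.card ι * Real.exp (-(τ / (2 * B))) ≤ e := by
    rw [he, tailError]
    gcongr
    nlinarith
  have hQ1 : ∫ ω, Q ω ∂μ ≤ 6 * e := (hY.integral_indicator_le hτ).trans (by linarith)
  have hQ3 : ∑ j, ∫ ω, Q ω * |Y u ω j| ^ 3 ∂μ ≤ 288 * B ^ 3 * e := by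
    calc _ ≤ ∑ j : ι, 288 * B ^ 3 *
          (Fintype.card κ * Fintype.card ι * Real.exp (-(τ / (2 * B)))) :=
          Finset.sum_le_sum fun j _ => hY.integral_indicator_cube_le u j
      _ = _ := by
        rw [Finset.sum_const, Finset.card_univ, nsmul_eq_mul, he, tailError]; ring
  calc ∫ ω, cub (domWeight φ β τ x₀ c Y ω) (Y u ω) ∂μ
      ≤ ∫ ω, (E * E * ∑ j, I 2 (V ω) * smw β (V ω) j * |Y u ω j| ^ 3 +
          (E + 1) * ∑ j, Q ω * |Y u ω j| ^ 3) ∂μ := by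
        refine integral_mono (integrable_cub_domWeight hY u)
          (((integrable_finsetSum _ fun j _ => hint1 j).const_mul _).add
            ((integrable_finsetSum _ fun j _ => hint2 j).const_mul _)) fun ω => ?_
        simp only [cub, Finset.mul_sum, ← Finset.sum_add_distrib]
        refine Finset.sum_le_sum fun j _ => ?_
        have := mul_le_mul_of_nonneg_left (h1 ω j) hE0.le
        calc domWeight φ β τ x₀ c Y ω j * |Y u ω j| ^ 3
            ≤ (E * (E * (I 2 (V ω) * smw β (V ω) j) + Q ω) + Q ω) * |Y u ω j| ^ 3 := by
              refine mul_le_mul_of_nonneg_right ?_ (by positivity)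
              exact add_le_add this le_rfl
          _ = _ := by ring
    _ = E * E * ∑ j, ∫ ω, I 2 (V ω) * smw β (V ω) j * |Y u ω j| ^ 3 ∂μ +
          (E + 1) * ∑ j, ∫ ω, Q ω * |Y u ω j| ^ 3 ∂μ := by
        rw [integral_add ((integrable_finsetSum _ fun j _ => hint1 j).const_mul _)
          ((integrable_finsetSum _ fun j _ => hint2 j).const_mul _), integral_const_mul,
          integral_const_mul, integral_finsetSum _ fun j _ => hint1 j,
          integral_finsetSum _ fun j _ => hint2 j]
    _ ≤ 7.4 * 7.4 * (36 * B ^ 3 * (p + 6 * e)) + (7.4 + 1) * (288 * B ^ 3 * e) := by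
        have hdec' : ∑ j, ∫ ω, I 2 (V ω) * smw β (V ω) j * |Y u ω j| ^ 3 ∂μ ≤
            36 * B ^ 3 * (p + 6 * e) := by
          refine hdec.trans ?_
          gcongr
          rw [← hI3]
          exact hV3.trans (add_le_add le_rfl hQ1)
        have hn1 : 0 ≤ ∑ j, ∫ ω, Q ω * |Y u ω j| ^ 3 ∂μ := Finset.sum_nonneg fun j _ =>
          integral_nonneg fun ω => mul_nonneg (hQI ω).1 (by positivity)
        have hn2 : 0 ≤ ∑ j, ∫ ω, I 2 (V ω) * smw β (V ω) j * |Y u ω j| ^ 3 ∂μ :=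
          Finset.sum_nonneg fun j _ => integral_nonneg fun ω =>
            mul_nonneg (hg1 j _).1 (by positivity)
        gcongr
    -- The coefficient of B³ e is 7.4² · 36 · 6 + 8.4 · 288 < 14300, and that of B³ p is below 2000.
    _ ≤ cubBound φ β τ B x₀ c Y μ := by
        rw [cubBound, ← hp, ← he]
        have h3 : 0 ≤ B ^ 3 * p := by positivity
        have h4 : 0 ≤ B ^ 3 * e := by positivity
        nlinarith

/-- The moments of an independent copy are constants, so no decoupling is needed. On `largeEvent`
the weights add up to an extra `Fintype.card ι`, for which the square in `tailError` provides. -/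
theorem integral_cub_domWeight_copy_le (hY : SubExp B Y μ) (hτ : 0 ≤ τ) (u : κ) :
    ∫ ω, ∑ j, domWeight φ β τ x₀ c Y ω j * ∫ ω', |Y u ω' j| ^ 3 ∂μ ∂μ ≤
      cubBound φ β τ B x₀ c Y μ := by
  have hB := hY.pos
  set W := partialSum x₀ c Y ∅ with hW
  set Q : Ω → ℝ := (largeEvent τ Y).indicator 1 with hQ
  set I : ℝ → (ι → ℝ) → ℝ := fun k => (shell φ β k).indicator 1 with hI
  have hQm : Measurable Q := measurable_one.indicator hY.measurableSet_largeEvent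
  have hIm : ∀ k, Measurable (I k) := fun k => measurable_one.indicator (measurableSet_shell φ β k)
  have hWm : Measurable W := hY.measurable_partialSum ∅
  have hQI : ∀ ω, Q ω ∈ Set.Icc (0 : ℝ) 1 := indicator_one_mem_Icc _
  have hII : ∀ k x, I k x ∈ Set.Icc (0 : ℝ) 1 := fun k x => indicator_one_mem_Icc _ _
  have hnorm : ∀ {r : ℝ}, r ∈ Set.Icc (0 : ℝ) 1 → ‖r‖ ≤ 1 := fun hr => by
    rw [Real.norm_eq_abs, abs_of_nonneg hr.1]; exact hr.2
  have hintQ : Integrable Q μ := (integrable_const (1 : ℝ)).mono' hQm.aestronglyMeasurable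
    (ae_of_all _ fun ω => hnorm (hQI ω))
  have hintI : Integrable (fun ω => I 3 (W ω)) μ :=
    (integrable_const (1 : ℝ)).mono' ((hIm 3).comp hWm).aestronglyMeasurable
    (ae_of_all _ fun ω => hnorm (hII 3 _))
  have hI3 : ∫ ω, I 3 (W ω) ∂μ = μ.real {ω | W ω ∈ shell φ β 3} := by
    exact integral_indicator_one (s := {ω | W ω ∈ shell φ β 3}) (hWm (measurableSet_shell φ β 3))
  have hI13 : ∀ x, I 1 x ≤ I 3 x := by
    intro x
    refine Set.indicator_le_indicator_of_subset (fun y hy => ?_) (fun _ => zero_le_one) x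
    exact ⟨by linarith [hy.1], by linarith [hy.2]⟩
  have hcard : (1 : ℝ) ≤ Fintype.card ι := by exact_mod_cast Fintype.card_pos
  have hE1 : Real.exp 2 ≤ 7.4 := exp_two_lt.le
  set p := μ.real {ω | W ω ∈ shell φ β 3} with hp
  have hp0 : 0 ≤ p := measureReal_nonneg
  set e := tailError ι κ B τ with he
  have he0 : 0 ≤ e := by rw [he, tailError]; positivity
  have hQ1 : (Fintype.card ι : ℝ) * ∫ ω, Q ω ∂μ ≤ 6 * e := by
    refine (mul_le_mul_of_nonneg_left (hY.integral_indicator_le hτ) (by positivity)).trans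
      (le_of_eq ?_)
    rw [he, tailError]; ring
  have hQ0 : 0 ≤ ∫ ω, Q ω ∂μ := integral_nonneg fun ω => (hQI ω).1
  calc _ ≤ ∫ ω, 36 * B ^ 3 * (Real.exp 2 * I 3 (W ω) + Fintype.card ι * Q ω) ∂μ := by
        refine integral_mono (integrable_finsetSum _ fun j _ =>
          (integrable_domWeight hY j).mul_const _)
          (((hintI.const_mul _).add (hintQ.const_mul _)).const_mul _) fun ω => ?_
        calc _ ≤ ∑ j, domWeight φ β τ x₀ c Y ω j * (36 * B ^ 3) :=
              Finset.sum_le_sum fun j _ => mul_le_mul_of_nonneg_left (hY.integral_cube_le u j)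
                (domWeight_nonneg ω j)
          _ = 36 * B ^ 3 * (Real.exp 2 * I 1 (W ω) + Fintype.card ι * Q ω) := by
              rw [← Finset.sum_mul]
              simp only [domWeight, Finset.sum_add_distrib, ← Finset.mul_sum, sum_smw]
              rw [Finset.sum_const, Finset.card_univ, nsmul_eq_mul]
              ring
          _ ≤ _ := by
              have := hI13 (W ω)
              gcongr
    _ = 36 * B ^ 3 * (Real.exp 2 * p + Fintype.card ι * ∫ ω, Q ω ∂μ) := by
        rw [integral_const_mul, integral_add (hintI.const_mul _) (hintQ.const_mul _),
          integral_const_mul, integral_const_mul, hI3]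
    _ ≤ 36 * B ^ 3 * (7.4 * p + 6 * e) := by gcongr
    _ ≤ cubBound φ β τ B x₀ c Y μ := by
        rw [cubBound, ← hp, ← he]
        have h3 : 0 ≤ B ^ 3 * p := by positivity
        have h4 : 0 ≤ B ^ 3 * e := by positivity
        nlinarith

end Decoupling


/-! ### Continuity of the derivatives in the base point. -/

section Continuity

variable {ι : Type*} [Fintype ι] [Nonempty ι]

theorem continuous_avg (β : ℝ) (a : ι → ℝ) : Continuous fun x : ι → ℝ => avg β x a :=
  continuous_finsetSum _ fun j _ => (continuous_smw β j).mul continuous_const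

theorem continuous_iteratedDeriv_cutoff_lse {k : ℕ} (hk : k ≤ 4) (φ β : ℝ) :
    Continuous fun x : ι → ℝ => iteratedDeriv k cutoff (φ * lse β x) :=
  (contDiff_cutoff.continuous_iteratedDeriv k (by exact_mod_cast hk)).comp
    (continuous_const.mul (continuous_lse β))

theorem continuous_smoothInd (φ β : ℝ) : Continuous fun x : ι → ℝ => smoothInd φ β x :=
  contDiff_cutoff.continuous.comp (continuous_const.mul (continuous_lse β))

theorem continuous_smoothInd₁ (φ β : ℝ) (a : ι → ℝ) :
    Continuous fun x : ι → ℝ => smoothInd₁ φ β x a :=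
  (continuous_iteratedDeriv_cutoff_lse (by norm_num) φ β).mul
    (continuous_const.mul (continuous_avg β a))

theorem continuous_smoothInd₂ (φ β : ℝ) (a b : ι → ℝ) :
    Continuous fun x : ι → ℝ => smoothInd₂ φ β x a b := by
  have h1 := continuous_iteratedDeriv_cutoff_lse (ι := ι) (k := 1) (by norm_num) φ β
  have h2 := continuous_iteratedDeriv_cutoff_lse (ι := ι) (k := 2) (by norm_num) φ β
  have ha := continuous_avg β a
  have hb := continuous_avg β b
  have hab := continuous_avg β (a * b)
  unfold smoothInd₂
  fun_prop

theorem smoothInd₁_eq_sum [DecidableEq ι] (φ β : ℝ) (x a : ι → ℝ) : smoothInd₁ φ β x a =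
    ∑ j, smoothInd₁ φ β x (Pi.single j 1) * a j := by
  have expand : a = (1 : ℝ) • ∑ j, a j • (Pi.single j 1 : ι → ℝ) := by
    ext k
    simp [Finset.sum_apply, Pi.single_apply]
  conv_lhs => rw [expand, smoothInd₁_sum, one_mul]
  exact Finset.sum_congr rfl fun k _ => by rw [smoothInd₁_smul, mul_comm]

theorem norm_single_one_le [DecidableEq ι] (j : ι) : ‖(Pi.single j 1 : ι → ℝ)‖ ≤ 1 := by
  rw [Pi.norm_single]; simp

end Continuity

/-! ### Stein's method for locally dependent sums. -/

section Stein

variable {Ω : Type*} [MeasurableSpace Ω] {μ : Measure Ω} [IsProbabilityMeasure μ]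
  {ι κ : Type*} [Fintype ι] [DecidableEq ι] [Nonempty ι] [Fintype κ] [DecidableEq κ]
  {B τ : ℝ} {Y : κ → Ω → ι → ℝ} {φ β c : ℝ} {x₀ : ι → ℝ} {N : κ → Finset κ} {D : ℕ}

theorem abs_integral_le_of_abs_le {Ω : Type*} [MeasurableSpace Ω] {μ : Measure Ω} {f g : Ω → ℝ}
    (hg : Integrable g μ) (h : ∀ ω, |f ω| ≤ g ω) : |∫ ω, f ω ∂μ| ≤ ∫ ω, g ω ∂μ :=
  norm_integral_le_of_norm_le (f := f) hg (ae_of_all _ h)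

theorem integral_add_three {Ω : Type*} [MeasurableSpace Ω] {μ : Measure Ω} {f g h : Ω → ℝ}
    (hf : Integrable f μ) (hg : Integrable g μ) (hh : Integrable h μ) :
    ∫ ω, (f ω + g ω + h ω) ∂μ = ∫ ω, f ω ∂μ + ∫ ω, g ω ∂μ + ∫ ω, h ω ∂μ := by
  have hfg : Integrable (fun ω => f ω + g ω) μ := hf.add hg
  rw [← integral_add hf hg, ← integral_add hfg hh]

theorem integrable_smoothInd₁_single_mul {φ : ℝ} (hφ : 0 ≤ φ) (β : ℝ) {V : Ω → ι → ℝ}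
    (hV : Measurable V) {g : Ω → ℝ} (hg : Integrable g μ) (j : ι) :
    Integrable (fun ω => smoothInd₁ φ β (V ω) (Pi.single j 1) * g ω) μ := by
  have hM : (0 : ℝ) ≤ cutoffBound := zero_le_one.trans one_le_cutoffBound
  refine hg.bdd_mul (c := cutoffBound * φ * 1)
    ((continuous_smoothInd₁ φ β _).measurable.comp hV).aestronglyMeasurable
    (ae_of_all _ fun ω => (abs_smoothInd₁_le hφ β _ _).trans ?_)
  gcongr
  exact norm_single_one_le j

theorem integrable_smoothInd₂_single_mul (hφ : 0 ≤ φ) (hφβ : φ ≤ β) {V : Ω → ι → ℝ}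
    (hV : Measurable V) {g : Ω → ℝ} (hg : Integrable g μ) (j k : ι) :
    Integrable (fun ω => smoothInd₂ φ β (V ω) (Pi.single j 1) (Pi.single k 1) * g ω) μ := by
  have hM : (0 : ℝ) ≤ cutoffBound := zero_le_one.trans one_le_cutoffBound
  have hβ : 0 ≤ β := hφ.trans hφβ
  refine hg.bdd_mul (c := 3 * cutoffBound * φ * β * (1 * 1))
    ((continuous_smoothInd₂ φ β _ _).measurable.comp hV).aestronglyMeasurable
    (ae_of_all _ fun ω => (abs_smoothInd₂_le hφ hφβ _ _ _).trans ?_)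
  gcongr
  · exact norm_single_one_le j
  · exact norm_single_one_le k

theorem SubExp.integrable_smoothInd₁ (hY : SubExp B Y μ) (hφ : 0 ≤ φ) {V : Ω → ι → ℝ}
    (hV : Measurable V) (t : κ) : Integrable (fun ω => smoothInd₁ φ β (V ω) (Y t ω)) μ := by
  simp only [smoothInd₁_eq_sum φ β _ (Y t _)]
  exact integrable_finsetSum _ fun j _ =>
    integrable_smoothInd₁_single_mul hφ β hV (hY.integrable_eval t j) j

theorem SubExp.integrable_smoothInd₂ (hY : SubExp B Y μ) (hφ : 0 ≤ φ) (hφβ : φ ≤ β)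
    {V : Ω → ι → ℝ} (hV : Measurable V) (t s : κ) :
    Integrable (fun ω => smoothInd₂ φ β (V ω) (Y t ω) (Y s ω)) μ := by
  simp only [smoothInd₂_eq_sum φ β _ (Y t _)]
  exact integrable_finsetSum _ fun j _ => integrable_finsetSum _ fun k _ =>
    integrable_smoothInd₂_single_mul hφ hφβ hV (hY.integrable_mul t s j k) j k

/-- The second derivative at `x`, averaged over an independent copy of `(Y t, Y s)`. -/
def avgHess (φ β : ℝ) (Y : κ → Ω → ι → ℝ) (μ : Measure Ω) (t s : κ) (x : ι → ℝ) : ℝ :=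
  ∫ ω, smoothInd₂ φ β x (Y t ω) (Y s ω) ∂μ

theorem SubExp.avgHess_eq_sum (hY : SubExp B Y μ) (t s : κ) (x : ι → ℝ) :
    avgHess φ β Y μ t s x = ∑ j, ∑ k, smoothInd₂ φ β x (Pi.single j 1) (Pi.single k 1) *
      ∫ ω, Y t ω j * Y s ω k ∂μ := by
  simp only [avgHess, smoothInd₂_eq_sum φ β x (Y t _)]
  have h : ∀ j k, Integrable (fun ω => smoothInd₂ φ β x (Pi.single j 1) (Pi.single k 1) *
      (Y t ω j * Y s ω k)) μ := fun j k => (hY.integrable_mul t s j k).const_mul _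
  rw [integral_finsetSum _ fun j _ => integrable_finsetSum _ fun k _ => h j k]
  refine Finset.sum_congr rfl fun j _ => ?_
  rw [integral_finsetSum _ fun k _ => h j k]
  exact Finset.sum_congr rfl fun k _ => integral_const_mul _ _

theorem SubExp.integrable_avgHess (hY : SubExp B Y μ) (hφ : 0 ≤ φ) (hφβ : φ ≤ β)
    {V : Ω → ι → ℝ} (hV : Measurable V) (t s : κ) :
    Integrable (fun ω => avgHess φ β Y μ t s (V ω)) μ := by
  simp only [hY.avgHess_eq_sum]
  exact integrable_finsetSum _ fun j _ => integrable_finsetSum _ fun k _ =>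
    integrable_smoothInd₂_single_mul hφ hφβ hV (integrable_const _) j k

theorem SubExp.integral_avgHess (hY : SubExp B Y μ) (hφ : 0 ≤ φ) (hφβ : φ ≤ β)
    {V : Ω → ι → ℝ} (hV : Measurable V) (t s : κ) :
    ∫ ω, avgHess φ β Y μ t s (V ω) ∂μ =
      ∑ j, ∑ k, (∫ ω, smoothInd₂ φ β (V ω) (Pi.single j 1) (Pi.single k 1) ∂μ) *
        ∫ ω, Y t ω j * Y s ω k ∂μ := by
  simp only [hY.avgHess_eq_sum]
  have h : ∀ j k, Integrable (fun ω => smoothInd₂ φ β (V ω) (Pi.single j 1) (Pi.single k 1) *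
      ∫ ω, Y t ω j * Y s ω k ∂μ) μ := fun j k =>
    integrable_smoothInd₂_single_mul hφ hφβ hV (integrable_const _) j k
  rw [integral_finsetSum _ fun j _ => integrable_finsetSum _ fun k _ => h j k]
  refine Finset.sum_congr rfl fun j _ => ?_
  rw [integral_finsetSum _ fun k _ => h j k]
  exact Finset.sum_congr rfl fun k _ => integral_mul_const _ _

/-- Without the neighbourhood of t, the base point is independent of the centered direction Y t. -/
theorem integral_smoothInd₁_partialSum (hY : SubExp B Y μ) (hN : LocallyDependent N Y μ)
    (hφ : 0 ≤ φ) (t : κ) :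
    ∫ ω, smoothInd₁ φ β (partialSum x₀ c Y (N t) ω) (Y t ω) ∂μ = 0 := by
  have hV := hY.measurable_partialSum (x₀ := x₀) (c := c) (N t)
  simp only [smoothInd₁_eq_sum φ β _ (Y t _)]
  rw [integral_finsetSum _ fun j _ =>
    integrable_smoothInd₁_single_mul hφ β hV (hY.integrable_eval t j) j]
  refine Finset.sum_eq_zero fun j _ => ?_
  have hm1 : Measurable fun x : ι → ℝ => smoothInd₁ φ β (x₀ + c • x) (Pi.single j 1) :=
    (continuous_smoothInd₁ φ β _).measurable.comp (by fun_prop)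
  have hm2 : Measurable fun x : ι → ℝ => x j := measurable_pi_apply j
  have h := ((hN.indep_sum t).symm.comp hm1 hm2).integral_fun_mul_eq_mul_integral
    (hm1.comp (by have := hY.measurable; fun_prop)).aestronglyMeasurable
    (hY.measurable_eval t j).aestronglyMeasurable
  refine h.trans ?_
  have h0 : ∫ ω, ((fun x : ι → ℝ => x j) ∘ Y t) ω ∂μ = 0 := hN.centered t j
  rw [h0, mul_zero]

/-- Without both neighbourhoods, the base point is independent of the pair, which may then be
replaced by an independent copy. -/
theorem integral_smoothInd₂_partialSum (hY : SubExp B Y μ) (hN : LocallyDependent N Y μ)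
    (hφ : 0 ≤ φ) (hφβ : φ ≤ β) (t s : κ) :
    ∫ ω, smoothInd₂ φ β (partialSum x₀ c Y (N t ∪ N s) ω) (Y t ω) (Y s ω) ∂μ =
      ∫ ω, avgHess φ β Y μ t s (partialSum x₀ c Y (N t ∪ N s) ω) ∂μ := by
  have hV := hY.measurable_partialSum (x₀ := x₀) (c := c) (N t ∪ N s)
  rw [hY.integral_avgHess hφ hφβ hV]
  simp only [smoothInd₂_eq_sum φ β _ (Y t _)]
  have hint := fun j k => integrable_smoothInd₂_single_mul hφ hφβ hV (hY.integrable_mul t s j k) j k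
  rw [integral_finsetSum _ fun j _ => integrable_finsetSum _ fun k _ => hint j k]
  refine Finset.sum_congr rfl fun j _ => ?_
  rw [integral_finsetSum _ fun k _ => hint j k]
  refine Finset.sum_congr rfl fun k _ => ?_
  have hm1 : Measurable fun x : ι → ℝ =>
      smoothInd₂ φ β (x₀ + c • x) (Pi.single j 1) (Pi.single k 1) :=
    (continuous_smoothInd₂ φ β _ _).measurable.comp (by fun_prop)
  have hm2 : Measurable fun x : (ι → ℝ) × (ι → ℝ) => x.1 j * x.2 k := by fun_prop
  exact ((hN.indep_sum_pair t s).symm.comp hm1 hm2).integral_fun_mul_eq_mul_integral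
    (hm1.comp (by have := hY.measurable; fun_prop)).aestronglyMeasurable
    (hY.integrable_mul t s j k).aestronglyMeasurable

/-- Covariances of non-neighbours vanish, so the covariance of the full sum is a sum over
neighbouring pairs. This matches the trace term with the pairs that the Taylor expansion produces.
-/
theorem sum_integral_smoothInd₂_mul (hY : SubExp B Y μ) (hN : LocallyDependent N Y μ)
    (hφ : 0 ≤ φ) (hφβ : φ ≤ β) {V : Ω → ι → ℝ} (hV : Measurable V) :
    ∑ j, ∑ k, (∫ ω, smoothInd₂ φ β (V ω) (Pi.single j 1) (Pi.single k 1) ∂μ) *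
        ∫ ω, (∑ t, Y t ω) j * (∑ t, Y t ω) k ∂μ =
      ∑ t, ∑ s ∈ N t, ∫ ω, avgHess φ β Y μ t s (V ω) ∂μ := by
  have hcov : ∀ j k, ∫ ω, (∑ t, Y t ω) j * (∑ t, Y t ω) k ∂μ =
      ∑ t, ∑ s ∈ N t, ∫ ω, Y t ω j * Y s ω k ∂μ := by
    intro j k
    simp only [Finset.sum_apply, Finset.sum_mul_sum]
    rw [integral_finsetSum _ fun t _ => integrable_finsetSum _ fun s _ => hY.integrable_mul t s j k]
    refine Finset.sum_congr rfl fun t _ => ?_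
    rw [integral_finsetSum _ fun s _ => hY.integrable_mul t s j k]
    refine (Finset.sum_subset (Finset.subset_univ (N t)) fun s _ hs => ?_).symm
    have := ((hN.indep t s hs).comp (measurable_pi_apply j)
      (measurable_pi_apply k)).integral_fun_mul_eq_mul_integral
      (hY.measurable_eval t j).aestronglyMeasurable (hY.measurable_eval s k).aestronglyMeasurable
    refine this.trans ?_
    have h0 : ∫ ω, ((fun x : ι → ℝ => x j) ∘ Y t) ω ∂μ = 0 := hN.centered t j
    exact mul_eq_zero_of_left h0 _
  simp only [hcov, hY.integral_avgHess hφ hφβ hV, Finset.mul_sum]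
  rw [Finset.sum_congr rfl fun j _ => Finset.sum_comm, Finset.sum_comm]
  refine Finset.sum_congr rfl fun t _ => ?_
  rw [Finset.sum_congr rfl fun j _ => Finset.sum_comm, Finset.sum_comm]

/-- Stein's method for a locally dependent sum: the drift term agrees with the trace of the
Hessian against the covariance, up to a third-order error. -/
theorem abs_integral_smoothInd₁_sub_le (hY : SubExp B Y μ) (hN : LocallyDependent N Y μ)
    (hφ : 0 < φ) (hφβ : φ ≤ β) (hc : 0 ≤ c) (hτ : 0 ≤ τ)
    (hτβ : c * ((2 * D : ℕ) * τ) ≤ β⁻¹) (hD : ∀ t, (N t).card ≤ D) :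
    |∫ ω, smoothInd₁ φ β (partialSum x₀ c Y ∅ ω) (∑ t, Y t ω) ∂μ -
      c * ∑ j, ∑ k, (∫ ω, smoothInd₂ φ β (partialSum x₀ c Y ∅ ω)
        (Pi.single j 1) (Pi.single k 1) ∂μ) * ∫ ω, (∑ t, Y t ω) j * (∑ t, Y t ω) k ∂μ| ≤
      Fintype.card κ * (c ^ 2 * (13 * cutoffBound * φ * β ^ 2) *
        (15 * D ^ 2 * cubBound φ β τ B x₀ c Y μ)) := by
  have hβ : 0 < β := hφ.trans_le hφβ
  have hM : (0 : ℝ) ≤ cutoffBound := zero_le_one.trans one_le_cutoffBound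
  set A := 13 * cutoffBound * φ * β ^ 2 with hA
  have hA0 : 0 ≤ A := by positivity
  set P := cubBound φ β τ B x₀ c Y μ with hP
  set W := partialSum x₀ c Y ∅ with hW
  set w := domWeight φ β τ x₀ c Y with hw
  have hWm : Measurable W := hY.measurable_partialSum ∅
  have hD2 : ∀ t, (N t).card ≤ 2 * D := fun t => (hD t).trans (by omega)
  -- The union of two neighbourhoods has at most 2D elements. This keeps the error at order D²,
  -- without second-order neighbourhoods.
  have hDu : ∀ t s, (N t ∪ N s).card ≤ 2 * D := fun t s =>
    (Finset.card_union_le _ _).trans (by have := hD t; have := hD s; omega)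
  have hcub : ∀ u, ∫ ω, cub (w ω) (Y u ω) ∂μ ≤ P := fun u =>
    integral_cub_domWeight_le hY hN hφ hφβ hc hτ hτβ hD2 u
  have hcubint : ∀ u, Integrable (fun ω => cub (w ω) (Y u ω)) μ := fun u =>
    integrable_cub_domWeight hY u
  set m : κ → ι → ℝ := fun u j => ∫ ω', |Y u ω' j| ^ 3 ∂μ with hm
  have hcub' : ∀ u, ∫ ω, ∑ j, w ω j * m u j ∂μ ≤ P := fun u =>
    integral_cub_domWeight_copy_le hY hτ u
  have hcubint' : ∀ u, Integrable (fun ω => ∑ j, w ω j * m u j) μ := fun u =>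
    integrable_finsetSum _ fun j _ => (integrable_domWeight hY j).mul_const _
  have hP0 : 0 ≤ P := by
    have hB := hY.pos
    rw [hP, cubBound, tailError]
    positivity
  have hf1 : ∀ {V : Ω → ι → ℝ}, Measurable V → ∀ t,
      Integrable (fun ω => smoothInd₁ φ β (V ω) (Y t ω)) μ := fun hV t =>
    hY.integrable_smoothInd₁ hφ.le hV t
  have hf2 : ∀ {V : Ω → ι → ℝ}, Measurable V → ∀ t s,
      Integrable (fun ω => smoothInd₂ φ β (V ω) (Y t ω) (Y s ω)) μ := fun hV t s =>
    hY.integrable_smoothInd₂ hφ.le hφβ hV t s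
  have hH : ∀ {V : Ω → ι → ℝ}, Measurable V → ∀ t s,
      Integrable (fun ω => avgHess φ β Y μ t s (V ω)) μ := fun hV t s =>
    hY.integrable_avgHess hφ.le hφβ hV t s
  have hthird := fun (R : Finset κ) (hR : R.card ≤ 2 * D) ω =>
    abs_smoothInd₃_partialSum_le (x₀ := x₀) (Y := Y) hφ hφβ hc hτ hτβ hR ω
  -- first-order term
  have first : ∀ t, |∫ ω, smoothInd₁ φ β (W ω) (Y t ω) ∂μ -
      c * ∑ s ∈ N t, ∫ ω, smoothInd₂ φ β (W ω) (Y t ω) (Y s ω) ∂μ| ≤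
      c ^ 2 * A * (3 * D ^ 2 * P) := by
    intro t
    have hVm : Measurable (partialSum x₀ c Y (N t)) := hY.measurable_partialSum (N t)
    have hint2 : Integrable
        (fun ω => c * ∑ s ∈ N t, smoothInd₂ φ β (W ω) (Y t ω) (Y s ω)) μ :=
      (integrable_finsetSum _ fun s _ => hf2 hWm t s).const_mul c
    -- Subtracting the first derivative at the reduced sum is free, because its expectation is zero.
    have e : ∫ ω, smoothInd₁ φ β (W ω) (Y t ω) ∂μ -
        c * ∑ s ∈ N t, ∫ ω, smoothInd₂ φ β (W ω) (Y t ω) (Y s ω) ∂μ =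
        ∫ ω, (smoothInd₁ φ β (W ω) (Y t ω) -
          smoothInd₁ φ β (partialSum x₀ c Y (N t) ω) (Y t ω) -
          c * ∑ s ∈ N t, smoothInd₂ φ β (W ω) (Y t ω) (Y s ω)) ∂μ := by
      have hsub : Integrable (fun ω => smoothInd₁ φ β (W ω) (Y t ω) -
          smoothInd₁ φ β (partialSum x₀ c Y (N t) ω) (Y t ω)) μ := (hf1 hWm t).sub (hf1 hVm t)
      rw [integral_sub hsub hint2,
        integral_sub (hf1 hWm t) (hf1 hVm t), integral_smoothInd₁_partialSum hY hN hφ.le t,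
        sub_zero, integral_const_mul, integral_finsetSum _ fun s _ => hf2 hWm t s]
    have hc3 : ∀ i k, Integrable (fun ω => cub (w ω) (Y t ω) + cub (w ω) (Y i ω) +
      cub (w ω) (Y k ω)) μ := fun i k => ((hcubint t).add (hcubint i)).add (hcubint k)
    rw [e]
    refine (abs_integral_le_of_abs_le (g := fun ω => c ^ 2 * A * ∑ i ∈ N t, ∑ k ∈ N t,
      (cub (w ω) (Y t ω) + cub (w ω) (Y i ω) + cub (w ω) (Y k ω)))
      ((integrable_finsetSum _ fun i _ => integrable_finsetSum _ fun k _ => hc3 i k).const_mul _)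
      fun ω => ?_).trans ?_
    · rw [partialSum_eq_sub (N t)]
      exact abs_smoothInd₁_sub_sub_le_sum hβ.ne' hc (hthird (N t) (hD2 t) ω) (Y t ω)
    · rw [integral_const_mul, integral_finsetSum _ fun i _ => integrable_finsetSum _ fun k _ =>
        hc3 i k]
      refine mul_le_mul_of_nonneg_left ?_ (by positivity)
      calc _ ≤ ∑ i ∈ N t, ∑ k ∈ N t, (P + P + P) := by
            refine Finset.sum_le_sum fun i _ => ?_
            rw [integral_finsetSum _ fun k _ => hc3 i k]
            refine Finset.sum_le_sum fun k _ => ?_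
            rw [integral_add_three (hcubint t) (hcubint i) (hcubint k)]
            exact add_le_add (add_le_add (hcub t) (hcub i)) (hcub k)
        _ = ((N t).card : ℝ) ^ 2 * (3 * P) := by
            rw [Finset.sum_const, Finset.sum_const]; simp only [nsmul_eq_mul]; ring
        _ ≤ (D : ℝ) ^ 2 * (3 * P) := by
            have : ((N t).card : ℝ) ≤ D := by exact_mod_cast hD t
            gcongr
        _ = _ := by ring
  -- second-order terms
  have second : ∀ t s, |∫ ω, smoothInd₂ φ β (W ω) (Y t ω) (Y s ω) ∂μ -
      ∫ ω, avgHess φ β Y μ t s (W ω) ∂μ| ≤ c * A * (12 * D * P) := by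
    intro t s
    set V := partialSum x₀ c Y (N t ∪ N s) with hV
    have hVm : Measurable V := hY.measurable_partialSum (N t ∪ N s)
    have hcardR : ((N t ∪ N s).card : ℝ) ≤ 2 * D := by exact_mod_cast hDu t s
    -- At the reduced sum V the pair and its independent copy give equal expectations. What remains
    -- is two increments of the Hessian from V to W.
    have e : ∫ ω, smoothInd₂ φ β (W ω) (Y t ω) (Y s ω) ∂μ - ∫ ω, avgHess φ β Y μ t s (W ω) ∂μ =
        ∫ ω, (smoothInd₂ φ β (W ω) (Y t ω) (Y s ω) - smoothInd₂ φ β (V ω) (Y t ω) (Y s ω)) ∂μ -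
        ∫ ω, (avgHess φ β Y μ t s (W ω) - avgHess φ β Y μ t s (V ω)) ∂μ := by
      rw [integral_sub (hf2 hWm t s) (hf2 hVm t s), integral_sub (hH hWm t s) (hH hVm t s),
        integral_smoothInd₂_partialSum hY hN hφ.le hφβ t s]
      ring
    have b1 : |∫ ω, (smoothInd₂ φ β (W ω) (Y t ω) (Y s ω) -
        smoothInd₂ φ β (V ω) (Y t ω) (Y s ω)) ∂μ| ≤ c * A * (6 * D * P) := by
      have hc3 : ∀ k, Integrable (fun ω => cub (w ω) (Y t ω) + cub (w ω) (Y s ω) +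
        cub (w ω) (Y k ω)) μ := fun k => ((hcubint t).add (hcubint s)).add (hcubint k)
      refine (abs_integral_le_of_abs_le (g := fun ω => c * A * ∑ k ∈ N t ∪ N s,
        (cub (w ω) (Y t ω) + cub (w ω) (Y s ω) + cub (w ω) (Y k ω)))
        ((integrable_finsetSum _ fun k _ => hc3 k).const_mul _)
        fun ω => ?_).trans ?_
      · rw [hV, partialSum_eq_sub (N t ∪ N s)]
        exact abs_smoothInd₂_sub_le_sum hβ.ne' hc (hthird _ (hDu t s) ω) (Y t ω) (Y s ω)
      · rw [integral_const_mul, integral_finsetSum _ fun k _ => hc3 k]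
        refine mul_le_mul_of_nonneg_left ?_ (by positivity)
        calc _ ≤ ∑ k ∈ N t ∪ N s, (P + P + P) := by
              refine Finset.sum_le_sum fun k _ => ?_
              rw [integral_add_three (hcubint t) (hcubint s) (hcubint k)]
              exact add_le_add (add_le_add (hcub t) (hcub s)) (hcub k)
          _ = ((N t ∪ N s).card : ℝ) * (3 * P) := by
              rw [Finset.sum_const, nsmul_eq_mul]; ring
          _ ≤ (2 * D : ℝ) * (3 * P) := by gcongr
          _ = _ := by ring
    have b2 : |∫ ω, (avgHess φ β Y μ t s (W ω) - avgHess φ β Y μ t s (V ω)) ∂μ| ≤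
        c * A * (6 * D * P) := by
      have hc3 : ∀ k, Integrable (fun ω => ∑ j, w ω j * m t j + ∑ j, w ω j * m s j +
        cub (w ω) (Y k ω)) μ := fun k => ((hcubint' t).add (hcubint' s)).add (hcubint k)
      refine (abs_integral_le_of_abs_le (g := fun ω => c * A * ∑ k ∈ N t ∪ N s,
        (∑ j, w ω j * m t j + ∑ j, w ω j * m s j + cub (w ω) (Y k ω)))
        ((integrable_finsetSum _ fun k _ => hc3 k).const_mul _)
        fun ω => ?_).trans ?_
      -- Here ω carries the sum and its weights, while ω' carries the independent copy of the pair;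
      -- the cubes of the copy are integrated first, with the weights frozen.
      · have hcst : ∀ x : ι → ℝ, Integrable (fun ω' => smoothInd₂ φ β x (Y t ω') (Y s ω')) μ :=
          fun x => hf2 measurable_const t s
        have hcu : ∀ u, Integrable (fun ω' => cub (w ω) (Y u ω')) μ := fun u =>
          integrable_finsetSum _ fun j _ => (hY.integrable_cube u j).const_mul _
        have hcu' : ∀ u, ∫ ω', cub (w ω) (Y u ω') ∂μ = ∑ j, w ω j * m u j := fun u => by
          simp only [cub]
          rw [integral_finsetSum _ fun j _ => (hY.integrable_cube u j).const_mul _]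
          exact Finset.sum_congr rfl fun j _ => integral_const_mul _ _
        have hc3' : ∀ k, Integrable (fun ω' => cub (w ω) (Y t ω') + cub (w ω) (Y s ω') +
          cub (w ω) (Y k ω)) μ := fun k => ((hcu t).add (hcu s)).add (integrable_const _)
        simp only [avgHess]
        rw [← integral_sub (hcst _) (hcst _)]
        refine (abs_integral_le_of_abs_le (g := fun ω' => c * A * ∑ k ∈ N t ∪ N s,
          (cub (w ω) (Y t ω') + cub (w ω) (Y s ω') + cub (w ω) (Y k ω)))
          ((integrable_finsetSum _ fun k _ => hc3' k).const_mul _)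
          fun ω' => ?_).trans (le_of_eq ?_)
        · rw [hV, partialSum_eq_sub (N t ∪ N s)]
          exact abs_smoothInd₂_sub_le_sum hβ.ne' hc (hthird _ (hDu t s) ω) (Y t ω') (Y s ω')
        · rw [integral_const_mul, integral_finsetSum _ fun k _ => hc3' k]
          congr 1
          refine Finset.sum_congr rfl fun k _ => ?_
          rw [integral_add_three (hcu t) (hcu s) (integrable_const _), hcu', hcu']
          simp
      · rw [integral_const_mul, integral_finsetSum _ fun k _ => hc3 k]
        refine mul_le_mul_of_nonneg_left ?_ (by positivity)
        calc _ ≤ ∑ k ∈ N t ∪ N s, (P + P + P) := by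
              refine Finset.sum_le_sum fun k _ => ?_
              rw [integral_add_three (hcubint' t) (hcubint' s) (hcubint k)]
              exact add_le_add (add_le_add (hcub' t) (hcub' s)) (hcub k)
          _ = ((N t ∪ N s).card : ℝ) * (3 * P) := by
              rw [Finset.sum_const, nsmul_eq_mul]; ring
          _ ≤ (2 * D : ℝ) * (3 * P) := by gcongr
          _ = _ := by ring
    rw [e]
    refine (abs_sub _ _).trans ((add_le_add b1 b2).trans (le_of_eq (by ring)))
  have hsum : ∫ ω, smoothInd₁ φ β (W ω) (∑ t, Y t ω) ∂μ =
      ∑ t, ∫ ω, smoothInd₁ φ β (W ω) (Y t ω) ∂μ := by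
    rw [← integral_finsetSum _ fun t _ => hf1 hWm t]
    refine integral_congr_ae (ae_of_all _ fun ω => ?_)
    have := smoothInd₁_sum φ β (W ω) 1 Finset.univ (fun t => Y t ω)
    simpa using this
  rw [hsum, sum_integral_smoothInd₂_mul hY hN hφ.le hφβ hWm, Finset.mul_sum,
    ← Finset.sum_sub_distrib]
  refine (Finset.abs_sum_le_sum_abs _ _).trans ?_
  rw [← nsmul_eq_mul, ← Finset.card_univ]
  refine Finset.sum_le_card_nsmul _ _ _ fun t _ => ?_
  have hlast : |c * ∑ s ∈ N t, ∫ ω, smoothInd₂ φ β (W ω) (Y t ω) (Y s ω) ∂μ -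
      c * ∑ s ∈ N t, ∫ ω, avgHess φ β Y μ t s (W ω) ∂μ| ≤ c ^ 2 * A * (12 * D ^ 2 * P) := by
    rw [← mul_sub, ← Finset.sum_sub_distrib, abs_mul, abs_of_nonneg hc]
    calc _ ≤ c * ∑ s ∈ N t, c * A * (12 * D * P) := by
          gcongr
          exact (Finset.abs_sum_le_sum_abs _ _).trans (Finset.sum_le_sum fun s _ => second t s)
      _ = c * ((N t).card * (c * A * (12 * D * P))) := by rw [Finset.sum_const, nsmul_eq_mul]
      _ ≤ c * (D * (c * A * (12 * D * P))) := by
          have : ((N t).card : ℝ) ≤ D := by exact_mod_cast hD t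
          gcongr
      _ = _ := by ring
  -- The first-order error 3D² and the second-order errors, 12D for each of at most D neighbours,
  -- add up to 15D².
  have h := (abs_add_le _ _).trans (add_le_add (first t) hlast)
  rw [sub_add_sub_cancel] at h
  exact h.trans (le_of_eq (by ring))

end Stein


/-! ### Joint continuity and measurability in base point and directions. -/

section JointContinuity

variable {ι : Type*} [Fintype ι] [Nonempty ι] {α : Type*} [TopologicalSpace α]

theorem Continuous.smoothInd₁ (φ β : ℝ) {x a : α → ι → ℝ} (hx : Continuous x) (ha : Continuous a) :
    Continuous fun p => smoothInd₁ φ β (x p) (a p) := by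
  classical
  simp only [smoothInd₁_eq_sum φ β _ (a _)]
  exact continuous_finsetSum _ fun j _ => ((continuous_smoothInd₁ φ β _).comp hx).mul
    ((continuous_apply j).comp ha)

theorem Continuous.smoothInd₂ (φ β : ℝ) {x a b : α → ι → ℝ} (hx : Continuous x)
    (ha : Continuous a) (hb : Continuous b) :
    Continuous fun p => smoothInd₂ φ β (x p) (a p) (b p) := by
  classical
  simp only [smoothInd₂_eq_sum φ β _ (a _)]
  exact continuous_finsetSum _ fun j _ => continuous_finsetSum _ fun k _ =>
    ((continuous_smoothInd₂ φ β _ _).comp hx).mul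
      (((continuous_apply j).comp ha).mul ((continuous_apply k).comp hb))

theorem Measurable.smoothInd₁ {α : Type*} [MeasurableSpace α] (φ β : ℝ) {x a : α → ι → ℝ}
    (hx : Measurable x) (ha : Measurable a) : Measurable fun p => smoothInd₁ φ β (x p) (a p) := by
  classical
  simp only [smoothInd₁_eq_sum φ β _ (a _)]
  exact Finset.measurable_sum _ fun j _ => ((continuous_smoothInd₁ φ β _).measurable.comp hx).mul
    ((measurable_pi_apply j).comp ha)

end JointContinuity

/-! ### Gaussian integration by parts through rotation invariance. -/

section GaussianIBP

variable {ι : Type*} [Fintype ι] [Nonempty ι] {γ : Measure (ι → ℝ)} [IsGaussian γ] {φ β : ℝ}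

theorem IsGaussian.integrable_norm_sq (γ : Measure (ι → ℝ)) [IsGaussian γ] :
    Integrable (fun z => ‖z‖ ^ 2) γ :=
  (IsGaussian.memLp_two_id (μ := γ)).integrable_norm_pow (by norm_num)

theorem IsGaussian.integrable_norm (γ : Measure (ι → ℝ)) [IsGaussian γ] :
    Integrable (fun z => ‖z‖) γ := (IsGaussian.integrable_id (μ := γ)).norm

theorem IsGaussian.integrable_eval (γ : Measure (ι → ℝ)) [IsGaussian γ] (j : ι) :
    Integrable (fun z => z j) γ := (IsGaussian.integrable_id (μ := γ)).eval j

theorem IsGaussian.integrable_eval_mul (γ : Measure (ι → ℝ)) [IsGaussian γ] (j k : ι) :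
    Integrable (fun z => z j * z k) γ :=
  ((IsGaussian.memLp_two_id (μ := γ)).eval j).integrable_mul
    ((IsGaussian.memLp_two_id (μ := γ)).eval k)

theorem measurePreserving_rotation (hγ : ∫ z, z ∂γ = 0) (t : ℝ) :
    MeasurePreserving (fun p : (ι → ℝ) × (ι → ℝ) =>
      (Real.cos t • p.1 + Real.sin t • p.2, -Real.sin t • p.1 + Real.cos t • p.2))
      (γ.prod γ) (γ.prod γ) :=
  ⟨by fun_prop, IsGaussian.map_rotation_eq_self hγ t⟩

/-- Let U, U' be the pair rotated by t. It has the law of the original pair, and the second original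
vector equals sin t · U + cos t · U'. The U' part integrates to zero, since U' is centered and
independent of U. -/
theorem integral_smoothInd₁_rotation (hφ : 0 ≤ φ) (hγ : ∫ z, z ∂γ = 0) (x : ι → ℝ) (s t : ℝ) :
    ∫ p, smoothInd₁ φ β (x + s • (Real.cos t • p.1 + Real.sin t • p.2)) p.2 ∂(γ.prod γ) =
      Real.sin t * ∫ z, smoothInd₁ φ β (x + s • z) z ∂γ := by
  classical
  have hM : (0 : ℝ) ≤ cutoffBound := zero_le_one.trans one_le_cutoffBound
  set F : (ι → ℝ) × (ι → ℝ) → ℝ := fun p =>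
    smoothInd₁ φ β (x + s • p.1) (Real.sin t • p.1 + Real.cos t • p.2) with hF
  have hFc : Continuous F := Continuous.smoothInd₁ φ β (by fun_prop) (by fun_prop)
  have e1 : ∫ p, smoothInd₁ φ β (x + s • (Real.cos t • p.1 + Real.sin t • p.2)) p.2 ∂(γ.prod γ) =
      ∫ p, F p ∂(γ.prod γ) := by
    have hmp := measurePreserving_rotation (γ := γ) hγ t
    rw [← hmp.map_eq, integral_map hmp.measurable.aemeasurable
      hFc.measurable.aestronglyMeasurable, hmp.map_eq]
    refine integral_congr_ae (ae_of_all _ fun p => ?_)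
    simp only [hF]
    congr 1
    ext j
    simp only [Pi.add_apply, Pi.smul_apply, smul_eq_mul]
    linear_combination (-(p.2 j)) * Real.sin_sq_add_cos_sq t
  have i1 : Integrable (fun z => smoothInd₁ φ β (x + s • z) z) γ := by
    refine ((IsGaussian.integrable_norm γ).const_mul (cutoffBound * φ)).mono'
      (Continuous.smoothInd₁ φ β (by fun_prop) (by fun_prop)).measurable.aestronglyMeasurable
      (ae_of_all _ fun z => abs_smoothInd₁_le hφ β _ _)
  have i2 : Integrable (fun p : (ι → ℝ) × (ι → ℝ) => smoothInd₁ φ β (x + s • p.1) p.2)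
      (γ.prod γ) := by
    refine (((IsGaussian.integrable_norm γ).comp_snd γ).const_mul (cutoffBound * φ)).mono'
      (Continuous.smoothInd₁ φ β (by fun_prop) (by fun_prop)).measurable.aestronglyMeasurable
      (ae_of_all _ fun z => abs_smoothInd₁_le hφ β _ _)
  have e2 : ∫ p : (ι → ℝ) × (ι → ℝ), smoothInd₁ φ β (x + s • p.1) p.2 ∂(γ.prod γ) = 0 := by
    rw [integral_prod _ i2]
    refine integral_eq_zero_of_ae (ae_of_all _ fun u => ?_)
    have hs : ∀ z, smoothInd₁ φ β (x + s • u) z = _ := smoothInd₁_eq_sum φ β (x + s • u)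
    change ∫ z, smoothInd₁ φ β (x + s • u) z ∂γ = 0
    rw [integral_congr_ae (ae_of_all _ hs),
      integral_finsetSum _ fun j _ => (IsGaussian.integrable_eval γ j).const_mul _]
    refine Finset.sum_eq_zero fun j _ => ?_
    rw [integral_const_mul]
    have h0 : ∫ z : ι → ℝ, z j ∂γ = 0 := by
      have := eval_integral (μ := γ) (f := fun z : ι → ℝ => z)
        (fun i => IsGaussian.integrable_eval γ i) j
      rw [← this, hγ]; rfl
    rw [h0, mul_zero]
  have i1' := i1.comp_fst γ
  have e3 : ∫ p : (ι → ℝ) × (ι → ℝ), smoothInd₁ φ β (x + s • p.1) p.1 ∂(γ.prod γ) =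
      ∫ z, smoothInd₁ φ β (x + s • z) z ∂γ := by
    rw [integral_prod _ i1']
    simp
  rw [e1]
  have e4 : ∀ p, F p = Real.sin t * smoothInd₁ φ β (x + s • p.1) p.1 +
      Real.cos t * smoothInd₁ φ β (x + s • p.1) p.2 := fun p => by
    simp only [hF, smoothInd₁_add, smoothInd₁_smul]
  simp only [e4]
  rw [integral_add (i1'.const_mul _) (i2.const_mul _), integral_const_mul, integral_const_mul,
    e2, e3, mul_zero, add_zero]

/-- Gaussian integration by parts. -/
theorem integral_smoothInd₁_eq [DecidableEq ι] (hφ : 0 < φ) (hφβ : φ ≤ β)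
    (hγ : ∫ z, z ∂γ = 0) (x : ι → ℝ) (s : ℝ) :
    ∫ z, smoothInd₁ φ β (x + s • z) z ∂γ =
      s * ∑ j, ∑ k, (∫ z, smoothInd₂ φ β (x + s • z) (Pi.single j 1) (Pi.single k 1) ∂γ) *
        ∫ z, z j * z k ∂γ := by
  have hM : (0 : ℝ) ≤ cutoffBound := zero_le_one.trans one_le_cutoffBound
  have hβ : 0 < β := hφ.trans_le hφβ
  set m := ∫ z, smoothInd₁ φ β (x + s • z) z ∂γ with hm
  set F : ℝ → (ι → ℝ) × (ι → ℝ) → ℝ := fun t p =>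
    smoothInd₁ φ β (x + s • (Real.cos t • p.1 + Real.sin t • p.2)) p.2 with hF
  set F' : ℝ → (ι → ℝ) × (ι → ℝ) → ℝ := fun t p =>
    smoothInd₂ φ β (x + s • (Real.cos t • p.1 + Real.sin t • p.2)) p.2
      (s • (-Real.sin t • p.1 + Real.cos t • p.2)) with hF'
  have hFc : ∀ t, Continuous (F t) := fun t => Continuous.smoothInd₁ φ β (by fun_prop) (by fun_prop)
  have hF'c : ∀ t, Continuous (F' t) := fun t =>
    Continuous.smoothInd₂ φ β (by fun_prop) (by fun_prop) (by fun_prop)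
  have hn1 := (IsGaussian.integrable_norm γ).comp_snd γ
  have hn2 := (IsGaussian.integrable_norm_sq γ).comp_snd γ
  have hn3 := (IsGaussian.integrable_norm γ).mul_prod (IsGaussian.integrable_norm γ)
  have hderiv := hasDerivAt_integral_of_dominated_loc_of_deriv_le (μ := γ.prod γ) (F := F)
    (F' := F') (x₀ := 0) (s := Set.univ)
    (bound := fun p => 3 * cutoffBound * φ * β * |s| * (‖p.1‖ * ‖p.2‖ + ‖p.2‖ ^ 2))
    Filter.univ_mem (Filter.Eventually.of_forall fun t => (hFc t).measurable.aestronglyMeasurable)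
    ((hn1.const_mul (cutoffBound * φ)).mono' (hFc 0).measurable.aestronglyMeasurable
      (ae_of_all _ fun p => abs_smoothInd₁_le hφ.le β _ _))
    (hF'c 0).measurable.aestronglyMeasurable
    (ae_of_all _ fun p t _ => by
      refine (abs_smoothInd₂_le hφ.le hφβ _ _ _).trans ?_
      rw [mul_assoc (3 * cutoffBound * φ * β)]
      refine mul_le_mul_of_nonneg_left ?_ (by positivity)
      have h1 : ‖s • (-Real.sin t • p.1 + Real.cos t • p.2)‖ ≤ |s| * (‖p.1‖ + ‖p.2‖) := by
        rw [norm_smul, Real.norm_eq_abs]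
        refine mul_le_mul_of_nonneg_left ((norm_add_le _ _).trans ?_) (abs_nonneg s)
        rw [norm_smul, norm_smul, Real.norm_eq_abs, Real.norm_eq_abs, abs_neg]
        refine add_le_add ?_ ?_
        · exact mul_le_of_le_one_left (norm_nonneg _) (Real.abs_sin_le_one t)
        · exact mul_le_of_le_one_left (norm_nonneg _) (Real.abs_cos_le_one t)
      calc ‖p.2‖ * ‖s • (-Real.sin t • p.1 + Real.cos t • p.2)‖
          ≤ ‖p.2‖ * (|s| * (‖p.1‖ + ‖p.2‖)) := by gcongr
        _ = _ := by ring)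
    ((hn3.add hn2).const_mul _)
    (ae_of_all _ fun p t _ => by
      refine hasDerivAt_smoothInd₁ φ hβ.ne' ?_ p.2
      exact ((((Real.hasDerivAt_cos t).smul_const p.1).add
        ((Real.hasDerivAt_sin t).smul_const p.2)).const_smul s).const_add x)
  -- The derivative at t = 0 is computed twice. The closed form sin t · m gives m, and
  -- differentiating under the integral gives the Hessian at the first vector applied to the
  -- independent second one, whose moments factor out.
  have hq : (fun t => ∫ p, F t p ∂(γ.prod γ)) = fun t => Real.sin t * m := by
    funext t
    exact integral_smoothInd₁_rotation hφ.le hγ x s t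
  have hd2 : HasDerivAt (fun t => Real.sin t * m) m 0 := by
    simpa using (Real.hasDerivAt_sin 0).mul_const m
  have hd1 := hderiv.2
  rw [hq] at hd1
  rw [hd2.unique hd1]
  have hval : ∀ p, F' 0 p = ∑ j, ∑ k, s *
      (smoothInd₂ φ β (x + s • p.1) (Pi.single j 1) (Pi.single k 1) * (p.2 j * p.2 k)) := by
    intro p
    simp only [hF', Real.sin_zero, Real.cos_zero, neg_zero, zero_smul, one_smul, zero_add,
      add_zero, smoothInd₂_smul]
    rw [smoothInd₂_eq_sum φ β _ p.2 p.2, Finset.mul_sum]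
    exact Finset.sum_congr rfl fun j _ => Finset.mul_sum ..
  have hint2 : ∀ j k, Integrable (fun z =>
      smoothInd₂ φ β (x + s • z) (Pi.single j 1) (Pi.single k 1)) γ := fun j k => by
    refine (integrable_const (3 * cutoffBound * φ * β * (1 * 1))).mono'
      ((continuous_smoothInd₂ φ β _ _).comp (by fun_prop)).measurable.aestronglyMeasurable
      (ae_of_all _ fun z => (abs_smoothInd₂_le hφ.le hφβ _ _ _).trans ?_)
    gcongr
    · exact norm_single_one_le j
    · exact norm_single_one_le k
  have hint : ∀ j k, Integrable (fun p : (ι → ℝ) × (ι → ℝ) => s *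
      (smoothInd₂ φ β (x + s • p.1) (Pi.single j 1) (Pi.single k 1) * (p.2 j * p.2 k)))
      (γ.prod γ) := fun j k =>
    ((hint2 j k).mul_prod (IsGaussian.integrable_eval_mul γ j k)).const_mul s
  simp only [hval]
  rw [integral_finsetSum _ fun j _ => integrable_finsetSum _ fun k _ => hint j k, Finset.mul_sum]
  refine Finset.sum_congr rfl fun j _ => ?_
  rw [integral_finsetSum _ fun k _ => hint j k, Finset.mul_sum]
  refine Finset.sum_congr rfl fun k _ => ?_
  rw [integral_const_mul]
  congr 1
  exact integral_prod_mul (μ := γ) (ν := γ)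
    (fun z => smoothInd₂ φ β (x + s • z) (Pi.single j 1) (Pi.single k 1)) (fun z => z j * z k)

end GaussianIBP

/-! ### Trigonometric interpolation between the sum and the Gaussian vector. -/

section Interpolation

variable {Ω : Type*} [MeasurableSpace Ω] {μ : Measure Ω} [IsProbabilityMeasure μ]
  {ι : Type*} [Fintype ι] [Nonempty ι] {γ : Measure (ι → ℝ)} [IsGaussian γ] {φ β : ℝ}

/-- The path from `γ` (at `θ = 0`) to the law of `S` (at `θ = π / 2`). -/
def interp (S : Ω → ι → ℝ) (θ : ℝ) (p : Ω × (ι → ℝ)) : ι → ℝ :=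
  Real.sin θ • S p.1 + Real.cos θ • p.2

theorem measurable_interp {S : Ω → ι → ℝ} (hS : Measurable S) (θ : ℝ) :
    Measurable (interp S θ) := by
  unfold interp
  fun_prop

theorem hasDerivAt_interp (S : Ω → ι → ℝ) (p : Ω × (ι → ℝ)) (θ : ℝ) :
    HasDerivAt (fun θ => interp S θ p) (Real.cos θ • S p.1 - Real.sin θ • p.2) θ := by
  have h := ((Real.hasDerivAt_sin θ).smul_const (S p.1)).add
    ((Real.hasDerivAt_cos θ).smul_const p.2)
  rw [neg_smul, ← sub_eq_add_neg] at h
  exact h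

/-- The coefficients sin θ and cos θ and their derivatives are bounded by one, so one integrable
bound serves every θ and there is no singularity at the endpoints. -/
theorem hasDerivAt_integral_interp (hφ : 0 ≤ φ) (hβ : β ≠ 0) {S : Ω → ι → ℝ} (hS : Measurable S)
    (hSi : Integrable S μ) (y : ι → ℝ) (θ : ℝ) :
    HasDerivAt (fun θ => ∫ p, smoothInd φ β (interp S θ p - y) ∂(μ.prod γ))
      (∫ p, smoothInd₁ φ β (interp S θ p - y) (Real.cos θ • S p.1 - Real.sin θ • p.2)
        ∂(μ.prod γ)) θ := by
  have hM : (0 : ℝ) ≤ cutoffBound := zero_le_one.trans one_le_cutoffBound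
  have hW : ∀ θ, Measurable fun p : Ω × (ι → ℝ) => interp S θ p - y := fun θ =>
    (measurable_interp hS θ).sub_const y
  have hf : ∀ θ, AEStronglyMeasurable (fun p : Ω × (ι → ℝ) => smoothInd φ β (interp S θ p - y))
      (μ.prod γ) := fun θ =>
    ((continuous_smoothInd φ β).measurable.comp (hW θ)).aestronglyMeasurable
  have hf' : Measurable fun p : Ω × (ι → ℝ) =>
      smoothInd₁ φ β (interp S θ p - y) (Real.cos θ • S p.1 - Real.sin θ • p.2) :=
    Measurable.smoothInd₁ φ β (hW θ) (by fun_prop)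
  have hfi : Integrable (fun p : Ω × (ι → ℝ) => smoothInd φ β (interp S θ p - y))
      (μ.prod γ) := by
    refine (integrable_const (1 : ℝ)).mono' (hf θ) (ae_of_all _ fun p => ?_)
    rw [Real.norm_eq_abs, smoothInd, abs_of_nonneg (cutoff_nonneg _)]
    exact cutoff_le_one _
  have hbound : ∀ (p : Ω × (ι → ℝ)) (t : ℝ),
      ‖smoothInd₁ φ β (interp S t p - y) (Real.cos t • S p.1 - Real.sin t • p.2)‖ ≤
        cutoffBound * φ * (‖S p.1‖ + ‖p.2‖) := by
    intro p t
    refine (abs_smoothInd₁_le hφ β _ _).trans ?_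
    gcongr
    refine (norm_sub_le _ _).trans (add_le_add ?_ ?_)
    · rw [norm_smul]
      exact mul_le_of_le_one_left (norm_nonneg _) (Real.abs_cos_le_one t)
    · rw [norm_smul]
      exact mul_le_of_le_one_left (norm_nonneg _) (Real.abs_sin_le_one t)
  have hbi : Integrable (fun p : Ω × (ι → ℝ) => cutoffBound * φ * (‖S p.1‖ + ‖p.2‖))
      (μ.prod γ) :=
    ((hSi.norm.comp_fst γ).add ((IsGaussian.integrable_norm γ).comp_snd μ)).const_mul _
  have hderiv : ∀ (p : Ω × (ι → ℝ)) (t : ℝ),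
      HasDerivAt (fun t => smoothInd φ β (interp S t p - y))
        (smoothInd₁ φ β (interp S t p - y) (Real.cos t • S p.1 - Real.sin t • p.2)) t :=
    fun p t => hasDerivAt_smoothInd φ hβ ((hasDerivAt_interp S p t).sub_const y)
  exact (hasDerivAt_integral_of_dominated_loc_of_deriv_le Filter.univ_mem
    (Filter.Eventually.of_forall hf) hfi hf'.aestronglyMeasurable
    (ae_of_all _ fun p t _ => hbound p t) hbi (ae_of_all _ fun p t _ => hderiv p t)).2

end Interpolation


/-! ### The derivative along the interpolation. -/

section Drift

variable {Ω : Type*} [MeasurableSpace Ω] {μ : Measure Ω} [IsProbabilityMeasure μ]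
  {ι κ : Type*} [Fintype ι] [Nonempty ι] [Fintype κ] [DecidableEq κ] [Nonempty κ]
  {γ : Measure (ι → ℝ)} [IsGaussian γ]
  {B τ : ℝ} {Y : κ → Ω → ι → ℝ} {φ β : ℝ} {N : κ → Finset κ} {D : ℕ}

/-- The normalized sum of a finite family. -/
def scaledSum (Y : κ → Ω → ι → ℝ) (ω : Ω) : ι → ℝ :=
  (√(Fintype.card κ : ℝ))⁻¹ • ∑ t, Y t ω

theorem SubExp.measurable_scaledSum (hY : SubExp B Y μ) : Measurable (scaledSum Y) := by
  have := hY.measurable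
  unfold scaledSum
  fun_prop

theorem SubExp.integrable_scaledSum (hY : SubExp B Y μ) : Integrable (scaledSum Y) μ := by
  refine Integrable.of_eval fun j => ?_
  have h : (fun ω => scaledSum Y ω j) =
      fun ω => (√(Fintype.card κ : ℝ))⁻¹ * ∑ t, Y t ω j := by
    ext ω
    simp [scaledSum]
  rw [h]
  exact (integrable_finsetSum _ fun t _ => hY.integrable_eval t j).const_mul _

theorem interp_sub_eq_partialSum (y : ι → ℝ) (θ : ℝ) (ω : Ω) (z : ι → ℝ) :
    interp (scaledSum Y) θ (ω, z) - y =
      partialSum (Real.cos θ • z - y) (Real.sin θ * (√(Fintype.card κ : ℝ))⁻¹) Y ∅ ω := by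
  simp only [interp, scaledSum, partialSum, Finset.compl_empty, smul_smul]
  abel

theorem interp_sub_eq_add (S : Ω → ι → ℝ) (y : ι → ℝ) (θ : ℝ) (ω : Ω) (z : ι → ℝ) :
    interp S θ (ω, z) - y = (Real.sin θ • S ω - y) + Real.cos θ • z := by
  simp only [interp]
  abel

/-- The drift along S gives sin θ times the trace of the Hessian against the covariance, up to
Stein's error, and the drift along G gives exactly cos θ times it. Weighted by cos θ and - sin θ
these cancel, because the covariances agree. Stein's bound is applied with the Gaussian vector
frozen, integration by parts with the sum frozen. -/
theorem abs_integral_smoothInd₁_interp_le (hY : SubExp B Y μ) (hN : LocallyDependent N Y μ)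
    (hφ : 0 < φ) (hφβ : φ ≤ β) (hτ : 0 ≤ τ) (hγ : ∫ z, z ∂γ = 0)
    (hcov : ∀ j k, ∫ z, z j * z k ∂γ = ∫ ω, scaledSum Y ω j * scaledSum Y ω k ∂μ)
    (hτβ : (√(Fintype.card κ : ℝ))⁻¹ * ((2 * D : ℕ) * τ) ≤ β⁻¹) (hD : ∀ t, (N t).card ≤ D)
    (y : ι → ℝ) {θ : ℝ} (hθ : θ ∈ Set.Icc 0 (Real.pi / 2)) :
    |∫ p, smoothInd₁ φ β (interp (scaledSum Y) θ p - y)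
        (Real.cos θ • scaledSum Y p.1 - Real.sin θ • p.2) ∂(μ.prod γ)| ≤
      (√(Fintype.card κ : ℝ))⁻¹ * (13 * cutoffBound * φ * β ^ 2) * (15 * D ^ 2 *
        (15000 * B ^ 3 * ((μ.prod γ).real {p | interp (scaledSum Y) θ p - y ∈ shell φ β 3} +
          tailError ι κ B τ))) := by
  classical
  have hM : (0 : ℝ) ≤ cutoffBound := zero_le_one.trans one_le_cutoffBound
  have hβ : 0 < β := hφ.trans_le hφβ
  have hB := hY.pos
  set S := scaledSum Y with hS
  set r := (√(Fintype.card κ : ℝ))⁻¹ with hr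
  have hn : (0 : ℝ) < Fintype.card κ := by exact_mod_cast Fintype.card_pos
  have hr0 : 0 < r := by rw [hr]; positivity
  have hr2 : Fintype.card κ * r ^ 2 = 1 := by
    rw [hr, inv_pow, Real.sq_sqrt hn.le]; field_simp
  have hsin0 : 0 ≤ Real.sin θ :=
    Real.sin_nonneg_of_mem_Icc ⟨hθ.1, by linarith [hθ.2, Real.pi_pos]⟩
  have hsin1 : Real.sin θ ≤ 1 := Real.sin_le_one θ
  set c := Real.sin θ * r with hc
  have hc0 : 0 ≤ c := by positivity
  have hτβ' : c * ((2 * D : ℕ) * τ) ≤ β⁻¹ := by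
    refine le_trans ?_ hτβ
    have : c ≤ r := mul_le_of_le_one_left hr0.le hsin1
    gcongr
  have hSm : Measurable S := hY.measurable_scaledSum
  have hSi : Integrable S μ := hY.integrable_scaledSum
  set W : Ω × (ι → ℝ) → ι → ℝ := fun p => interp S θ p - y with hW
  have hWm : Measurable W := (measurable_interp hSm θ).sub_const y
  set A := 13 * cutoffBound * φ * β ^ 2 with hA
  have hA0 : 0 ≤ A := by positivity
  -- integrability
  have i1 : Integrable (fun p : Ω × (ι → ℝ) => smoothInd₁ φ β (W p) (S p.1)) (μ.prod γ) :=
    ((hSi.norm.comp_fst γ).const_mul (cutoffBound * φ)).mono'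
      (Measurable.smoothInd₁ φ β hWm (hSm.comp measurable_fst)).aestronglyMeasurable
      (ae_of_all _ fun p => abs_smoothInd₁_le hφ.le β _ _)
  have i2 : Integrable (fun p : Ω × (ι → ℝ) => smoothInd₁ φ β (W p) p.2) (μ.prod γ) :=
    (((IsGaussian.integrable_norm γ).comp_snd μ).const_mul (cutoffBound * φ)).mono'
      (Measurable.smoothInd₁ φ β hWm measurable_snd).aestronglyMeasurable
      (ae_of_all _ fun p => abs_smoothInd₁_le hφ.le β _ _)
  have i3 : ∀ j k, Integrable (fun p : Ω × (ι → ℝ) =>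
      smoothInd₂ φ β (W p) (Pi.single j 1) (Pi.single k 1)) (μ.prod γ) := fun j k => by
    refine (integrable_const (3 * cutoffBound * φ * β * (1 * 1))).mono'
      ((continuous_smoothInd₂ φ β _ _).measurable.comp hWm).aestronglyMeasurable
      (ae_of_all _ fun z => (abs_smoothInd₂_le hφ.le hφβ _ _ _).trans ?_)
    gcongr
    · exact norm_single_one_le j
    · exact norm_single_one_le k
  set H : ι → ι → ℝ := fun j k =>
    ∫ p, smoothInd₂ φ β (W p) (Pi.single j 1) (Pi.single k 1) ∂(μ.prod γ) with hH
  -- the Gaussian part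
  have hI2 : ∫ p : Ω × (ι → ℝ), smoothInd₁ φ β (W p) p.2 ∂(μ.prod γ) =
      Real.cos θ * ∑ j, ∑ k, H j k * ∫ z, z j * z k ∂γ := by
    rw [integral_prod _ i2]
    have h : ∀ ω, ∫ z, smoothInd₁ φ β (W (ω, z)) z ∂γ = Real.cos θ * ∑ j, ∑ k,
        (∫ z, smoothInd₂ φ β (W (ω, z)) (Pi.single j 1) (Pi.single k 1) ∂γ) *
          ∫ z, z j * z k ∂γ := by
      intro ω
      simp only [hW, interp_sub_eq_add S y θ ω]
      exact integral_smoothInd₁_eq hφ hφβ hγ _ _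
    have i4 : ∀ j k, Integrable (fun ω => (∫ z, smoothInd₂ φ β (W (ω, z)) (Pi.single j 1)
        (Pi.single k 1) ∂γ) * ∫ z, z j * z k ∂γ) μ := fun j k =>
      (i3 j k).integral_prod_left.mul_const _
    rw [integral_congr_ae (ae_of_all _ h), integral_const_mul,
      integral_finsetSum _ fun j _ => integrable_finsetSum _ fun k _ => i4 j k]
    congr 1
    refine Finset.sum_congr rfl fun j _ => ?_
    rw [integral_finsetSum _ fun k _ => i4 j k]
    refine Finset.sum_congr rfl fun k _ => ?_
    rw [integral_mul_const, hH]
    simp only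
    rw [integral_prod _ (i3 j k)]
  -- the sum part
  have hI1 : |∫ p : Ω × (ι → ℝ), smoothInd₁ φ β (W p) (S p.1) ∂(μ.prod γ) -
      Real.sin θ * ∑ j, ∑ k, H j k * ∫ z, z j * z k ∂γ| ≤ r * A * (15 * D ^ 2 *
        (15000 * B ^ 3 * ((μ.prod γ).real {p | W p ∈ shell φ β 3} + tailError ι κ B τ))) := by
    have i4 : ∀ j k, Integrable (fun z => (∫ ω, smoothInd₂ φ β (W (ω, z)) (Pi.single j 1)
        (Pi.single k 1) ∂μ) * ∫ z, z j * z k ∂γ) γ := fun j k =>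
      (i3 j k).integral_prod_right.mul_const _
    have e : ∫ p : Ω × (ι → ℝ), smoothInd₁ φ β (W p) (S p.1) ∂(μ.prod γ) -
        Real.sin θ * ∑ j, ∑ k, H j k * ∫ z, z j * z k ∂γ =
        ∫ z, (∫ ω, smoothInd₁ φ β (W (ω, z)) (S ω) ∂μ -
          Real.sin θ * ∑ j, ∑ k, (∫ ω, smoothInd₂ φ β (W (ω, z)) (Pi.single j 1)
            (Pi.single k 1) ∂μ) * ∫ z, z j * z k ∂γ) ∂γ := by
      rw [integral_sub i1.integral_prod_right ((integrable_finsetSum _ fun j _ =>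
        integrable_finsetSum _ fun k _ => i4 j k).const_mul _), ← integral_prod_symm _ i1,
        integral_const_mul,
        integral_finsetSum _ fun j _ => integrable_finsetSum _ fun k _ => i4 j k]
      congr 2
      refine Finset.sum_congr rfl fun j _ => ?_
      rw [integral_finsetSum _ fun k _ => i4 j k]
      refine Finset.sum_congr rfl fun k _ => ?_
      rw [integral_mul_const, hH]
      simp only
      rw [integral_prod_symm _ (i3 j k)]
    have hset : MeasurableSet {p : Ω × (ι → ℝ) | W p ∈ shell φ β 3} :=
      hWm (measurableSet_shell φ β 3)
    have i5 : Integrable ({p : Ω × (ι → ℝ) | W p ∈ shell φ β 3}.indicator (1 : Ω × (ι → ℝ) → ℝ))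
        (μ.prod γ) := (integrable_const (1 : ℝ)).indicator hset
    have e5 : ∀ z, ∫ ω, {p : Ω × (ι → ℝ) | W p ∈ shell φ β 3}.indicator
        (1 : Ω × (ι → ℝ) → ℝ) (ω, z) ∂μ =
        μ.real {ω | W (ω, z) ∈ shell φ β 3} := fun z =>
      integral_indicator_one (s := {ω | W (ω, z) ∈ shell φ β 3})
        (hset.preimage (by fun_prop : Measurable fun ω => (ω, z)))
    have i6 : Integrable (fun z => μ.real {ω | W (ω, z) ∈ shell φ β 3}) γ := by
      refine (i5.integral_prod_right).congr (ae_of_all _ fun z => ?_)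
      exact e5 z
    have e6 : ∫ z, μ.real {ω | W (ω, z) ∈ shell φ β 3} ∂γ =
        (μ.prod γ).real {p | W p ∈ shell φ β 3} := by
      rw [← integral_indicator_one hset, integral_prod_symm _ i5]
      exact integral_congr_ae (ae_of_all _ fun z => (e5 z).symm)
    rw [e]
    refine (abs_integral_le_of_abs_le (g := fun z => r * A * (15 * D ^ 2 *
      (15000 * B ^ 3 * (μ.real {ω | W (ω, z) ∈ shell φ β 3} + tailError ι κ B τ))))
      ((((i6.add (integrable_const _)).const_mul _).const_mul _).const_mul _) fun z => ?_).trans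
      (le_of_eq ?_)
    · have h := abs_integral_smoothInd₁_sub_le (x₀ := Real.cos θ • z - y) hY hN hφ hφβ hc0 hτ
        hτβ' hD
      have hfun : ∀ ω, W (ω, z) = partialSum (Real.cos θ • z - y) c Y ∅ ω := fun ω =>
        interp_sub_eq_partialSum y θ ω z
      have hcov' : ∀ j k, Real.sin θ * ∫ z, z j * z k ∂γ =
          r * (c * ∫ ω, (∑ t, Y t ω) j * (∑ t, Y t ω) k ∂μ) := by
        intro j k
        have : ∀ ω, S ω j * S ω k = r ^ 2 * ((∑ t, Y t ω) j * (∑ t, Y t ω) k) := by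
          intro ω
          simp only [hS, scaledSum, Pi.smul_apply, smul_eq_mul]
          rw [← hr]; ring
        rw [hcov, integral_congr_ae (ae_of_all _ this), integral_const_mul, hc]
        ring
      have hlin : ∀ ω, smoothInd₁ φ β (W (ω, z)) (S ω) =
          r * smoothInd₁ φ β (partialSum (Real.cos θ • z - y) c Y ∅ ω) (∑ t, Y t ω) := by
        intro ω
        rw [← smoothInd₁_smul, ← hfun]
        rfl
      have e7 : ∫ ω, smoothInd₁ φ β (W (ω, z)) (S ω) ∂μ -
          Real.sin θ * ∑ j, ∑ k, (∫ ω, smoothInd₂ φ β (W (ω, z)) (Pi.single j 1)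
            (Pi.single k 1) ∂μ) * ∫ z, z j * z k ∂γ =
          r * (∫ ω, smoothInd₁ φ β (partialSum (Real.cos θ • z - y) c Y ∅ ω) (∑ t, Y t ω) ∂μ -
            c * ∑ j, ∑ k, (∫ ω, smoothInd₂ φ β (partialSum (Real.cos θ • z - y) c Y ∅ ω)
              (Pi.single j 1) (Pi.single k 1) ∂μ) *
                ∫ ω, (∑ t, Y t ω) j * (∑ t, Y t ω) k ∂μ) := by
        rw [integral_congr_ae (ae_of_all _ hlin), integral_const_mul, mul_sub]
        congr 1
        simp only [Finset.mul_sum, hfun]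
        refine Finset.sum_congr rfl fun j _ => Finset.sum_congr rfl fun k _ => ?_
        linear_combination (∫ ω, smoothInd₂ φ β (partialSum (Real.cos θ • z - y) c Y ∅ ω)
              (Pi.single j 1) (Pi.single k 1) ∂μ) * hcov' j k
      rw [e7, abs_mul, abs_of_pos hr0, mul_assoc r A]
      refine mul_le_mul_of_nonneg_left (h.trans ?_) hr0.le
      have hcub : cubBound φ β τ B (Real.cos θ • z - y) c Y μ =
          15000 * B ^ 3 * (μ.real {ω | W (ω, z) ∈ shell φ β 3} + tailError ι κ B τ) := by
        rw [cubBound]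
        simp only [hfun]
      rw [hcub]
      -- There are n summands with errors of order c² = sin² θ / n, so the sum over them costs
      -- nothing and the outer factor r = n^(-1/2) survives.
      have hnc : Fintype.card κ * c ^ 2 ≤ 1 := by
        have : Fintype.card κ * c ^ 2 = Real.sin θ ^ 2 := by
          rw [hc, mul_pow]; linear_combination Real.sin θ ^ 2 * hr2
        rw [this]
        exact pow_le_one₀ hsin0 hsin1
      have hT : 0 ≤ A * (15 * D ^ 2 *
          (15000 * B ^ 3 * (μ.real {ω | W (ω, z) ∈ shell φ β 3} + tailError ι κ B τ))) := by
        rw [tailError]; positivity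
      calc _ = (Fintype.card κ * c ^ 2) * (A * (15 * D ^ 2 *
          (15000 * B ^ 3 * (μ.real {ω | W (ω, z) ∈ shell φ β 3} + tailError ι κ B τ)))) := by ring
        _ ≤ _ := mul_le_of_le_one_left hT hnc
    · rw [integral_const_mul, integral_const_mul, integral_const_mul,
        integral_add i6 (integrable_const _), e6]
      simp
  have hfin : ∫ p, smoothInd₁ φ β (W p) (Real.cos θ • S p.1 - Real.sin θ • p.2) ∂(μ.prod γ) =
      Real.cos θ * (∫ p : Ω × (ι → ℝ), smoothInd₁ φ β (W p) (S p.1) ∂(μ.prod γ) -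
        Real.sin θ * ∑ j, ∑ k, H j k * ∫ z, z j * z k ∂γ) := by
    have h : ∀ p : Ω × (ι → ℝ), smoothInd₁ φ β (W p) (Real.cos θ • S p.1 - Real.sin θ • p.2) =
        Real.cos θ * smoothInd₁ φ β (W p) (S p.1) - Real.sin θ * smoothInd₁ φ β (W p) p.2 := by
      intro p
      rw [sub_eq_add_neg, ← neg_smul, smoothInd₁_add, smoothInd₁_smul, smoothInd₁_smul]
      ring
    rw [integral_congr_ae (ae_of_all _ h), integral_sub (i1.const_mul _) (i2.const_mul _),
      integral_const_mul, integral_const_mul, hI2]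
    ring
  rw [hfin, abs_mul]
  exact (mul_le_of_le_one_left (abs_nonneg _) (Real.abs_cos_le_one θ)).trans hI1

end Drift

/-! ### The self-bounding inequality for the Kolmogorov distance. -/

section Recursion

variable {Ω : Type*} [MeasurableSpace Ω] {μ : Measure Ω} [IsProbabilityMeasure μ]
  {ι κ : Type*} [Fintype ι] [Nonempty ι] [Fintype κ] [DecidableEq κ] [Nonempty κ]
  {γ : Measure (ι → ℝ)} [IsGaussian γ]
  {B τ : ℝ} {Y : κ → Ω → ι → ℝ} {φ β : ℝ} {N : κ → Finset κ} {D : ℕ}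

/-- The distribution function of the interpolation. -/
def interpCdf (μ : Measure Ω) (γ : Measure (ι → ℝ)) (S : Ω → ι → ℝ) (θ : ℝ) (y : ι → ℝ) : ℝ :=
  (μ.prod γ).real {p | interp S θ p ∈ Set.Iic y}

theorem interpCdf_zero (S : Ω → ι → ℝ) (y : ι → ℝ) :
    interpCdf μ γ S 0 y = γ.real (Set.Iic y) := by
  have : {p : Ω × (ι → ℝ) | interp S 0 p ∈ Set.Iic y} = Set.univ ×ˢ Set.Iic y := by
    ext p; simp [interp]
  rw [interpCdf, this, measureReal_prod_prod, probReal_univ, one_mul]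

theorem interpCdf_pi_div_two (S : Ω → ι → ℝ) (y : ι → ℝ) :
    interpCdf μ γ S (Real.pi / 2) y = μ.real {ω | S ω ∈ Set.Iic y} := by
  have : {p : Ω × (ι → ℝ) | interp S (Real.pi / 2) p ∈ Set.Iic y} =
      {ω | S ω ∈ Set.Iic y} ×ˢ Set.univ := by
    ext p; simp [interp]
  rw [interpCdf, this, measureReal_prod_prod, probReal_univ, mul_one]

theorem le_of_smoothInd_ne_zero (hφ : 0 < φ) (hφβ : φ ≤ β) {x : ι → ℝ}
    (h : smoothInd φ β x ≠ 0) (j : ι) : x j ≤ φ⁻¹ := by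
  by_contra! hj
  refine h (cutoff_of_one_le ?_)
  have h1 := hj.le.trans (le_lse (hφ.trans_le hφβ) x j)
  have h2 := mul_le_mul_of_nonneg_left h1 hφ.le
  rwa [mul_inv_cancel₀ hφ.ne'] at h2

theorem mul_lse_le (hφ : 0 < φ) (hφβ : φ ≤ β)
    (hK : φ * (β⁻¹ * Real.log (Fintype.card ι)) ≤ 1) {x : ι → ℝ} {m : ℝ}
    (h : ∀ j, x j ≤ m) : φ * lse β x ≤ φ * m + 1 := by
  have h1 := mul_le_mul_of_nonneg_left (lse_le_of_forall_le (hφ.trans_le hφβ) h) hφ.le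
  linarith

theorem smoothInd_eq_one (hφ : 0 < φ) (hφβ : φ ≤ β)
    (hK : φ * (β⁻¹ * Real.log (Fintype.card ι)) ≤ 1) {x : ι → ℝ} (h : ∀ j, x j ≤ -φ⁻¹) :
    smoothInd φ β x = 1 := by
  refine cutoff_of_nonpos ((mul_lse_le hφ hφβ hK h).trans (le_of_eq ?_))
  field_simp
  ring

theorem integrable_smoothInd_interp {S : Ω → ι → ℝ} (hS : Measurable S) (y : ι → ℝ) (θ : ℝ) :
    Integrable (fun p => smoothInd φ β (interp S θ p - y)) (μ.prod γ) := by
  refine (integrable_const (1 : ℝ)).mono' ((continuous_smoothInd φ β).measurable.comp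
    ((measurable_interp hS θ).sub_const y)).aestronglyMeasurable (ae_of_all _ fun p => ?_)
  rw [Real.norm_eq_abs, smoothInd, abs_of_nonneg (cutoff_nonneg _)]
  exact cutoff_le_one _

theorem integral_smoothInd_interp_le (hφ : 0 < φ) (hφβ : φ ≤ β) {S : Ω → ι → ℝ}
    (hS : Measurable S) (y : ι → ℝ) (θ : ℝ) :
    ∫ p, smoothInd φ β (interp S θ p - y) ∂(μ.prod γ) ≤
      interpCdf μ γ S θ (fun j => y j + φ⁻¹) := by
  have hm : MeasurableSet {p | interp S θ p ∈ Set.Iic (fun j => y j + φ⁻¹)} :=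
    measurable_interp hS θ measurableSet_Iic
  rw [interpCdf, ← integral_indicator_one hm]
  refine integral_mono (integrable_smoothInd_interp hS y θ)
    ((integrable_const (1 : ℝ)).indicator hm) fun p => ?_
  by_cases hp : p ∈ {p | interp S θ p ∈ Set.Iic (fun j => y j + φ⁻¹)}
  · rw [Set.indicator_of_mem hp]
    exact cutoff_le_one _
  · rw [Set.indicator_of_notMem hp]
    refine le_of_eq ?_
    by_contra h
    refine hp fun j => ?_
    have := le_of_smoothInd_ne_zero hφ hφβ h j
    simp only [Pi.sub_apply] at this
    simp only
    linarith

theorem le_integral_smoothInd_interp (hφ : 0 < φ) (hφβ : φ ≤ β)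
    (hK : φ * (β⁻¹ * Real.log (Fintype.card ι)) ≤ 1) {S : Ω → ι → ℝ}
    (hS : Measurable S) (y : ι → ℝ) (θ : ℝ) :
    interpCdf μ γ S θ (fun j => y j - φ⁻¹) ≤
      ∫ p, smoothInd φ β (interp S θ p - y) ∂(μ.prod γ) := by
  have hm : MeasurableSet {p | interp S θ p ∈ Set.Iic (fun j => y j - φ⁻¹)} :=
    measurable_interp hS θ measurableSet_Iic
  rw [interpCdf, ← integral_indicator_one hm]
  refine integral_mono ((integrable_const (1 : ℝ)).indicator hm)
    (integrable_smoothInd_interp hS y θ) fun p => ?_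
  by_cases hp : p ∈ {p | interp S θ p ∈ Set.Iic (fun j => y j - φ⁻¹)}
  · rw [Set.indicator_of_mem hp]
    refine le_of_eq (smoothInd_eq_one hφ hφβ hK fun j => ?_).symm
    have := hp j
    simp only [Pi.sub_apply]
    linarith
  · rw [Set.indicator_of_notMem hp]
    exact cutoff_nonneg _

/-- In the shell, φ times the smooth maximum of x - y lies in [-3, 4]. Hence all coordinates are at
most 4/φ, and they are not all below -5/φ, since that would push it down to -5 + 1 = -4. -/
theorem measureReal_shell_le (hφ : 0 < φ) (hφβ : φ ≤ β)
    (hK : φ * (β⁻¹ * Real.log (Fintype.card ι)) ≤ 1) {S : Ω → ι → ℝ}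
    (hS : Measurable S) (y : ι → ℝ) (θ : ℝ) :
    (μ.prod γ).real {p | interp S θ p - y ∈ shell φ β 3} ≤
      interpCdf μ γ S θ (fun j => y j + 4 * φ⁻¹) - interpCdf μ γ S θ (fun j => y j - 5 * φ⁻¹) := by
  have hφ' : 0 < φ⁻¹ := inv_pos.2 hφ
  have hsub : {p | interp S θ p ∈ Set.Iic (fun j => y j - 5 * φ⁻¹)} ⊆
      {p | interp S θ p ∈ Set.Iic (fun j => y j + 4 * φ⁻¹)} := fun p hp j => by
    have := hp j
    simp only at this ⊢
    linarith
  rw [interpCdf, interpCdf, ← measureReal_sdiff hsub (measurable_interp hS θ measurableSet_Iic)]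
  refine measureReal_mono fun p hp => ⟨fun j => ?_, fun h => ?_⟩
  · have h1 := (mul_le_mul_of_nonneg_left
      (le_lse (hφ.trans_le hφβ) (interp S θ p - y) j) hφ.le).trans hp.2
    rw [← le_div_iff₀' hφ, div_eq_mul_inv] at h1
    simp only [Pi.sub_apply] at h1 ⊢
    linarith
  · have h1 := mul_lse_le hφ hφβ hK (x := interp S θ p - y) (m := -(5 * φ⁻¹)) fun j => by
      have := h j
      simp only [Pi.sub_apply] at this ⊢
      linarith
    have h2 : φ * -(5 * φ⁻¹) = -5 := by field_simp
    have := hp.1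
    linarith

/-- Kolmogorov distance between a locally dependent sum and a Gaussian vector over lower orthants,
given an anti-concentration constant `α` of the Gaussian. -/
theorem abs_measureReal_scaledSum_sub_le (hY : SubExp B Y μ) (hN : LocallyDependent N Y μ)
    (hφ : 0 < φ) (hφβ : φ ≤ β) (hτ : 0 ≤ τ) (hγ : ∫ z, z ∂γ = 0)
    (hcov : ∀ j k, ∫ z, z j * z k ∂γ = ∫ ω, scaledSum Y ω j * scaledSum Y ω k ∂μ)
    (hτβ : (√(Fintype.card κ : ℝ))⁻¹ * ((2 * D : ℕ) * τ) ≤ β⁻¹) (hD : ∀ t, (N t).card ≤ D)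
    (hK : φ * (β⁻¹ * Real.log (Fintype.card ι)) ≤ 1) {α : ℝ}
    (hα : ∀ (y : ι → ℝ) (δ : ℝ), 0 ≤ δ →
      γ.real (Set.Iic fun j => y j + δ) ≤ γ.real (Set.Iic y) + α * δ)
    (hsmall : Real.pi / 2 * ((√(Fintype.card κ : ℝ))⁻¹ * (13 * cutoffBound * φ * β ^ 2) *
      (15 * D ^ 2 * (15000 * B ^ 3))) ≤ 1 / 4) (y : ι → ℝ) :
    |μ.real {ω | scaledSum Y ω ∈ Set.Iic y} - γ.real (Set.Iic y)| ≤
      9 * (α * φ⁻¹) + tailError ι κ B τ := by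
  have hM : (0 : ℝ) ≤ cutoffBound := zero_le_one.trans one_le_cutoffBound
  have hβ : 0 < β := hφ.trans_le hφβ
  have hφ' : 0 < φ⁻¹ := inv_pos.2 hφ
  have hB := hY.pos
  set S := scaledSum Y with hS
  set η := tailError ι κ B τ with hη
  have hη0 : 0 ≤ η := by rw [hη, tailError]; positivity
  have hSm : Measurable S := hY.measurable_scaledSum
  have hpi : (0 : ℝ) ≤ Real.pi / 2 := by positivity
  set C := (√(Fintype.card κ : ℝ))⁻¹ * (13 * cutoffBound * φ * β ^ 2) *
      (15 * D ^ 2 * (15000 * B ^ 3)) with hC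
  have hC0 : 0 ≤ C := by positivity
  -- The supremum runs over the whole path, not only its end, because the shell probabilities in the
  -- drift concern every intermediate law.
  set dist : Set.Icc (0 : ℝ) (Real.pi / 2) × (ι → ℝ) → ℝ := fun q =>
    |interpCdf μ γ S q.1 q.2 - γ.real (Set.Iic q.2)| with hdist
  have hbdd : BddAbove (Set.range dist) := by
    refine ⟨1, ?_⟩
    rintro _ ⟨q, rfl⟩
    rw [hdist, abs_le]
    have h1 : interpCdf μ γ S q.1 q.2 ≤ 1 := measureReal_le_one
    have h2 : 0 ≤ interpCdf μ γ S q.1 q.2 := measureReal_nonneg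
    have h3 : γ.real (Set.Iic q.2) ≤ 1 := measureReal_le_one
    have h4 : 0 ≤ γ.real (Set.Iic q.2) := measureReal_nonneg
    constructor <;> linarith
  set R := ⨆ q, dist q with hR
  have hle : ∀ θ ∈ Set.Icc (0 : ℝ) (Real.pi / 2), ∀ y,
      |interpCdf μ γ S θ y - γ.real (Set.Iic y)| ≤ R := fun θ hθ y =>
    le_ciSup hbdd (⟨⟨θ, hθ⟩, y⟩ : Set.Icc (0 : ℝ) (Real.pi / 2) × (ι → ℝ))
  have hα' : ∀ (y : ι → ℝ) (s t : ℝ), s ≤ t → γ.real (Set.Iic fun j => y j + t) ≤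
      γ.real (Set.Iic fun j => y j + s) + α * (t - s) := by
    intro y s t hst
    have := hα (fun j => y j + s) (t - s) (by linarith)
    simpa using this
  have hshell : ∀ θ ∈ Set.Icc (0 : ℝ) (Real.pi / 2), ∀ y,
      (μ.prod γ).real {p | interp S θ p - y ∈ shell φ β 3} ≤ 9 * (α * φ⁻¹) + 2 * R := by
    intro θ hθ y
    have h1 := measureReal_shell_le (μ := μ) (γ := γ) hφ hφβ hK hSm y θ
    have h2 := (abs_le.1 (hle θ hθ fun j => y j + 4 * φ⁻¹)).2
    have h3 := (abs_le.1 (hle θ hθ fun j => y j - 5 * φ⁻¹)).1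
    have h4 := hα' y (-(5 * φ⁻¹)) (4 * φ⁻¹) (by linarith)
    simp only [← sub_eq_add_neg] at h4
    linarith
  have hderiv : ∀ y, ∀ θ ∈ Set.Icc (0 : ℝ) (Real.pi / 2),
      |∫ p, smoothInd₁ φ β (interp S θ p - y)
        (Real.cos θ • S p.1 - Real.sin θ • p.2) ∂(μ.prod γ)| ≤
        C * (9 * (α * φ⁻¹) + 2 * R + η) := by
    intro y θ hθ
    refine (abs_integral_smoothInd₁_interp_le hY hN hφ hφβ hτ hγ hcov hτβ hD y hθ).trans ?_
    have := hshell θ hθ y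
    calc _ = C * ((μ.prod γ).real {p | interp S θ p - y ∈ shell φ β 3} + η) := by
          rw [hC]; ring
      _ ≤ _ := by gcongr
  have hcomp : ∀ y, ∀ θ ∈ Set.Icc (0 : ℝ) (Real.pi / 2),
      |∫ p, smoothInd φ β (interp S θ p - y) ∂(μ.prod γ) -
        ∫ p, smoothInd φ β (interp S 0 p - y) ∂(μ.prod γ)| ≤
        1 / 4 * (9 * (α * φ⁻¹) + 2 * R + η) := by
    intro y θ hθ
    have hE : 0 ≤ 9 * (α * φ⁻¹) + 2 * R + η :=
      add_nonneg (measureReal_nonneg.trans (hshell θ hθ y)) hη0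
    have h := (convex_Icc (0 : ℝ) (Real.pi / 2)).norm_image_sub_le_of_norm_hasDerivWithin_le
      (f := fun θ => ∫ p, smoothInd φ β (interp S θ p - y) ∂(μ.prod γ))
      (fun θ _ => (hasDerivAt_integral_interp hφ.le hβ.ne' hSm
        hY.integrable_scaledSum y θ).hasDerivWithinAt)
      (fun θ hθ => hderiv y θ hθ) (x := 0) (y := θ) ⟨le_rfl, by positivity⟩ hθ
    refine h.trans ?_
    rw [sub_zero, Real.norm_eq_abs, abs_of_nonneg hθ.1]
    calc _ ≤ C * (9 * (α * φ⁻¹) + 2 * R + η) * (Real.pi / 2) := by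
          gcongr
          exact hθ.2
      _ = Real.pi / 2 * C * (9 * (α * φ⁻¹) + 2 * R + η) := by ring
      _ ≤ _ := by gcongr
  have hstep : ∀ θ ∈ Set.Icc (0 : ℝ) (Real.pi / 2), ∀ y,
      |interpCdf μ γ S θ y - γ.real (Set.Iic y)| ≤
        2 * (α * φ⁻¹) + 1 / 4 * (9 * (α * φ⁻¹) + 2 * R + η) := by
    intro θ hθ y
    rw [abs_le]
    constructor
    -- The test function is centered at y - 1/φ, between the indicators of the orthants at y - 2/φ
    -- and at y; the other direction uses y + 1/φ. Either way smoothing costs 2α/φ.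
    · have h1 := integral_smoothInd_interp_le (μ := μ) (γ := γ) hφ hφβ hSm
        (fun j => y j - φ⁻¹) θ
      have h2 := le_integral_smoothInd_interp (μ := μ) (γ := γ) hφ hφβ hK hSm
        (fun j => y j - φ⁻¹) 0
      have h3 := (abs_le.1 (hcomp (fun j => y j - φ⁻¹) θ hθ)).1
      rw [interpCdf_zero] at h2
      have h4 := hα' y (-(2 * φ⁻¹)) 0 (by linarith)
      have e1 : (fun j => y j - φ⁻¹ + φ⁻¹) = y := by ext j; ring
      have e2 : (fun j => y j - φ⁻¹ - φ⁻¹) = fun j => y j + -(2 * φ⁻¹) := by ext j; ring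
      simp only [add_zero] at h4
      rw [e1] at h1
      rw [e2] at h2
      linarith
    · have h1 := le_integral_smoothInd_interp (μ := μ) (γ := γ) hφ hφβ hK hSm
        (fun j => y j + φ⁻¹) θ
      have h2 := integral_smoothInd_interp_le (μ := μ) (γ := γ) hφ hφβ hSm
        (fun j => y j + φ⁻¹) 0
      have h3 := (abs_le.1 (hcomp (fun j => y j + φ⁻¹) θ hθ)).2
      rw [interpCdf_zero] at h2
      have h4 := hα' y 0 (2 * φ⁻¹) (by linarith)
      have e1 : (fun j => y j + φ⁻¹ - φ⁻¹) = y := by ext j; ring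
      have e2 : (fun j => y j + φ⁻¹ + φ⁻¹) = fun j => y j + 2 * φ⁻¹ := by ext j; ring
      simp only [add_zero] at h4
      rw [e1] at h1
      rw [e2] at h2
      linarith
  have hmem : Real.pi / 2 ∈ Set.Icc (0 : ℝ) (Real.pi / 2) := ⟨hpi, le_rfl⟩
  -- The right side contains R/2. Solving gives R ≤ 17/2 · α/φ + η/2, within the claimed 9α/φ + η.
  have hRle : R ≤ 2 * (α * φ⁻¹) + 1 / 4 * (9 * (α * φ⁻¹) + 2 * R + η) := by
    have : Nonempty (Set.Icc (0 : ℝ) (Real.pi / 2)) := ⟨⟨_, hmem⟩⟩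
    exact ciSup_le fun q => hstep q.1 q.1.2 q.2
  have hfin := hle _ hmem y
  rw [interpCdf_pi_div_two] at hfin
  -- No sign of α is assumed; monotonicity of the distribution function forces it.
  have hα0 : 0 ≤ α * φ⁻¹ := by
    have h1 := hα y φ⁻¹ hφ'.le
    have h2 : γ.real (Set.Iic y) ≤ γ.real (Set.Iic fun j => y j + φ⁻¹) :=
      measureReal_mono (Set.Iic_subset_Iic.2 fun j => by simp only; linarith)
    linarith
  linarith

end Recursion


/-! ### One-dimensional normal estimates. -/

section StandardNormal

/-- The standard normal density. -/
def stdDensity (x : ℝ) : ℝ := gaussianPDFReal 0 1 x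

theorem stdDensity_eq (x : ℝ) :
    stdDensity x = (√(2 * Real.pi))⁻¹ * Real.exp (-(x ^ 2) / 2) := by
  simp [stdDensity, gaussianPDFReal]

theorem stdDensity_le_mul_exp {x y r : ℝ} (h : x ^ 2 ≤ y ^ 2 + 2 * r) :
    stdDensity y ≤ stdDensity x * Real.exp r := by
  rw [stdDensity_eq, stdDensity_eq, mul_assoc, ← Real.exp_add]
  gcongr
  linarith

theorem stdDensity_le_exp (x : ℝ) : stdDensity x ≤ Real.exp (-(x ^ 2) / 2) := by
  rw [stdDensity_eq]
  refine mul_le_of_le_one_left (Real.exp_nonneg _) (inv_le_one_of_one_le₀ ?_)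
  rw [Real.one_le_sqrt]
  nlinarith [Real.pi_gt_three]

theorem stdDensity_le_one (x : ℝ) : stdDensity x ≤ 1 :=
  (stdDensity_le_exp x).trans (Real.exp_le_one_iff.2 (by nlinarith [sq_nonneg x]))

theorem integrable_stdDensity : Integrable stdDensity := integrable_gaussianPDFReal 0 1

theorem gaussianReal_real_eq (s : Set ℝ) :
    (gaussianReal 0 1).real s = ∫ x in s, stdDensity x := by
  rw [measureReal_def, gaussianReal_apply_eq_integral 0 one_ne_zero, ENNReal.toReal_ofReal]
  · rfl
  · exact integral_nonneg fun x => gaussianPDFReal_nonneg _ _ _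

theorem gaussianReal_real_Ioc_le {a b M : ℝ} (hab : a ≤ b)
    (h : ∀ x ∈ Set.Ioc a b, stdDensity x ≤ M) :
    (gaussianReal 0 1).real (Set.Ioc a b) ≤ M * (b - a) := by
  rw [gaussianReal_real_eq]
  calc ∫ x in Set.Ioc a b, stdDensity x ≤ ∫ _ in Set.Ioc a b, M :=
        setIntegral_mono_on integrable_stdDensity.integrableOn (by simp) measurableSet_Ioc h
    _ = M * (b - a) := by simp [hab, mul_comm]

theorem le_gaussianReal_real_Ioc {a b M : ℝ} (hab : a ≤ b)
    (h : ∀ x ∈ Set.Ioc a b, M ≤ stdDensity x) :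
    M * (b - a) ≤ (gaussianReal 0 1).real (Set.Ioc a b) := by
  rw [gaussianReal_real_eq]
  calc M * (b - a) = ∫ _ in Set.Ioc a b, M := by simp [hab, mul_comm]
    _ ≤ ∫ x in Set.Ioc a b, stdDensity x :=
        setIntegral_mono_on (by simp) integrable_stdDensity.integrableOn measurableSet_Ioc h

theorem gaussianReal_real_Ioc_le_exp (a : ℝ) {ε : ℝ} (hε : 0 ≤ ε) :
    (gaussianReal 0 1).real (Set.Ioc a (a + ε)) ≤
      stdDensity a * Real.exp (|a| * ε) * ε := by
  refine (gaussianReal_real_Ioc_le (by linarith) fun x hx => stdDensity_le_mul_exp ?_).trans_eq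
    (by ring)
  nlinarith [hx.1, hx.2, neg_abs_le a, abs_nonneg a, le_abs_self a,
    mul_nonneg (abs_nonneg a) (sub_nonneg.2 hx.2), mul_nonneg (sub_nonneg.2 hx.1.le)
      (sub_nonneg.2 (neg_abs_le a)), sq_nonneg (x - a)]

/-- With b = max a 0 and h = 1/(1 + b), every x in (b, b + h] satisfies x² ≤ b² + 2bh + h² ≤ a² + 3.
The density there loses at most exp (3/2), and the interval has length 1/(1 + b) ≥ 1/(1 + s). -/
theorem stdDensity_le_mills {a s : ℝ} (hs : 0 ≤ s) (ha : a ≤ s) :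
    stdDensity a ≤ Real.exp (3 / 2) * (1 + s) * (gaussianReal 0 1).real (Set.Ioi a) := by
  set b := max a 0 with hb
  have hb0 : 0 ≤ b := le_max_right _ _
  have hbs : b ≤ s := max_le ha hs
  have hpos : 0 < 1 + b := by linarith
  set h := (1 + b)⁻¹ with hh
  have hh0 : 0 < h := inv_pos.2 hpos
  have hh1 : (1 + b) * h = 1 := mul_inv_cancel₀ hpos.ne'
  have hbh : b * h ≤ 1 := by nlinarith
  have hle1 : h ≤ 1 := by nlinarith [mul_nonneg hb0 hh0.le]
  have h1 : ∀ x ∈ Set.Ioc b (b + h), stdDensity a * Real.exp (-(3 / 2)) ≤ stdDensity x := by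
    intro x hx
    rw [Real.exp_neg, ← div_eq_mul_inv, div_le_iff₀ (Real.exp_pos _)]
    refine stdDensity_le_mul_exp ?_
    have hba : b ^ 2 ≤ a ^ 2 := by
      rcases max_cases a 0 with h | h <;> rw [hb, h.1]
      nlinarith [sq_nonneg a]
    have : x ^ 2 ≤ (b + h) ^ 2 := pow_le_pow_left₀ (hb0.trans hx.1.le) hx.2 2
    nlinarith
  have h2 := le_gaussianReal_real_Ioc (by linarith) h1
  have h3 : (gaussianReal 0 1).real (Set.Ioc b (b + h)) ≤ (gaussianReal 0 1).real (Set.Ioi a) :=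
    measureReal_mono fun x hx => (le_max_left a 0).trans_lt hx.1
  have h4 : stdDensity a * Real.exp (-(3 / 2)) * h ≤ (gaussianReal 0 1).real (Set.Ioi a) := by
    refine le_trans (le_of_eq ?_) (h2.trans h3)
    ring
  have he : Real.exp (3 / 2) * Real.exp (-(3 / 2)) = 1 := by
    rw [← Real.exp_add]; simp
  calc stdDensity a = Real.exp (3 / 2) * (1 + b) * (stdDensity a * Real.exp (-(3 / 2)) * h) := by
        linear_combination (-stdDensity a) * he - stdDensity a *
          (Real.exp (3 / 2) * Real.exp (-(3 / 2))) * hh1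
    _ ≤ Real.exp (3 / 2) * (1 + b) * (gaussianReal 0 1).real (Set.Ioi a) := by gcongr
    _ ≤ _ := by gcongr

end StandardNormal

/-- A jointly Gaussian family of standard normal variables. -/
structure StdGaussian {Ω ι : Type*} [MeasurableSpace Ω] [Fintype ι] (U : ι → Ω → ℝ)
    (P : Measure Ω) : Prop where
  law : HasGaussianLaw (fun ω j => U j ω) P
  measurable : ∀ j, Measurable (U j)
  mean : ∀ j, ∫ ω, U j ω ∂P = 0
  sq : ∀ j, ∫ ω, U j ω * U j ω ∂P = 1

/-! ### Nazarov's anti-concentration inequality. -/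

namespace StdGaussian

variable {Ω ι : Type*} [MeasurableSpace Ω] [Fintype ι] {U : ι → Ω → ℝ} {P : Measure Ω}
  [IsProbabilityMeasure P]

theorem memLp (hU : StdGaussian U P) (j : ι) : MemLp (U j) 2 P := (hU.law.eval j).memLp_two

theorem integrable_mul (hU : StdGaussian U P) (j k : ι) :
    Integrable (fun ω => U j ω * U k ω) P := (hU.memLp j).integrable_mul (hU.memLp k)

theorem map_eq (hU : StdGaussian U P) (j : ι) : P.map (U j) = gaussianReal 0 1 := by
  have h : Var[U j; P] = 1 := by
    rw [variance_eq_sub (hU.memLp j), hU.mean j]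
    simp only [Pi.pow_apply, pow_two, hU.sq j]
    norm_num
  rw [(hU.law.eval j).map_eq_gaussianReal, hU.mean j, h, Real.toNNReal_one]

theorem real_preimage (hU : StdGaussian U P) (j : ι) {s : Set ℝ} (hs : MeasurableSet s) :
    P.real (U j ⁻¹' s) = (gaussianReal 0 1).real s := by
  rw [← hU.map_eq j, map_measureReal_apply (hU.measurable j) hs]

/-- The correlations of a family. -/
def corr (U : ι → Ω → ℝ) (P : Measure Ω) (j k : ι) : ℝ := ∫ ω, U j ω * U k ω ∂P

theorem corr_comm (j k : ι) : corr U P j k = corr U P k j := by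
  simp only [corr, mul_comm]

theorem integral_sub_mul_sq (hU : StdGaussian U P) (j k : ι) (c : ℝ) :
    ∫ ω, (U k ω - c * U j ω) ^ 2 ∂P = 1 - 2 * c * corr U P j k + c ^ 2 := by
  have h : ∀ ω, (U k ω - c * U j ω) ^ 2 =
      U k ω * U k ω - 2 * c * (U j ω * U k ω) + c ^ 2 * (U j ω * U j ω) := fun ω => by ring
  have h1 := (hU.integrable_mul j k).const_mul (2 * c)
  have h2 := (hU.integrable_mul j j).const_mul (c ^ 2)
  have h3 : Integrable (fun ω => U k ω * U k ω - 2 * c * (U j ω * U k ω)) P :=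
    (hU.integrable_mul k k).sub h1
  simp only [h]
  rw [integral_add h3 h2, integral_sub (hU.integrable_mul k k) h1, integral_const_mul,
    integral_const_mul, hU.sq, hU.sq, corr]
  ring

theorem corr_sq_le_one (hU : StdGaussian U P) (j k : ι) : corr U P j k ^ 2 ≤ 1 := by
  have h := hU.integral_sub_mul_sq j k (corr U P j k)
  have : 0 ≤ ∫ ω, (U k ω - corr U P j k * U j ω) ^ 2 ∂P := integral_nonneg fun ω => sq_nonneg _
  nlinarith

theorem ae_eq_of_corr_eq_one (hU : StdGaussian U P) {j k : ι} (h : corr U P j k = 1) :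
    U k =ᵐ[P] U j := by
  have h1 := hU.integral_sub_mul_sq j k 1
  rw [h] at h1
  norm_num at h1
  have hi : Integrable (fun ω => (U k ω - U j ω) ^ 2) P :=
    ((hU.memLp k).sub (hU.memLp j)).integrable_sq
  rw [integral_eq_zero_iff_of_nonneg (fun ω => sq_nonneg _) hi] at h1
  filter_upwards [h1] with ω hω
  have : (U k ω - U j ω) ^ 2 = 0 := hω
  nlinarith [pow_eq_zero_iff (two_ne_zero) |>.1 this]

/-- The regression residuals are uncorrelated with U j, and joint Gaussianity turns this into
independence. -/
theorem indepFun (hU : StdGaussian U P) (j : ι) :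
    IndepFun (fun ω k => U k ω - corr U P j k * U j ω) (U j) P := by
  have hlaw : HasGaussianLaw (fun ω => ((fun k => U k ω - corr U P j k * U j ω),
      fun _ : Unit => U j ω)) P := by
    have h := hU.law.map_fun (ContinuousLinearMap.prod
      (ContinuousLinearMap.pi fun k => ContinuousLinearMap.proj (R := ℝ) (φ := fun _ : ι => ℝ) k -
        corr U P j k • ContinuousLinearMap.proj (R := ℝ) (φ := fun _ : ι => ℝ) j)
      (ContinuousLinearMap.pi fun _ : Unit =>
        ContinuousLinearMap.proj (R := ℝ) (φ := fun _ : ι => ℝ) j))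
    exact h
  have h := HasGaussianLaw.indepFun_of_covariance_eval
    (X := fun k ω => U k ω - corr U P j k * U j ω) (Y := fun (_ : Unit) => U j) hlaw ?_
  · exact h.comp measurable_id (measurable_pi_apply ())
  · intro k _
    have hk : MemLp (fun ω => U k ω - corr U P j k * U j ω) 2 P :=
      (hU.memLp k).sub ((hU.memLp j).const_mul _)
    have h1 : ∀ ω, (U k ω - corr U P j k * U j ω) * U j ω =
      U j ω * U k ω - corr U P j k * (U j ω * U j ω) := fun ω => by ring
    rw [covariance_eq_sub hk (hU.memLp j), hU.mean j, mul_zero, sub_zero]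
    simp only [Pi.mul_apply, h1]
    rw [integral_sub (hU.integrable_mul j k) ((hU.integrable_mul j j).const_mul _),
      integral_const_mul, hU.sq, corr]
    ring

/-- The event that the residuals of the regression on the `j`-th variable lie below a face. -/
def residualEvent (U : ι → Ω → ℝ) (P : Measure Ω) (a : ι → ℝ) (j : ι) (δ : ℝ) : Set Ω :=
  {ω | ∀ k, U k ω - corr U P j k * U j ω ≤ a k - corr U P j k * a j + δ}

theorem measurableSet_residualEvent (hU : StdGaussian U P) (a : ι → ℝ) (j : ι) (δ : ℝ) :
    MeasurableSet (residualEvent U P a j δ) := by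
  have := hU.measurable
  have h : residualEvent U P a j δ =
      ⋂ k, {ω | U k ω - corr U P j k * U j ω ≤ a k - corr U P j k * a j + δ} := by
    ext; simp [residualEvent]
  rw [h]
  exact MeasurableSet.iInter fun k => measurableSet_le (by fun_prop) measurable_const

theorem real_preimage_inter (hU : StdGaussian U P) (a : ι → ℝ) (j : ι) (δ : ℝ) {s : Set ℝ}
    (hs : MeasurableSet s) : P.real (U j ⁻¹' s ∩ residualEvent U P a j δ) =
      (gaussianReal 0 1).real s * P.real (residualEvent U P a j δ) := by
  have h := (hU.indepFun j).measure_inter_preimage_eq_mul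
    (Set.Iic fun k => a k - corr U P j k * a j + δ) s measurableSet_Iic hs
  rw [← hU.real_preimage j hs, Set.inter_comm, mul_comm]
  simp only [measureReal_def, ← ENNReal.toReal_mul]
  exact congrArg _ h

theorem residualEvent_mono (a : ι → ℝ) (j : ι) :
    Monotone (residualEvent U P a j) := fun _ _ h _ hω k => (hω k).trans (by gcongr)

/-- This is continuity from above: the constraints are non-strict, so the events decrease to the one
without slack. -/
theorem tendsto_real_residualEvent (hU : StdGaussian U P) (a : ι → ℝ) (j : ι) :
    Filter.Tendsto (fun δ => P.real (residualEvent U P a j δ)) (nhdsWithin 0 (Set.Ioi 0))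
      (nhds (P.real (residualEvent U P a j 0))) := by
  have h := tendsto_measure_biInter_gt (μ := P) (s := residualEvent U P a j) (a := (0 : ℝ))
    (fun r _ => (hU.measurableSet_residualEvent a j r).nullMeasurableSet)
    (fun _ _ _ hij => residualEvent_mono a j hij) ⟨1, one_pos, measure_ne_top _ _⟩
  have e : (⋂ r > (0 : ℝ), residualEvent U P a j r) = residualEvent U P a j 0 := by
    refine Set.Subset.antisymm (fun ω hω k => ?_) (Set.subset_iInter₂ fun r hr =>
      residualEvent_mono a j (le_of_lt hr))
    rw [add_zero]
    refine le_of_forall_pos_le_add fun r hr => ?_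
    exact Set.mem_iInter₂.1 hω r hr k
  rw [e] at h
  exact (ENNReal.tendsto_toReal (measure_ne_top _ _)).comp h

section Faces

variable [LinearOrder ι]

open Classical in
/-- The indices of the distinct faces of an orthant. -/
def faces (U : ι → Ω → ℝ) (P : Measure Ω) (a : ι → ℝ) : Finset ι :=
  Finset.univ.filter fun j => ∀ k < j, ¬ (U k =ᵐ[P] U j ∧ a k = a j)

theorem mem_faces {a : ι → ℝ} {j : ι} :
    j ∈ faces U P a ↔ ∀ k < j, ¬ (U k =ᵐ[P] U j ∧ a k = a j) := by
  simp [faces]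

theorem exists_mem_faces (a : ι → ℝ) :
    ∀ᵐ ω ∂P, ∀ j, a j < U j ω → ∃ k ∈ faces U P a, a k < U k ω := by
  have h : ∀ᵐ ω ∂P, ∀ j k, U k =ᵐ[P] U j → U k ω = U j ω := by
    rw [ae_all_iff]
    intro j
    rw [ae_all_iff]
    intro k
    by_cases hjk : U k =ᵐ[P] U j
    · filter_upwards [hjk] with ω hω _ using hω
    · exact ae_of_all _ fun ω h => absurd h hjk
  filter_upwards [h] with ω hω j hj
  classical
  -- The smallest violated index represents its face: an earlier index with the same variable and
  -- threshold would be violated as well.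
  set s : Finset ι := Finset.univ.filter fun k => a k < U k ω with hs
  have hne : s.Nonempty := ⟨j, by simp [hs, hj]⟩
  have hmem := s.min'_mem hne
  refine ⟨s.min' hne, ?_, (Finset.mem_filter.1 hmem).2⟩
  rw [mem_faces]
  rintro k hk ⟨h1, h2⟩
  refine absurd (s.min'_le k ?_) (not_le.2 hk)
  simp only [hs, Finset.mem_filter, Finset.mem_univ, true_and]
  rw [hω _ _ h1, h2]
  exact (Finset.mem_filter.1 hmem).2

/-- A point gained by the enlargement crosses some face k by at most ε. As correlations are at most
one in absolute value, the residuals exceed their bounds by at most 2ε, and independence from U k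
factors the probability of the crossing. -/
theorem real_orthant_add_le (hU : StdGaussian U P) (a : ι → ℝ) {ε : ℝ} (hε : 0 ≤ ε) :
    P.real {ω | ∀ j, U j ω ≤ a j + ε} ≤ P.real {ω | ∀ j, U j ω ≤ a j} +
      ∑ j ∈ faces U P a, stdDensity (a j) * Real.exp (|a j| * ε) * ε *
        P.real (residualEvent U P a j (2 * ε)) := by
  have hsub : {ω | ∀ j, U j ω ≤ a j + ε} ≤ᵐ[P] ({ω | ∀ j, U j ω ≤ a j} ∪
      ⋃ j ∈ faces U P a, (U j ⁻¹' Set.Ioc (a j) (a j + ε) ∩ residualEvent U P a j (2 * ε)) :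
        Set Ω) := by
    filter_upwards [exists_mem_faces (U := U) (P := P) a] with ω hω h
    have h : ∀ j, U j ω ≤ a j + ε := h
    by_cases hall : ∀ j, U j ω ≤ a j
    · exact Or.inl hall
    · push Not at hall
      obtain ⟨j, hj⟩ := hall
      obtain ⟨k, hk, hk'⟩ := hω j hj
      refine Or.inr (Set.mem_iUnion₂.2 ⟨k, hk, ⟨hk', h k⟩, fun i => ?_⟩)
      have h1 := abs_le_one_iff_mul_self_le_one.2 (by
        simpa [pow_two] using hU.corr_sq_le_one k i)
      have h2 := (abs_le.1 h1).1
      have h3 := h i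
      have h4 := h k
      nlinarith
  refine (ENNReal.toReal_mono (measure_ne_top _ _) (measure_mono_ae hsub)).trans ?_
  refine (measureReal_union_le _ _).trans (add_le_add_right ?_ _)
  refine (measureReal_biUnion_finset_le _ _).trans (Finset.sum_le_sum fun j _ => ?_)
  rw [hU.real_preimage_inter a j _ measurableSet_Ioc]
  exact mul_le_mul_of_nonneg_right (gaussianReal_real_Ioc_le_exp _ hε) measureReal_nonneg

/-- The events are almost surely disjoint. If two occurred, the excesses x, y > 0 would satisfy y ≤
ρx and x ≤ ρy, which forces ρ = 1 and x = y. Then the variables and the thresholds coincide, which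
`faces` excludes. -/
theorem sum_faces_le_one (hU : StdGaussian U P) (a : ι → ℝ) :
    ∑ j ∈ faces U P a, (gaussianReal 0 1).real (Set.Ioi (a j)) *
      P.real (residualEvent U P a j 0) ≤ 1 := by
  have hlt : ∀ j k, j < k → k ∈ faces U P a →
      P ((U j ⁻¹' Set.Ioi (a j) ∩ residualEvent U P a j 0) ∩
        (U k ⁻¹' Set.Ioi (a k) ∩ residualEvent U P a k 0)) = 0 := by
    intro j k hjk hk
    have hcase : ∀ ω, ω ∈ (U j ⁻¹' Set.Ioi (a j) ∩ residualEvent U P a j 0) ∩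
        (U k ⁻¹' Set.Ioi (a k) ∩ residualEvent U P a k 0) →
          corr U P j k = 1 ∧ U j ω - a j = U k ω - a k := by
      rintro ω ⟨⟨h1, h2⟩, h3, h4⟩
      have h1 : a j < U j ω := h1
      have h3 : a k < U k ω := h3
      have h5 := h2 k
      have h6 := h4 j
      rw [corr_comm] at h6
      have h7 := hU.corr_sq_le_one j k
      set ρ := corr U P j k
      have hρ : ρ = 1 := by
        have hx : 0 < U j ω - a j := by linarith
        have hy : 0 < U k ω - a k := by linarith
        have e1 : U k ω - a k ≤ ρ * (U j ω - a j) := by linarith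
        have e2 : U j ω - a j ≤ ρ * (U k ω - a k) := by linarith
        have hp : 0 < ρ := by
          by_contra! hn
          nlinarith
        have hle : ρ ≤ 1 := by nlinarith
        refine le_antisymm hle ?_
        by_contra! hlt
        nlinarith
      refine ⟨hρ, ?_⟩
      rw [hρ] at h5 h6
      linarith
    by_cases hρ : corr U P j k = 1
    · have hae : U k =ᵐ[P] U j := hU.ae_eq_of_corr_eq_one hρ
      have hne : a j ≠ a k := fun h =>
        mem_faces.1 hk j hjk ⟨hae.symm, h⟩
      rw [measure_eq_zero_iff_ae_notMem]
      filter_upwards [hae] with ω hω hmem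
      have := (hcase ω hmem).2
      rw [hω] at this
      exact hne (by linarith)
    · convert measure_empty (μ := P)
      exact Set.eq_empty_of_forall_notMem fun ω hω => hρ (hcase ω hω).1
  have hd : Set.Pairwise (faces U P a : Set ι) (Function.onFun (AEDisjoint P)
      fun j => U j ⁻¹' Set.Ioi (a j) ∩ residualEvent U P a j 0) := by
    intro j hj k hk hne
    rcases hne.lt_or_gt with h | h
    · exact hlt j k h hk
    · exact AEDisjoint.symm (hlt k j h hj)
  have hm : ∀ j ∈ faces U P a, NullMeasurableSet
      (U j ⁻¹' Set.Ioi (a j) ∩ residualEvent U P a j 0) P := fun j _ =>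
    ((hU.measurable j measurableSet_Ioi).inter
      (hU.measurableSet_residualEvent a j 0)).nullMeasurableSet
  have h := measureReal_biUnion_finset₀ (μ := P) hd hm
  simp only [hU.real_preimage_inter a _ 0 measurableSet_Ioi] at h
  rw [← h]
  exact measureReal_le_one

/-- The thresholds are split at s = √(2L). Below s, Mills' ratio costs a factor of order √L and
leaves the sum over disjoint events. Above s the density is at most exp (-L), and there are at most
exp L faces. -/
theorem sum_stdDensity_faces_le (hU : StdGaussian U P) (a : ι → ℝ) {L : ℝ} (hL : 1 ≤ L)
    (hcard : Real.log (Fintype.card ι) ≤ L) :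
    ∑ j ∈ faces U P a, stdDensity (a j) * P.real (residualEvent U P a j 0) ≤
      4 * Real.exp (3 / 2) * √L := by
  classical
  set s := √2 * √L with hs
  have hsL : 1 ≤ √L := Real.one_le_sqrt.2 hL
  have hs2 : s ^ 2 = 2 * L := by
    rw [hs, mul_pow, Real.sq_sqrt (by norm_num), Real.sq_sqrt (by linarith)]
  have hs0 : 0 ≤ s := by positivity
  have hterm : ∀ j ∈ faces U P a, stdDensity (a j) * P.real (residualEvent U P a j 0) ≤
      Real.exp (3 / 2) * (1 + s) * ((gaussianReal 0 1).real (Set.Ioi (a j)) *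
        P.real (residualEvent U P a j 0)) + Real.exp (-L) := by
    intro j _
    have hq0 : 0 ≤ P.real (residualEvent U P a j 0) := measureReal_nonneg
    have hq1 : P.real (residualEvent U P a j 0) ≤ 1 := measureReal_le_one
    have hg0 : 0 ≤ (gaussianReal 0 1).real (Set.Ioi (a j)) := measureReal_nonneg
    rcases le_total (a j) s with h | h
    · have h1 := mul_le_mul_of_nonneg_right (stdDensity_le_mills hs0 h) hq0
      have := Real.exp_pos (-L)
      linarith
    · have h1 : stdDensity (a j) ≤ Real.exp (-L) := by
        refine (stdDensity_le_exp _).trans (Real.exp_le_exp.2 ?_)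
        have : s ^ 2 ≤ a j ^ 2 := pow_le_pow_left₀ hs0 h 2
        linarith
      have h2 : stdDensity (a j) * P.real (residualEvent U P a j 0) ≤ Real.exp (-L) * 1 :=
        mul_le_mul h1 hq1 hq0 (Real.exp_nonneg _)
      have h3 : 0 ≤ Real.exp (3 / 2) * (1 + s) * ((gaussianReal 0 1).real (Set.Ioi (a j)) *
        P.real (residualEvent U P a j 0)) := by positivity
      linarith
  have hK : (Fintype.card ι : ℝ) * Real.exp (-L) ≤ 1 := by
    rcases Nat.eq_zero_or_pos (Fintype.card ι) with h0 | h0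
    · simp [h0]
    · have h1 : (Fintype.card ι : ℝ) ≤ Real.exp L := by
        rwa [← Real.log_le_iff_le_exp (by exact_mod_cast h0)]
      rw [Real.exp_neg, ← div_eq_mul_inv, div_le_one (Real.exp_pos _)]
      exact h1
  have he : 1 ≤ Real.exp (3 / 2) := Real.one_le_exp (by norm_num)
  have hsqrt2 : √2 ≤ 3 / 2 := by
    rw [Real.sqrt_le_left (by norm_num)]; norm_num
  calc _ ≤ ∑ j ∈ faces U P a, (Real.exp (3 / 2) * (1 + s) *
        ((gaussianReal 0 1).real (Set.Ioi (a j)) *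
          P.real (residualEvent U P a j 0)) + Real.exp (-L)) := Finset.sum_le_sum hterm
    _ = Real.exp (3 / 2) * (1 + s) * ∑ j ∈ faces U P a, (gaussianReal 0 1).real (Set.Ioi (a j)) *
          P.real (residualEvent U P a j 0) + (faces U P a).card * Real.exp (-L) := by
        rw [Finset.sum_add_distrib, Finset.mul_sum, Finset.sum_const, nsmul_eq_mul]
    _ ≤ Real.exp (3 / 2) * (1 + s) * 1 + Fintype.card ι * Real.exp (-L) := by
        gcongr
        · exact hU.sum_faces_le_one a
        · exact Finset.card_le_univ _
    _ ≤ Real.exp (3 / 2) * (1 + s) * 1 + 1 := by gcongr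
    _ ≤ Real.exp (3 / 2) * (√L + 3 / 2 * √L) + Real.exp (3 / 2) * √L := by
        have h1 : 1 ≤ Real.exp (3 / 2) * √L := one_le_mul_of_one_le_of_one_le he hsL
        have h2 : 1 + s ≤ √L + 3 / 2 * √L := by
          have := mul_le_mul_of_nonneg_right hsqrt2 (Real.sqrt_nonneg L)
          linarith
        have h3 := mul_le_mul_of_nonneg_left h2 (Real.exp_nonneg (3 / 2))
        linarith
    _ ≤ _ := by
        have : 0 ≤ Real.exp (3 / 2) * √L := by positivity
        linarith

/-- Nazarov's inequality for standardized Gaussian vectors. -/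
theorem real_orthant_add_le_sqrt (hU : StdGaussian U P) {L : ℝ} (hL : 1 ≤ L)
    (hcard : Real.log (Fintype.card ι) ≤ L) (a : ι → ℝ) {δ : ℝ} (hδ : 0 ≤ δ) :
    P.real {ω | ∀ j, U j ω ≤ a j + δ} ≤
      P.real {ω | ∀ j, U j ω ≤ a j} + 4 * Real.exp (3 / 2) * √L * δ := by
  set u : ℝ → ℝ := fun h => P.real {ω | ∀ j, U j ω ≤ a j + h} with hu
  set C := 4 * Real.exp (3 / 2) * √L with hC
  have hmono : Monotone u := fun s t hst => measureReal_mono fun ω hω j =>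
    (hω j).trans (by gcongr)
  have hstep : ∀ h ε, 0 ≤ ε → u (h + ε) ≤ u h +
      ∑ j ∈ faces U P (fun j => a j + h), stdDensity (a j + h) * Real.exp (|a j + h| * ε) * ε *
        P.real (residualEvent U P (fun j => a j + h) j (2 * ε)) := by
    intro h ε hε
    have := hU.real_orthant_add_le (fun j => a j + h) hε
    simpa only [hu, add_assoc] using this
  -- This union bound has a constant linear in the number of coordinates and is used only for
  -- continuity.
  have hlip : ∀ s t, s ≤ t → u t ≤ u s + Fintype.card ι * (t - s) := by
    intro s t hst
    have hsub : {ω | ∀ j, U j ω ≤ a j + t} ⊆ {ω | ∀ j, U j ω ≤ a j + s} ∪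
        ⋃ j ∈ (Finset.univ : Finset ι), U j ⁻¹' Set.Ioc (a j + s) (a j + t) := by
      intro ω hω
      by_cases hall : ∀ j, U j ω ≤ a j + s
      · exact Or.inl hall
      · push Not at hall
        obtain ⟨j, hj⟩ := hall
        exact Or.inr (Set.mem_iUnion₂.2 ⟨j, Finset.mem_univ _, hj, hω j⟩)
    refine (measureReal_mono hsub).trans ((measureReal_union_le _ _).trans
      (add_le_add_right ((measureReal_biUnion_finset_le _ _).trans ?_) _))
    calc _ ≤ ∑ _j : ι, (t - s) := by
          refine Finset.sum_le_sum fun j _ => ?_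
          rw [hU.real_preimage j measurableSet_Ioc]
          refine (gaussianReal_real_Ioc_le (by linarith) fun x _ => stdDensity_le_one x).trans_eq ?_
          ring
      _ = _ := by simp [mul_sub]
  have hcont : Continuous u := by
    refine (LipschitzWith.of_dist_le_mul (K := Fintype.card ι) fun s t => ?_).continuous
    rw [Real.dist_eq, Real.dist_eq]
    simp only [NNReal.coe_natCast]
    rcases le_total s t with h | h
    · rw [abs_sub_comm, abs_sub_comm s, abs_of_nonneg (sub_nonneg.2 (hmono h)),
        abs_of_nonneg (sub_nonneg.2 h)]
      linarith [hlip s t h]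
    · rw [abs_of_nonneg (sub_nonneg.2 (hmono h)), abs_of_nonneg (sub_nonneg.2 h)]
      linarith [hlip t s h]
  -- A continuous function whose right slopes stay below C grows at rate at most C; the slope at h
  -- is the limit of the one-step bounds in `hstep`.
  have hmain := image_le_of_liminf_slope_right_le_deriv_boundary (f := u) (a := 0) (b := δ)
    (B := fun h => u 0 + C * h) (B' := fun _ => C) hcont.continuousOn (by simp)
    (by fun_prop) (fun x _ => by
      simpa using (((hasDerivAt_id x).const_mul C).const_add (u 0)).hasDerivWithinAt) ?_
    ⟨hδ, le_rfl⟩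
  · simpa only [hu, add_zero] using hmain
  intro h _ r hr
  set b : ι → ℝ := fun j => a j + h with hb
  have hlim : Filter.Tendsto (fun ε => ∑ j ∈ faces U P b, stdDensity (b j) *
      Real.exp (|b j| * ε) * P.real (residualEvent U P b j (2 * ε)))
      (nhdsWithin 0 (Set.Ioi 0)) (nhds (∑ j ∈ faces U P b, stdDensity (b j) *
        Real.exp (|b j| * 0) * P.real (residualEvent U P b j 0))) := by
    refine tendsto_finsetSum _ fun j _ => Filter.Tendsto.mul ?_ ?_
    · exact (Continuous.tendsto (by fun_prop) 0).mono_left nhdsWithin_le_nhds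
    · refine (hU.tendsto_real_residualEvent b j).comp ?_
      refine tendsto_nhdsWithin_iff.2 ⟨?_, ?_⟩
      · have : Filter.Tendsto (fun ε : ℝ => 2 * ε) (nhds 0) (nhds (2 * 0)) :=
          Continuous.tendsto (by fun_prop) 0
        rw [mul_zero] at this
        exact this.mono_left nhdsWithin_le_nhds
      · filter_upwards [self_mem_nhdsWithin] with ε hε
        exact mul_pos two_pos (Set.mem_Ioi.1 hε)
  simp only [mul_zero, Real.exp_zero, mul_one] at hlim
  have hev := hlim.eventually (gt_mem_nhds ((hU.sum_stdDensity_faces_le b hL hcard).trans_lt hr))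
  have hshift : Filter.Tendsto (fun z => z - h) (nhdsWithin h (Set.Ioi h))
      (nhdsWithin 0 (Set.Ioi 0)) := by
    refine tendsto_nhdsWithin_iff.2 ⟨?_, ?_⟩
    · have : Filter.Tendsto (fun z : ℝ => z - h) (nhds h) (nhds (h - h)) :=
        Continuous.tendsto (by fun_prop) h
      rw [sub_self] at this
      exact this.mono_left nhdsWithin_le_nhds
    · filter_upwards [self_mem_nhdsWithin] with z hz
      exact sub_pos.2 (Set.mem_Ioi.1 hz)
  refine Filter.Eventually.frequently ?_
  filter_upwards [hshift.eventually hev, self_mem_nhdsWithin] with z hz hzh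
  have hzh : h < z := hzh
  have hpos : 0 < z - h := sub_pos.2 hzh
  rw [slope_def_field, div_lt_iff₀ hpos]
  have h1 := hstep h (z - h) hpos.le
  rw [add_sub_cancel] at h1
  have h2 := mul_lt_mul_of_pos_right hz hpos
  rw [Finset.sum_mul] at h2
  have h3 : ∀ j ∈ faces U P b, stdDensity (b j) * Real.exp (|b j| * (z - h)) * (z - h) *
      P.real (residualEvent U P b j (2 * (z - h))) = stdDensity (b j) *
        Real.exp (|b j| * (z - h)) * P.real (residualEvent U P b j (2 * (z - h))) * (z - h) :=
    fun j _ => by ring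
  rw [Finset.sum_congr rfl h3] at h1
  linarith

end Faces

end StdGaussian

/-- Nazarov's inequality: anti-concentration of a Gaussian vector on lower orthants. -/
theorem IsGaussian.real_Iic_add_le {ι : Type*} [Fintype ι] {γ : Measure (ι → ℝ)} [IsGaussian γ]
    (hγ : ∫ z, z ∂γ = 0) {v : ℝ} (hv : 0 < v) (hvar : ∀ j, v ≤ ∫ z, z j * z j ∂γ) {L : ℝ}
    (hL : 1 ≤ L) (hcard : Real.log (Fintype.card ι) ≤ L) (y : ι → ℝ) {δ : ℝ} (hδ : 0 ≤ δ) :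
    γ.real (Set.Iic fun j => y j + δ) ≤
      γ.real (Set.Iic y) + 4 * Real.exp (3 / 2) * √L / √v * δ := by
  -- Any linear order will do; it only selects representatives of coinciding faces.
  let : LinearOrder ι := LinearOrder.lift' (Fintype.equivFin ι) (Fintype.equivFin ι).injective
  set σ : ι → ℝ := fun j => √(∫ z, z j * z j ∂γ) with hσ
  have hσ0 : ∀ j, 0 < σ j := fun j => Real.sqrt_pos.2 (hv.trans_le (hvar j))
  have hU : StdGaussian (fun j (z : ι → ℝ) => z j / σ j) γ := by
    refine ⟨?_, fun j => by fun_prop, fun j => ?_, fun j => ?_⟩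
    · have h := (IsGaussian.hasGaussianLaw_id (μ := γ)).map_fun (ContinuousLinearMap.pi fun j =>
        (σ j)⁻¹ • ContinuousLinearMap.proj (R := ℝ) (φ := fun _ : ι => ℝ) j)
      refine h.congr (ae_of_all _ fun z => ?_)
      ext j
      simp [div_eq_inv_mul]
    · rw [integral_div]
      have h := ContinuousLinearMap.integral_comp_comm
        (ContinuousLinearMap.proj (R := ℝ) (φ := fun _ : ι => ℝ) j)
        (IsGaussian.integrable_id (μ := γ))
      simp only [id, ContinuousLinearMap.proj_apply, hγ, Pi.zero_apply] at h
      rw [h, zero_div]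
    · have h : ∀ z : ι → ℝ, z j / σ j * (z j / σ j) = z j * z j / (σ j * σ j) := fun z => by
        rw [div_mul_div_comm]
      simp only [h]
      rw [integral_div, Real.mul_self_sqrt (hv.le.trans (hvar j))]
      exact div_self (hv.trans_le (hvar j)).ne'
  have h := hU.real_orthant_add_le_sqrt hL hcard (fun j => y j / σ j)
    (δ := δ / √v) (by positivity)
  have e : {z : ι → ℝ | ∀ j, z j / σ j ≤ y j / σ j} = Set.Iic y := by
    ext z
    simp only [Set.mem_ofPred_eq, Set.mem_Iic, Pi.le_def]
    exact forall_congr' fun j => div_le_div_iff_of_pos_right (hσ0 j)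
  have hsub : (Set.Iic fun j => y j + δ) ⊆ {z : ι → ℝ | ∀ j, z j / σ j ≤ y j / σ j + δ / √v} := by
    intro z hz j
    have h1 : δ / σ j ≤ δ / √v := by
      have := hσ0 j
      gcongr
      exact Real.sqrt_le_sqrt (hvar j)
    have h2 : z j / σ j ≤ (y j + δ) / σ j := div_le_div_of_nonneg_right (hz j) (hσ0 j).le
    rw [add_div] at h2
    linarith
  rw [e] at h
  refine (measureReal_mono hsub).trans (h.trans_eq ?_)
  ring


/-! ### From Orlicz norms to exponential moments. -/

section PsiNorm

variable {Ω : Type*} [MeasurableSpace Ω] {μ : Measure Ω} [IsProbabilityMeasure μ]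

theorem exp_div_le_of_one_le {x B l γ : ℝ} (hγ : 1 ≤ γ) (hx : 0 ≤ x) (hl : 0 < l) (hlB : l ≤ B) :
    Real.exp (x / B) ≤ Real.exp 1 * Real.exp ((x / l) ^ γ) := by
  rw [← Real.exp_add]
  refine Real.exp_le_exp.2 ?_
  have h1 : x / B ≤ x / l := by gcongr
  have h2 : 0 ≤ x / l := by positivity
  have h3 : 0 ≤ (x / l) ^ γ := by positivity
  rcases le_total (x / l) 1 with h | h
  · linarith
  · have := Real.self_le_rpow_of_one_le h hγ
    linarith

/-- The infimum need not be attained, but it is below 2B, which yields an admissible l < 2B. As t ≤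
1 + t^γ for t ≥ 0 and γ ≥ 1, the moment is at most 2e < 6. -/
theorem exp_moment_of_psiNorm_le {γ B : ℝ} (hγ : 1 ≤ γ) (hB : 0 < B) {ξ : Ω → ℝ}
    (hξ : Measurable ξ) (h : psiNorm γ ξ μ ≤ ENNReal.ofReal B) :
    Integrable (fun ω => Real.exp (|ξ ω| / (2 * B))) μ ∧
      ∫ ω, Real.exp (|ξ ω| / (2 * B)) ∂μ ≤ 6 := by
  have hlt : psiNorm γ ξ μ < ENNReal.ofReal (2 * B) :=
    h.trans_lt ((ENNReal.ofReal_lt_ofReal_iff (by linarith)).2 (by linarith))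
  rw [psiNorm, iInf_lt_iff] at hlt
  obtain ⟨l, hl⟩ := hlt
  rw [iInf_lt_iff] at hl
  obtain ⟨⟨hl0, hle⟩, hlB⟩ := hl
  have hlB' : l ≤ 2 * B := ((ENNReal.ofReal_lt_ofReal_iff (by linarith)).1 hlB).le
  set f : Ω → ℝ := fun ω => Real.exp ((|ξ ω| / l) ^ γ) - 1 with hf
  have hf0 : ∀ ω, 0 ≤ f ω := fun ω => by
    have : 0 ≤ (|ξ ω| / l) ^ γ := by positivity
    have := Real.one_le_exp this
    simp only [hf]
    linarith
  have hfm : Measurable f := by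
    simp only [hf]
    fun_prop
  have hfi : Integrable f μ := by
    refine ⟨hfm.aestronglyMeasurable, ?_⟩
    rw [hasFiniteIntegral_iff_ofReal (ae_of_all _ hf0)]
    exact hle.trans_lt ENNReal.one_lt_top
  have hfl : ∫ ω, f ω ∂μ ≤ 1 := by
    rw [integral_eq_lintegral_of_nonneg_ae (ae_of_all _ hf0) hfm.aestronglyMeasurable]
    exact ENNReal.toReal_le_of_le_ofReal zero_le_one (by simpa using hle)
  have hbound : ∀ ω, Real.exp (|ξ ω| / (2 * B)) ≤ Real.exp 1 * (f ω + 1) := fun ω => by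
    simp only [hf, sub_add_cancel]
    exact exp_div_le_of_one_le hγ (abs_nonneg _) hl0 hlB'
  have hgi : Integrable (fun ω => Real.exp 1 * (f ω + 1)) μ :=
    (hfi.add (integrable_const 1)).const_mul _
  have hint : Integrable (fun ω => Real.exp (|ξ ω| / (2 * B))) μ := by
    refine hgi.mono' (by fun_prop) (ae_of_all _ fun ω => ?_)
    rw [Real.norm_eq_abs, abs_of_pos (Real.exp_pos _)]
    exact hbound ω
  refine ⟨hint, (integral_mono hint hgi hbound).trans ?_⟩
  rw [integral_const_mul, integral_add hfi (integrable_const 1)]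
  simp only [integral_const, probReal_univ, one_smul]
  nlinarith [Real.exp_one_lt_d9, Real.exp_pos 1]

end PsiNorm

/-! ### Projection of the sum and of the Gaussian vector on the normals. -/

section Projection

variable {Ω : Type*} [MeasurableSpace Ω] {μ : Measure Ω} [IsProbabilityMeasure μ]
  {n p : ℕ} {ι : Type*} [Fintype ι] {X : Fin n → Ω → Vec p} {v : ι → Vec p}

/-- The map `x ↦ (⟪x, v_j⟫)_j`. -/
def faceMap (v : ι → Vec p) : Vec p →L[ℝ] (ι → ℝ) :=
  ContinuousLinearMap.pi fun j => innerSL ℝ (v j)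

theorem faceMap_apply (x : Vec p) (j : ι) : faceMap v x j = ⟪v j, x⟫ := rfl

theorem scaledSum_faceMap [NeZero n] (ω : Ω) :
    scaledSum (fun t ω => faceMap v (X t ω)) ω = faceMap v (normSum X ω) := by
  simp [scaledSum, normSum]

theorem memLp_normSum (hX : ∀ t, MemLp (X t) 2 μ) : MemLp (normSum X) 2 μ := by
  have h : MemLp (fun ω => ∑ t, X t ω) 2 μ := memLp_finsetSum _ fun t _ => hX t
  exact h.const_smul (√(n : ℝ))⁻¹

theorem integral_normSum (hX : ∀ t, MemLp (X t) 2 μ) (hX0 : ∀ t, ∫ ω, X t ω ∂μ = 0) :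
    ∫ ω, normSum X ω ∂μ = 0 := by
  simp only [normSum]
  rw [integral_smul, integral_finsetSum _ fun t _ => (hX t).integrable one_le_two]
  simp [hX0]

theorem memLp_inner {f : Ω → Vec p} (hf : MemLp f 2 μ) (x : Vec p) :
    MemLp (fun ω => (⟪x, f ω⟫ : ℝ)) 2 μ := hf.const_inner x

theorem integral_inner_eq_zero {f : Ω → Vec p} (hf : MemLp f 2 μ) (hf0 : ∫ ω, f ω ∂μ = 0)
    (x : Vec p) : ∫ ω, (⟪x, f ω⟫ : ℝ) ∂μ = 0 := by
  rw [integral_inner (hf.integrable one_le_two), hf0, inner_zero_right]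

open Matrix in
theorem dotProduct_longRunCov_mulVec (hX : ∀ t, MemLp (X t) 2 μ) (x y : Vec p) :
    x.ofLp ⬝ᵥ longRunCov X μ *ᵥ y.ofLp =
      cov[fun ω => ⟪x, normSum X ω⟫, fun ω => ⟪y, normSum X ω⟫; μ] := by
  have h : ∀ (x : Vec p) ω, (⟪x, normSum X ω⟫ : ℝ) = ∑ i, x i * normSum X ω i := fun x ω => by
    simp [PiLp.inner_apply, mul_comm]
  have hm : ∀ (x : Vec p) i, MemLp (fun ω => x i * normSum X ω i) 2 μ := fun x i => by
    have h1 := memLp_inner (memLp_normSum hX) (EuclideanSpace.single i (1 : ℝ))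
    simp only [EuclideanSpace.inner_single_left, map_one, one_mul] at h1
    exact h1.const_mul _
  simp only [h]
  rw [covariance_fun_sum_fun_sum (hm x) (hm y)]
  simp only [dotProduct, mulVec, Finset.mul_sum, longRunCov, of_apply]
  refine Finset.sum_congr rfl fun i _ => Finset.sum_congr rfl fun j _ => ?_
  rw [covariance_const_mul_left, covariance_const_mul_right]
  ring

theorem posSemidef_longRunCov (hX : ∀ t, MemLp (X t) 2 μ) : (longRunCov X μ).PosSemidef := by
  refine Matrix.PosSemidef.of_dotProduct_mulVec_nonneg ?_ fun x => ?_
  · ext i j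
    simp only [Matrix.conjTranspose_apply, star_trivial, longRunCov, Matrix.of_apply]
    exact covariance_comm _ _
  · have h := dotProduct_longRunCov_mulVec hX (WithLp.toLp 2 x) (WithLp.toLp 2 x)
    rw [star_trivial]
    refine le_of_le_of_eq ?_ h.symm
    rw [covariance_self (memLp_inner (memLp_normSum hX) _).aestronglyMeasurable.aemeasurable]
    exact variance_nonneg _ _

/-- The law of the inner products of the Gaussian vector with given directions. -/
def faceGaussian (X : Fin n → Ω → Vec p) (μ : Measure Ω) (v : ι → Vec p) : Measure (ι → ℝ) :=
  (multivariateGaussian (0 : Vec p) (longRunCov X μ)).map (faceMap v)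

instance isGaussian_faceGaussian : IsGaussian (faceGaussian X μ v) := by
  unfold faceGaussian
  infer_instance

theorem integral_faceGaussian : ∫ z, z ∂(faceGaussian X μ v) = 0 := by
  rw [faceGaussian, integral_map (by fun_prop) (by fun_prop),
    ContinuousLinearMap.integral_comp_comm _ IsGaussian.integrable_fun_id,
    integral_id_multivariateGaussian, map_zero]

theorem integral_mul_faceGaussian (hX : ∀ t, MemLp (X t) 2 μ) (j k : ι) :
    ∫ z, z j * z k ∂(faceGaussian X μ v) =
      cov[fun ω => ⟪v j, normSum X ω⟫, fun ω => ⟪v k, normSum X ω⟫; μ] := by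
  rw [faceGaussian, integral_map (by fun_prop)
    (by fun_prop : Measurable fun z : ι → ℝ => z j * z k).aestronglyMeasurable,
    ← dotProduct_longRunCov_mulVec hX, ← covarianceBilin_multivariateGaussian (μ := 0)
    (posSemidef_longRunCov hX), covarianceBilin_apply IsGaussian.memLp_two_id]
  simp [faceMap_apply]

theorem covariance_inner_normSum (hX : ∀ t, MemLp (X t) 2 μ) (hX0 : ∀ t, ∫ ω, X t ω ∂μ = 0)
    (x y : Vec p) : cov[fun ω => ⟪x, normSum X ω⟫, fun ω => ⟪y, normSum X ω⟫; μ] =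
      ∫ ω, ⟪x, normSum X ω⟫ * ⟪y, normSum X ω⟫ ∂μ := by
  rw [covariance_eq_sub (memLp_inner (memLp_normSum hX) x) (memLp_inner (memLp_normSum hX) y),
    integral_inner_eq_zero (memLp_normSum hX) (integral_normSum hX hX0) x]
  simp

theorem longRunVar_eq (hX : ∀ t, MemLp (X t) 2 μ) (x : Vec p) :
    longRunVar X μ x = cov[fun ω => ⟪x, normSum X ω⟫, fun ω => ⟪x, normSum X ω⟫; μ] := by
  rw [covariance_self (memLp_inner (memLp_normSum hX) _).aestronglyMeasurable.aemeasurable]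
  simp only [longRunVar, normSum, inner_smul_right, inner_sum]

theorem subExp_faceMap {γ B : ℝ} (hγ : 1 ≤ γ) (hB : 0 < B) (hX : ∀ t, Measurable (X t))
    (h : ∀ t j, psiNorm γ (fun ω => ⟪v j, X t ω⟫) μ ≤ ENNReal.ofReal B) :
    SubExp (2 * B) (fun t ω => faceMap v (X t ω)) μ := by
  have hm : ∀ t j, Measurable fun ω => (⟪v j, X t ω⟫ : ℝ) := fun t j => by
    have := hX t
    fun_prop
  exact ⟨by linarith, fun t => by have := hX t; fun_prop,
    fun t j => (exp_moment_of_psiNorm_le hγ hB (hm t j) (h t j)).1,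
    fun t j => (exp_moment_of_psiNorm_le hγ hB (hm t j) (h t j)).2⟩

end Projection

/-! ### Dependency graphs as local dependence. -/

section Graph

variable {Ω : Type*} [MeasurableSpace Ω] {μ : Measure Ω} [IsProbabilityMeasure μ]
  {n p : ℕ} {ι : Type*} [Fintype ι] {X : Fin n → Ω → Vec p} {v : ι → Vec p}
  {G : SimpleGraph (Fin n)}

open Classical in
/-- The closed neighbourhood as a finite set. -/
def nbhd (G : SimpleGraph (Fin n)) (t : Fin n) : Finset (Fin n) :=
  Finset.univ.filter fun s => s ∈ closedNbhd G t

theorem mem_nbhd {s t : Fin n} : s ∈ nbhd G t ↔ s = t ∨ G.Adj t s := by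
  simp only [nbhd, Finset.mem_filter, Finset.mem_univ, true_and]
  rfl

theorem card_nbhd_le (G : SimpleGraph (Fin n)) (t : Fin n) : (nbhd G t).card ≤ maxDeg G := by
  have h : (nbhd G t : Set (Fin n)) = closedNbhd G t := by ext s; simp [nbhd]
  rw [← Set.ncard_coe_finset, h]
  exact Finset.le_sup (f := fun t => (closedNbhd G t).ncard) (Finset.mem_univ t)

theorem IsDependencyGraph.locallyDependent (hG : IsDependencyGraph G X μ)
    (hX : ∀ t, MemLp (X t) 2 μ) (hX0 : ∀ t, ∫ ω, X t ω ∂μ = 0) :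
    LocallyDependent (nbhd G) (fun t ω => faceMap v (X t ω)) μ := by
  classical
  have hsum : ∀ (J : Finset (Fin n)), Measurable fun x : J → Vec p => ∑ s, faceMap v (x s) :=
    fun J => by fun_prop
  have hev : ∀ (J : Finset (Fin n)) (t : J), Measurable fun x : J → Vec p => faceMap v (x t) :=
    fun J t => (faceMap v).continuous.measurable.comp (measurable_pi_apply t)
  have hsum_eq : ∀ (J : Finset (Fin n)) ω, ∑ s : J, faceMap v (X s ω) =
      ∑ s ∈ J, faceMap v (X s ω) := fun J ω =>
    Finset.sum_coe_sort J fun s => faceMap v (X s ω)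
  refine ⟨fun t j => integral_inner_eq_zero (hX t) (hX0 t) _, fun t => ?_, fun t s => ?_,
    fun t s hs => ?_⟩
  · have h := hG {t} (nbhd G t)ᶜ fun i hi j hj => by
      rw [Finset.mem_singleton] at hi
      rw [Finset.mem_compl, mem_nbhd, not_or] at hj
      subst hi
      exact ⟨fun h => hj.1 h.symm, hj.2⟩
    have h' := h.comp (hev {t} ⟨t, Finset.mem_singleton_self t⟩) (hsum _)
    refine (h'.congr (ae_of_all _ fun ω => rfl) (ae_of_all _ fun ω => ?_))
    exact hsum_eq _ ω
  · have h := hG {t, s} (nbhd G t ∪ nbhd G s)ᶜ fun i hi j hj => by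
      rw [Finset.mem_insert, Finset.mem_singleton] at hi
      rw [Finset.mem_compl, Finset.mem_union, mem_nbhd, mem_nbhd] at hj
      push Not at hj
      rcases hi with rfl | rfl
      · exact ⟨fun h => hj.1.1 h.symm, hj.1.2⟩
      · exact ⟨fun h => hj.2.1 h.symm, hj.2.2⟩
    have h' := h.comp ((hev {t, s} ⟨t, by simp⟩).prodMk (hev {t, s} ⟨s, by simp⟩)) (hsum _)
    refine (h'.congr (ae_of_all _ fun ω => rfl) (ae_of_all _ fun ω => ?_))
    exact hsum_eq _ ω
  · have h := hG {t} {s} fun i hi j hj => by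
      rw [Finset.mem_singleton] at hi hj
      subst hi hj
      rw [mem_nbhd, not_or] at hs
      exact ⟨fun h => hs.1 h.symm, hs.2⟩
    exact h.comp (hev {t} ⟨t, Finset.mem_singleton_self t⟩)
      (hev {s} ⟨s, Finset.mem_singleton_self s⟩)

theorem maxDeg_le_maxDeg₂ (G : SimpleGraph (Fin n)) : maxDeg G ≤ maxDeg₂ G := by
  refine Finset.sup_le fun t ht => le_trans (Set.ncard_le_ncard ?_ (Set.toFinite _))
    (Finset.le_sup (f := fun t => (⋃ l ∈ closedNbhd G t, closedNbhd G l).ncard) ht)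
  exact Set.subset_iUnion₂_of_subset t (Or.inl rfl) subset_rfl

theorem one_le_maxDeg [NeZero n] (G : SimpleGraph (Fin n)) : 1 ≤ maxDeg G := by
  have h := card_nbhd_le G 0
  have : 0 < (nbhd G 0).card := Finset.card_pos.2 ⟨0, mem_nbhd.2 (Or.inl rfl)⟩
  omega

end Graph


/-! ### Constants and the choice of the smoothing parameters. -/

/-- The constant in Nazarov's inequality. -/
def nazarovConst (v : ℝ) : ℝ := 4 * Real.exp (3 / 2) / √v

/-- The constant relating the smoothing level to the rate of convergence. -/
def smoothingConst : ℝ :=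
  -- The 32 makes the tail error at most r. The second term makes the coefficient of the recursion
  -- at most 1/4, and its 8 = 2³ comes from exponential moments at scale 2B.
  32 + 4 * (Real.pi / 2 * (13 * cutoffBound) * (15 * (15000 * 8)))

/-- The constant in the bound over lower orthants. -/
def orthantConst (v : ℝ) : ℝ := 9 * nazarovConst v * smoothingConst + 1 + smoothingConst

theorem nazarovConst_nonneg (v : ℝ) : 0 ≤ nazarovConst v := by
  unfold nazarovConst
  positivity

theorem le_smoothingConst : 32 ≤ smoothingConst := by
  have hM : (0 : ℝ) ≤ cutoffBound := zero_le_one.trans one_le_cutoffBound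
  unfold smoothingConst
  have : 0 ≤ Real.pi / 2 * (13 * cutoffBound) * (15 * (15000 * 8)) := by positivity
  linarith

theorem orthantConst_pos (v : ℝ) : 0 < orthantConst v := by
  have h1 := nazarovConst_nonneg v
  have h2 := le_smoothingConst
  have h3 : 0 ≤ 9 * nazarovConst v * smoothingConst := by positivity
  unfold orthantConst
  linarith

/-- Each of n, K², and the target n⁻¹ costs a multiple of L in the exponent, 1 + 2 + 1 = 4
altogether. -/
theorem card_mul_exp_le {n K : ℕ} {L x : ℝ} (hn : Real.log n ≤ L) (hK : Real.log K ≤ L)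
    (hn0 : 0 < n) (hK0 : 0 < K) (hx : 4 * L ≤ x) :
    (n : ℝ) * (K : ℝ) ^ 2 * Real.exp (-x) ≤ (n : ℝ)⁻¹ := by
  have hn1 : (0 : ℝ) < n := by exact_mod_cast hn0
  have hK1 : (0 : ℝ) < K := by exact_mod_cast hK0
  rw [← Real.exp_log hn1, ← Real.exp_log hK1, ← Real.exp_nat_mul, ← Real.exp_add, ← Real.exp_add,
    ← Real.exp_neg]
  refine Real.exp_le_exp.2 ?_
  push_cast
  linarith

section Orthant

variable {Ω : Type*} [MeasurableSpace Ω] {μ : Measure Ω} [IsProbabilityMeasure μ]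
  {n p : ℕ} [NeZero n] {ι : Type*} [Fintype ι] {X : Fin n → Ω → Vec p} {v : ι → Vec p}
  {G : SimpleGraph (Fin n)} {γ B K₄ L : ℝ}

theorem real_Iic_faceGaussian_add_le (hK₄ : 0 < K₄) (hL : 1 ≤ L)
    (hι : Real.log (Fintype.card ι) ≤ L) (hX : ∀ t, MemLp (X t) 2 μ)
    (hvar : ∀ j, K₄ ≤ longRunVar X μ (v j)) (y : ι → ℝ) {δ : ℝ} (hδ : 0 ≤ δ) :
    (faceGaussian X μ v).real (Set.Iic fun j => y j + δ) ≤
      (faceGaussian X μ v).real (Set.Iic y) + nazarovConst K₄ * √L * δ := by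
  refine (IsGaussian.real_Iic_add_le integral_faceGaussian hK₄ (fun j => ?_) hL hι y hδ).trans_eq
    (by rw [nazarovConst]; ring)
  rw [integral_mul_faceGaussian hX, ← longRunVar_eq hX]
  exact hvar j

/-- Gaussian approximation over lower orthants of the projections on finitely many directions. -/
theorem abs_real_faceMap_sub_le [Nonempty ι] (hγ : 1 ≤ γ) (hB : 1 ≤ B) (hK₄ : 0 < K₄) (hL : 1 ≤ L)
    (hn : Real.log n ≤ L) (hι : Real.log (Fintype.card ι) ≤ L)
    (hXm : ∀ t, Measurable (X t)) (hX : ∀ t, MemLp (X t) 2 μ) (hX0 : ∀ t, ∫ ω, X t ω ∂μ = 0)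
    (hG : IsDependencyGraph G X μ)
    (hpsi : ∀ t j, psiNorm γ (fun ω => ⟪v j, X t ω⟫) μ ≤ ENNReal.ofReal B)
    (hvar : ∀ j, K₄ ≤ longRunVar X μ (v j)) {r : ℝ} (hr : 0 < r)
    (hr3 : r ^ 3 * √(n : ℝ) = B ^ 3 * (maxDeg G : ℝ) ^ 2 * L ^ 3 * √L) (y : ι → ℝ) :
    |μ.real {ω | faceMap v (normSum X ω) ∈ Set.Iic y} - (faceGaussian X μ v).real (Set.Iic y)| ≤
      orthantConst K₄ * r := by
  set C := smoothingConst with hC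
  have hC32 : 32 ≤ C := le_smoothingConst
  have hN0 := nazarovConst_nonneg K₄
  have hM : (0 : ℝ) ≤ cutoffBound := zero_le_one.trans one_le_cutoffBound
  -- If C r ≥ 1 the bound holds trivially, since `orthantConst` exceeds C. Otherwise r ≤ 1 is
  -- available.
  rcases le_total 1 (C * r) with hbig | hsmall
  · have h1 : |μ.real {ω | faceMap v (normSum X ω) ∈ Set.Iic y} -
        (faceGaussian X μ v).real (Set.Iic y)| ≤ 1 := by
      have a1 : μ.real {ω | faceMap v (normSum X ω) ∈ Set.Iic y} ≤ 1 := measureReal_le_one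
      have a2 : 0 ≤ μ.real {ω | faceMap v (normSum X ω) ∈ Set.Iic y} := measureReal_nonneg
      have a3 : (faceGaussian X μ v).real (Set.Iic y) ≤ 1 := measureReal_le_one
      have a4 : 0 ≤ (faceGaussian X μ v).real (Set.Iic y) := measureReal_nonneg
      rw [abs_le]
      constructor <;> linarith
    have h2 : 0 ≤ (9 * nazarovConst K₄ * C + 1) * r := by positivity
    rw [orthantConst]
    linarith
  have hn0 : 0 < n := Nat.pos_of_ne_zero (NeZero.ne n)
  have hn1 : (1 : ℝ) ≤ n := by exact_mod_cast hn0
  have hsn : 1 ≤ √(n : ℝ) := Real.one_le_sqrt.2 hn1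
  have hsL : 1 ≤ √L := Real.one_le_sqrt.2 hL
  have hD : (1 : ℝ) ≤ maxDeg G := by exact_mod_cast one_le_maxDeg G
  have hr1 : r ≤ 1 := by nlinarith
  have hC0 : 0 < C := by linarith
  -- Thus the anti-concentration cost √L/φ equals C r. Next, β = φL makes φ β⁻¹ log K ≤ 1, and τ is
  -- the largest threshold for which 2D summands move the normalized sum by at most β⁻¹.
  set φ := √L / (C * r) with hφ
  have hφ0 : 0 < φ := by positivity
  set β := φ * L with hβ
  have hβ0 : 0 < β := by positivity
  set τ := √(n : ℝ) / (2 * maxDeg G * β) with hτ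
  have hSE := subExp_faceMap (μ := μ) (v := v) hγ (zero_lt_one.trans_le hB) hXm hpsi
  have hLD := hG.locallyDependent (v := v) hX hX0
  have hcov : ∀ j k, ∫ z, z j * z k ∂(faceGaussian X μ v) =
      ∫ ω, scaledSum (fun t ω => faceMap v (X t ω)) ω j *
        scaledSum (fun t ω => faceMap v (X t ω)) ω k ∂μ := by
    intro j k
    simp only [scaledSum_faceMap, faceMap_apply]
    rw [integral_mul_faceGaussian hX, covariance_inner_normSum hX hX0]
  have hφ3 : φ ^ 3 * (C ^ 3 * B ^ 3 * (maxDeg G : ℝ) ^ 2 * L ^ 2) = √(n : ℝ) := by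
    have e1 : φ * (C * r) = √L := by rw [hφ]; field_simp
    have e2 : φ ^ 3 * C ^ 3 * r ^ 3 = √L * L := by
      have e : φ ^ 3 * C ^ 3 * r ^ 3 = (φ * (C * r)) ^ 3 := by ring
      rw [e, e1, pow_succ, Real.sq_sqrt (zero_le_one.trans hL), mul_comm]
    have e3 : √L * L ≠ 0 := by positivity
    have e4 : φ ^ 3 * C ^ 3 * (r ^ 3 * √(n : ℝ)) = √L * L * √(n : ℝ) := by rw [← e2]; ring
    rw [hr3] at e4
    refine mul_left_cancel₀ e3 ?_
    rw [← e4]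
    ring
  have hmain := abs_measureReal_scaledSum_sub_le (γ := faceGaussian X μ v) (D := maxDeg G)
    (φ := φ) (β := β) (τ := τ) (α := nazarovConst K₄ * √L)
    hSE hLD hφ0 (le_mul_of_one_le_right hφ0.le hL) (by positivity) integral_faceGaussian hcov
    ?_ (card_nbhd_le G) ?_
    (fun y δ hδ => real_Iic_faceGaussian_add_le hK₄ hL hι hX hvar y hδ) ?_ y
  · simp only [scaledSum_faceMap] at hmain
    refine hmain.trans ?_
    have e1 : 9 * (nazarovConst K₄ * √L * φ⁻¹) = 9 * nazarovConst K₄ * C * r := by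
      rw [hφ]
      field_simp
    have e2 : tailError ι (Fin n) (2 * B) τ ≤ r := by
      rw [tailError, Fintype.card_fin]
      refine (card_mul_exp_le hn hι hn0 Fintype.card_pos ?_).trans ?_
      · have e : τ / (2 * (2 * B)) = √(n : ℝ) * (C * r) / (8 * B * maxDeg G * L * √L) := by
          rw [hτ, hβ, hφ]
          field_simp
          ring
        rw [e, le_div_iff₀ (by positivity)]
        -- The defining relation determines r³ √n, while the exponent of the tail is linear in r; r
        -- ≤ 1 bridges the two.
        have h1 : r ^ 3 ≤ r := by
          have := mul_le_mul_of_nonneg_left (show r ^ 2 ≤ 1 by nlinarith) hr.le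
          linarith [pow_succ' r 2]
        have h2 : B * maxDeg G * L ^ 2 * √L ≤ B ^ 3 * (maxDeg G : ℝ) ^ 2 * L ^ 3 * √L := by
          gcongr
          · exact le_self_pow₀ hB (by norm_num)
          · exact le_self_pow₀ hD (by norm_num)
          · norm_num
        rw [← hr3] at h2
        have h3 : 32 * (B * maxDeg G * L ^ 2 * √L) ≤ C * (r * √(n : ℝ)) := by
          have h4 : r ^ 3 * √(n : ℝ) ≤ r * √(n : ℝ) := by gcongr
          have h5 : 0 ≤ B * maxDeg G * L ^ 2 * √L := by positivity
          exact mul_le_mul hC32 (h2.trans h4) h5 hC0.le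
        nlinarith
      · rw [inv_le_iff_one_le_mul₀ (by linarith)]
        have h1 : 1 ≤ B ^ 3 * (maxDeg G : ℝ) ^ 2 * L ^ 3 * √L :=
          one_le_mul_of_one_le_of_one_le (one_le_mul_of_one_le_of_one_le
            (one_le_mul_of_one_le_of_one_le (one_le_pow₀ hB) (one_le_pow₀ hD)) (one_le_pow₀ hL)) hsL
        rw [← hr3] at h1
        have h2 : √(n : ℝ) ≤ (n : ℝ) ^ 3 := by
          refine le_trans ?_ (le_self_pow₀ hn1 (by norm_num))
          rw [Real.sqrt_le_left (by linarith)]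
          nlinarith
        -- Since r³ √n ≥ 1 and √n ≤ n³, the cube of r n is at least one, which gives n⁻¹ ≤ r.
        have h3 : 1 ≤ (r * n) ^ 3 := by
          rw [mul_pow]
          exact h1.trans (by gcongr)
        by_contra! h4
        exact absurd h3 (not_le.2 (pow_lt_one₀ (by positivity) h4 (by norm_num)))
    have e3 : 0 ≤ C * r := by positivity
    -- The three summands of the constant cover the anti-concentration term, the tail error, and the
    -- trivial case.
    rw [e1, orthantConst]
    linarith
  · rw [Fintype.card_fin, hτ]
    refine le_of_eq ?_
    push_cast
    field_simp
  · rw [hβ]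
    have e : φ * ((φ * L)⁻¹ * Real.log (Fintype.card ι)) = Real.log (Fintype.card ι) / L := by
      field_simp
    rw [e, div_le_one (by linarith)]
    exact hι
  · rw [Fintype.card_fin, ← hφ3, hβ]
    set Q := Real.pi / 2 * (13 * cutoffBound) * (15 * (15000 * 8)) with hQ
    have hQ0 : 0 ≤ Q := by positivity
    have e : Real.pi / 2 * ((φ ^ 3 * (C ^ 3 * B ^ 3 * (maxDeg G : ℝ) ^ 2 * L ^ 2))⁻¹ *
        (13 * cutoffBound * φ * (φ * L) ^ 2) *
        (15 * (maxDeg G : ℝ) ^ 2 * (15000 * (2 * B) ^ 3))) = Q / C ^ 3 := by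
      rw [hQ]
      field_simp
      ring
    rw [e, div_le_iff₀ (by positivity)]
    -- The coefficient of the recursion is Q / C³, and C = 32 + 4Q ≤ C³ makes it at most 1/4.
    have h1 : C ≤ C ^ 3 := le_self_pow₀ (by linarith) (by norm_num)
    have h2 : C = 32 + 4 * Q := by rw [hC, smoothingConst]
    linarith

end Orthant

/-! ### Simple convex sets in the coordinates of their normals. -/

section Polytope

variable {p n : ℕ} {P A : Set (Vec p)} {V : Finset (Vec p)} {a d : ℝ}

theorem mem_enlarge_iff {ε : ℝ} {y : V → ℝ}
    (hy : ∀ v : V, supportFun P v = (y v : EReal)) (w : Vec p) :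
    w ∈ enlarge P V ε ↔ faceMap (fun v : V => (v : Vec p)) w ∈ Set.Iic fun v => y v + ε := by
  simp only [enlarge, Set.mem_ofPred_eq, Set.mem_Iic, Pi.le_def, faceMap_apply, Subtype.forall]
  refine forall₂_congr fun v hv => ?_
  rw [hy ⟨v, hv⟩, ← EReal.coe_add, EReal.coe_le_coe_iff, real_inner_comm]

/-- The half-space bound b keeps the support function below ∞, and a point of P keeps it above -∞.
-/
theorem IsGeneratedBy.exists_supportFun_eq (h : IsGeneratedBy P V) (hP : P.Nonempty) :
    ∃ y : V → ℝ, ∀ v : V, supportFun P v = (y v : EReal) := by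
  obtain ⟨-, b, hb⟩ := h
  obtain ⟨w, hw⟩ := hP
  refine ⟨fun v => (supportFun P v).toReal, fun v => (EReal.coe_toReal ?_ ?_).symm⟩
  · have h1 : supportFun P v ≤ (b v : EReal) := iSup₂_le fun w hw => by
      rw [hb] at hw
      exact EReal.coe_le_coe_iff.2 (hw v v.2)
    exact ne_top_of_le_ne_top (EReal.coe_ne_top _) h1
  · have h1 : ((⟪w, (v : Vec p)⟫ : ℝ) : EReal) ≤ supportFun P v :=
      le_iSup₂ (f := fun w (_ : w ∈ P) => ((⟪w, (v : Vec p)⟫ : ℝ) : EReal)) w hw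
    exact ne_bot_of_le_ne_bot (EReal.coe_ne_bot _) h1

/-- A simple convex set is trivial or lies between two orthants in the coordinates of its faces. -/
theorem IsSimpleApprox.trivial_or_exists (h : IsSimpleApprox n a d A P V) :
    A = ∅ ∨ A = Set.univ ∨ V.Nonempty ∧ ∃ y : V → ℝ,
      (faceMap fun v : V => (v : Vec p)) ⁻¹' Set.Iic y ⊆ A ∧
        A ⊆ (faceMap fun v : V => (v : Vec p)) ⁻¹' Set.Iic fun v => y v + a / n := by
  obtain ⟨hgen, -, hPA, hAP⟩ := h
  -- With no half-spaces, P is the whole space, and so is A.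
  rcases V.eq_empty_or_nonempty with rfl | hV
  · right; left
    obtain ⟨-, b, hb⟩ := hgen
    refine Set.eq_univ_of_forall fun w => hPA ?_
    rw [hb]
    intro v hv
    simp at hv
  -- An empty P has support function -∞, which stays -∞ after adding ε, so the enlargement and A are
  -- empty.
  rcases P.eq_empty_or_nonempty with rfl | hP
  · left
    refine Set.eq_empty_of_forall_notMem fun w hw => ?_
    obtain ⟨v, hv⟩ := hV
    have h1 := hAP hw v hv
    simp [supportFun] at h1
  right; right
  obtain ⟨y, hy⟩ := hgen.exists_supportFun_eq hP
  refine ⟨hV, y, fun w hw => hPA ?_, fun w hw => (mem_enlarge_iff hy w).1 (hAP hw)⟩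
  rw [hgen.eq_enlarge_zero, mem_enlarge_iff hy]
  simpa using hw

end Polytope


/-! ### From orthants to simple convex sets. -/

section Rho

variable {Ω : Type*} [MeasurableSpace Ω] {μ : Measure Ω} [IsProbabilityMeasure μ]
  {n p : ℕ} [NeZero n] {X : Fin n → Ω → Vec p} {G : SimpleGraph (Fin n)} {γ B K₄ L a d r : ℝ}

/-- The set lies between the orthants at y and at y + a/n. The orthant bound applies to both, and
Nazarov's inequality bounds the Gaussian mass between them. -/
theorem abs_real_normSum_sub_le_of_isSimpleApprox (hγ : 1 ≤ γ) (hB : 1 ≤ B) (hK₄ : 0 < K₄)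
    (hL : 1 ≤ L) (hn : Real.log n ≤ L) (hpn : d * Real.log ((p : ℝ) * n) ≤ L) (hp : 0 < p)
    (ha : 0 ≤ a) (hXm : ∀ t, Measurable (X t)) (hX : ∀ t, MemLp (X t) 2 μ)
    (hX0 : ∀ t, ∫ ω, X t ω ∂μ = 0) (hG : IsDependencyGraph G X μ) {A P : Set (Vec p)}
    {V : Finset (Vec p)} (hA : IsSimpleApprox n a d A P V)
    (hpsi : ∀ t, ∀ v ∈ V, psiNorm γ (fun ω => ⟪v, X t ω⟫) μ ≤ ENNReal.ofReal B)
    (hvar : ∀ v ∈ V, K₄ ≤ longRunVar X μ v) (hr : 0 < r)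
    (hr3 : r ^ 3 * √(n : ℝ) = B ^ 3 * (maxDeg G : ℝ) ^ 2 * L ^ 3 * √L) :
    |μ.real {ω | normSum X ω ∈ A} -
      (multivariateGaussian (0 : Vec p) (longRunCov X μ)).real A| ≤
      nazarovConst K₄ * √L * (a / n) + orthantConst K₄ * r := by
  have hN0 := nazarovConst_nonneg K₄
  have hO0 := (orthantConst_pos K₄).le
  have hRHS : 0 ≤ nazarovConst K₄ * √L * (a / n) + orthantConst K₄ * r := by positivity
  rcases hA.trivial_or_exists with rfl | rfl | ⟨hV, y, hPA, hAP⟩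
  · simpa using hRHS
  · simpa using hRHS
  have : Nonempty V := hV.coe_sort
  have hn0 : 0 < n := Nat.pos_of_ne_zero (NeZero.ne n)
  have hι : Real.log (Fintype.card V) ≤ L := by
    rw [Fintype.card_coe]
    have hc : (0 : ℝ) < V.card := by exact_mod_cast hV.card_pos
    have hpn0 : (0 : ℝ) < (p : ℝ) * n := by positivity
    refine le_trans (Real.log_le_log hc hA.2.1) ?_
    rwa [Real.log_rpow hpn0]
  set f := faceMap fun v : V => (v : Vec p) with hf
  set γG := multivariateGaussian (0 : Vec p) (longRunCov X μ) with hγG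
  have hvar' : ∀ v : V, K₄ ≤ longRunVar X μ v := fun v => hvar v v.2
  have hmain := abs_real_faceMap_sub_le (v := fun v : V => (v : Vec p)) hγ hB hK₄ hL hn hι hXm hX
    hX0 hG (fun t v => hpsi t v v.2) hvar' hr hr3
  have hmap : ∀ z, (faceGaussian X μ fun v : V => (v : Vec p)).real (Set.Iic z) =
      γG.real (f ⁻¹' Set.Iic z) := fun z => by
    rw [faceGaussian, map_measureReal_apply (by fun_prop) measurableSet_Iic]
  have hanti := real_Iic_faceGaussian_add_le (v := fun v : V => (v : Vec p)) hK₄ hL hι hX hvar' y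
    (δ := a / n) (by positivity)
  have h1 := hmain y
  have h2 := hmain fun v => y v + a / n
  rw [hmap, abs_le] at h1 h2
  rw [hmap, hmap] at hanti
  have h3 : μ.real {ω | f (normSum X ω) ∈ Set.Iic y} ≤ μ.real {ω | normSum X ω ∈ A} :=
    measureReal_mono fun ω hω => hPA hω
  have h4 : μ.real {ω | normSum X ω ∈ A} ≤
      μ.real {ω | f (normSum X ω) ∈ Set.Iic fun v => y v + a / n} :=
    measureReal_mono fun ω hω => hAP hω
  have h5 : γG.real (f ⁻¹' Set.Iic y) ≤ γG.real A := measureReal_mono hPA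
  have h6 : γG.real A ≤ γG.real (f ⁻¹' Set.Iic fun v => y v + a / n) := measureReal_mono hAP
  rw [abs_le]
  constructor <;> linarith [h1.1, h1.2, h2.1, h2.2]

end Rho

/-! ### The band graph of an m-dependent sequence. -/

section MDependence

/-- Both hypotheses together say that the joint law of (f, g, h) is a product of three measures,
which may be bracketed the other way. -/
theorem _root_.ProbabilityTheory.IndepFun.prodMk_right_of_prodMk_left {Ω α β δ : Type*}
    [MeasurableSpace Ω] {μ : Measure Ω} [IsProbabilityMeasure μ] [MeasurableSpace α]
    [MeasurableSpace β] [MeasurableSpace δ] {f : Ω → α} {g : Ω → β} {h : Ω → δ}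
    (hf : Measurable f) (hg : Measurable g) (hh : Measurable h) (hfg : IndepFun f g μ)
    (hfgh : IndepFun (fun ω => (f ω, g ω)) h μ) : IndepFun f (fun ω => (g ω, h ω)) μ := by
  have hgh : IndepFun g h μ := hfgh.comp measurable_snd measurable_id
  rw [indepFun_iff_map_prod_eq_prod_map_map (by fun_prop) (by fun_prop)] at hfg hfgh hgh ⊢
  have := Measure.isProbabilityMeasure_map (μ := μ) hf.aemeasurable
  have := Measure.isProbabilityMeasure_map (μ := μ) hg.aemeasurable
  have := Measure.isProbabilityMeasure_map (μ := μ) hh.aemeasurable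
  rw [hgh, ← Measure.prodAssoc_prod, ← hfg, ← hfgh, Measure.map_map (by fun_prop) (by fun_prop)]
  rfl

variable {n p : ℕ}

/-- The graph on `Fin n` joining distinct indices at distance at most `m`. -/
def bandGraph (n m : ℕ) : SimpleGraph (Fin n) where
  Adj i j := i ≠ j ∧ (i : ℕ) ≤ j + m ∧ (j : ℕ) ≤ i + m
  symm := ⟨fun _ _ h => ⟨h.1.symm, h.2.2, h.2.1⟩⟩
  loopless := ⟨fun _ h => h.1 rfl⟩

theorem IsMDependent.indepFun_of_lt {Ω : Type*} [MeasurableSpace Ω] {μ : Measure Ω}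
    {X : Fin n → Ω → Vec p} {m : ℕ} (hm : IsMDependent m X μ) {I J : Finset (Fin n)} (t : Fin n)
    (hI : ∀ i ∈ I, i ≤ t) (hJ : ∀ j ∈ J, (t : ℕ) + m < j) :
    IndepFun (fun ω (i : I) => X i ω) (fun ω (j : J) => X j ω) μ :=
  (hm t).comp (φ := fun x (i : I) => x ⟨i, hI i i.2⟩) (ψ := fun x (j : J) => x ⟨j, hJ j j.2⟩)
    (measurable_pi_lambda _ fun _ => measurable_pi_apply _)
    (measurable_pi_lambda _ fun _ => measurable_pi_apply _)

/-- The definition separates only past from future, whereas I and J may interleave. Let J contain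
the overall maximum and let t = max I. The part J₂ of J beyond t lies beyond t + m, so it is
independent of I together with the rest J₁ of J. By induction I is independent of J₁, and the two
facts combine. -/
theorem IsMDependent.isDependencyGraph {Ω : Type*} [MeasurableSpace Ω] {μ : Measure Ω}
    [IsProbabilityMeasure μ] {X : Fin n → Ω → Vec p} (hX : ∀ t, Measurable (X t)) {m : ℕ}
    (hm : IsMDependent m X μ) : IsDependencyGraph (bandGraph n m) X μ := by
  have key : ∀ (k : ℕ) (I J : Finset (Fin n)), I.card + J.card ≤ k →
      (∀ i ∈ I, ∀ j ∈ J, (i : ℕ) + m < j ∨ (j : ℕ) + m < i) →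
      IndepFun (fun ω (i : I) => X i ω) (fun ω (j : J) => X j ω) μ := by
    intro k
    induction k with
    | zero =>
      intro I J hk _
      have hI : I = ∅ := Finset.card_eq_zero.1 (by omega)
      subst hI
      have h : (fun ω (i : (∅ : Finset (Fin n))) => X i ω) =
          fun _ => fun i => absurd i.2 (Finset.notMem_empty _) := by
        ext ω i
        exact absurd i.2 (Finset.notMem_empty _)
      rw [h]
      exact indepFun_const_left _ _
    | succ k ih =>
      -- This is the case where some index of J exceeds all of I; symmetry of independence gives the
      -- other one.
      have main : ∀ I J : Finset (Fin n), I.card + J.card ≤ k + 1 →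
          (∀ i ∈ I, ∀ j ∈ J, (i : ℕ) + m < j ∨ (j : ℕ) + m < i) →
          (∃ j ∈ J, ∀ i ∈ I, i < j) →
          IndepFun (fun ω (i : I) => X i ω) (fun ω (j : J) => X j ω) μ := by
        intro I J hk hIJ hlast
        obtain ⟨j₀, hj₀, hlast⟩ := hlast
        rcases I.eq_empty_or_nonempty with rfl | hne
        · have h : (fun ω (i : (∅ : Finset (Fin n))) => X i ω) =
              fun _ => fun i => absurd i.2 (Finset.notMem_empty _) := by
            ext ω i
            exact absurd i.2 (Finset.notMem_empty _)
          rw [h]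
          exact indepFun_const_left _ _
        set t := I.max' hne with ht
        have htI : t ∈ I := I.max'_mem hne
        set J₁ := J.filter fun j => j ≤ t with hJ₁
        set J₂ := J.filter fun j => ¬ j ≤ t with hJ₂
        -- The index j₀ beyond t is dropped, so the induction hypothesis applies to I and J₁.
        have hcard : J₁.card < J.card := Finset.card_lt_card
          (Finset.filter_ssubset.2 ⟨j₀, hj₀, not_le.2 (hlast t htI)⟩)
        have h1 := ih I J₁ (by omega) fun i hi j hj => hIJ i hi j (Finset.mem_filter.1 hj).1
        have hJ₂t : ∀ j ∈ J₂, (t : ℕ) + m < j := fun j hj => by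
          obtain ⟨hj1, hj2⟩ := Finset.mem_filter.1 hj
          have hj3 : (t : ℕ) < j := not_le.1 hj2
          rcases hIJ t htI j hj1 with h | h <;> omega
        have h2 := hm.indepFun_of_lt (I := I ∪ J₁) (J := J₂) t (fun i hi => by
          rcases Finset.mem_union.1 hi with h | h
          · exact I.le_max' i h
          · exact (Finset.mem_filter.1 h).2) hJ₂t
        have h3 : IndepFun (fun ω => ((fun i : I => X i ω), fun j : J₁ => X j ω))
            (fun ω (j : J₂) => X j ω) μ :=
          h2.comp (φ := fun x => ((fun i : I => x ⟨i, Finset.mem_union_left _ i.2⟩),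
            fun j : J₁ => x ⟨j, Finset.mem_union_right _ j.2⟩))
            (Measurable.prodMk (measurable_pi_lambda _ fun _ => measurable_pi_apply _)
              (measurable_pi_lambda _ fun _ => measurable_pi_apply _)) measurable_id
        have hmeas : ∀ K : Finset (Fin n), Measurable fun ω (i : K) => X i ω := fun K =>
          measurable_pi_lambda _ fun i => hX i
        have h4 := h1.prodMk_right_of_prodMk_left (hmeas I) (hmeas J₁) (hmeas J₂) h3
        have hψ : Measurable fun (x : (J₁ → Vec p) × (J₂ → Vec p)) (j : J) =>
            if h : (j : Fin n) ≤ t then x.1 ⟨j, Finset.mem_filter.2 ⟨j.2, h⟩⟩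
            else x.2 ⟨j, Finset.mem_filter.2 ⟨j.2, h⟩⟩ := by
          refine measurable_pi_lambda _ fun j => ?_
          by_cases h : (j : Fin n) ≤ t
          · simp only [h, dite_true]
            fun_prop
          · simp only [h, dite_false]
            fun_prop
        refine (h4.comp measurable_id hψ).congr (ae_of_all _ fun ω => rfl)
          (ae_of_all _ fun ω => ?_)
        ext1 j
        by_cases h : (j : Fin n) ≤ t
        · simp [h]
        · simp [h]
      intro I J hk hIJ
      rcases (I ∪ J).eq_empty_or_nonempty with h0 | hne
      · refine ih I J ?_ hIJ
        rw [Finset.union_eq_empty] at h0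
        simp [h0.1, h0.2]
      have hmax := (I ∪ J).max'_mem hne
      have hlt : ∀ i ∈ I, ∀ j ∈ J, i ≠ j := fun i hi j hj h => by
        subst h
        rcases hIJ i hi i hj with h | h <;> omega
      rcases Finset.mem_union.1 hmax with h | h
      · refine (main J I (by omega) (fun i hi j hj => (hIJ j hj i hi).symm)
          ⟨_, h, fun j hj => ?_⟩).symm
        exact lt_of_le_of_ne (Finset.le_max' _ _ (Finset.mem_union_right _ hj)) (hlt _ h j hj).symm
      · refine main I J hk hIJ ⟨_, h, fun i hi => ?_⟩
        exact lt_of_le_of_ne (Finset.le_max' _ _ (Finset.mem_union_left _ hi)) (hlt i hi _ h)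
  intro I J hIJ
  refine key _ I J le_rfl fun i hi j hj => ?_
  obtain ⟨h1, h2⟩ := hIJ i hi j hj
  simp only [bandGraph, not_and, not_le] at h2
  have := h2 h1
  omega

theorem ncard_le_of_dist_le {n : ℕ} (s : Set (Fin n)) (t m : ℕ)
    (hs : ∀ i ∈ s, (i : ℕ) ≤ t + m ∧ t ≤ i + m) : s.ncard ≤ 2 * m + 1 := by
  have h : (Fin.val '' s).ncard ≤ (Finset.Icc (t - m) (t + m) : Set ℕ).ncard := by
    refine Set.ncard_le_ncard ?_ (Finset.finite_toSet _)
    rintro _ ⟨i, hi, rfl⟩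
    have := hs i hi
    simp only [Finset.coe_Icc, Set.mem_Icc]
    omega
  rw [Set.ncard_image_of_injective _ Fin.val_injective, Set.ncard_coe_finset, Nat.card_Icc] at h
  omega

theorem dist_le_of_mem_closedNbhd_bandGraph {n m : ℕ} {s t : Fin n}
    (h : s ∈ closedNbhd (bandGraph n m) t) : (s : ℕ) ≤ t + m ∧ (t : ℕ) ≤ s + m := by
  rcases h with rfl | h
  · omega
  · exact ⟨h.2.2, h.2.1⟩

theorem maxDeg_bandGraph_le (n m : ℕ) : maxDeg (bandGraph n m) ≤ 2 * m + 1 :=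
  Finset.sup_le fun t _ => ncard_le_of_dist_le _ t m fun _ h =>
    dist_le_of_mem_closedNbhd_bandGraph h

theorem maxDeg₂_bandGraph_le (n m : ℕ) : maxDeg₂ (bandGraph n m) ≤ 4 * m + 1 := by
  refine Finset.sup_le fun t _ => (ncard_le_of_dist_le _ t (2 * m) fun s h => ?_).trans
    (by omega)
  obtain ⟨l, hl, hs⟩ := Set.mem_iUnion₂.1 h
  have h1 := dist_le_of_mem_closedNbhd_bandGraph hl
  have h2 := dist_le_of_mem_closedNbhd_bandGraph hs
  omega

end MDependence

/-- With M = max m 1 the degrees are at most 3M and 5M, and 15^(1/3) is rounded up to 15. -/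
theorem maxDeg_mul_bandGraph_rpow_le (n m : ℕ) :
    ((maxDeg (bandGraph n m) : ℝ) * maxDeg₂ (bandGraph n m)) ^ (1 / 3 : ℝ) ≤
      15 * (max m 1 : ℝ) ^ (2 / 3 : ℝ) := by
  set M : ℝ := max (m : ℝ) 1 with hM
  have hM1 : 1 ≤ M := le_max_right _ _
  have hmM : (m : ℝ) ≤ M := le_max_left _ _
  have h1 : (maxDeg (bandGraph n m) : ℝ) ≤ 2 * m + 1 := by exact_mod_cast maxDeg_bandGraph_le n m
  have h2 : (maxDeg₂ (bandGraph n m) : ℝ) ≤ 4 * m + 1 := by exact_mod_cast maxDeg₂_bandGraph_le n m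
  have h3 : (maxDeg (bandGraph n m) : ℝ) * maxDeg₂ (bandGraph n m) ≤ (3 * M) * (5 * M) := by
    gcongr <;> linarith
  calc _ ≤ (15 * M ^ 2) ^ (1 / 3 : ℝ) :=
        Real.rpow_le_rpow (by positivity) (h3.trans_eq (by ring)) (by norm_num)
    _ = 15 ^ (1 / 3 : ℝ) * M ^ (2 / 3 : ℝ) := by
        rw [Real.mul_rpow (by norm_num) (by positivity), ← Real.rpow_natCast M 2,
          ← Real.rpow_mul (by linarith)]
        norm_num
    _ ≤ _ := by
        gcongr
        exact Real.rpow_le_self_of_one_le (by norm_num) (by norm_num)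

/-! ### The final rate. -/

/-- The rate of convergence, up to constants. -/
theorem rate_pow_three_mul_sqrt {B D L N : ℝ} (hD : 0 ≤ D) (hL : 0 ≤ L)
    (hN : 0 < N) :
    (B * D ^ (2 / 3 : ℝ) * L ^ (7 / 6 : ℝ) / N ^ (1 / 6 : ℝ)) ^ 3 * √N =
      B ^ 3 * D ^ 2 * L ^ 3 * √L := by
  have h : ∀ (x e : ℝ), 0 ≤ x → (x ^ e) ^ 3 = x ^ (e * 3) := fun x e hx => by
    rw [← Real.rpow_natCast, ← Real.rpow_mul hx]
    norm_num
  have e1 : D ^ (2 / 3 * 3 : ℝ) = D ^ 2 := by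
    rw [← Real.rpow_natCast]
    norm_num
  have e2 : L ^ (7 / 6 * 3 : ℝ) = L ^ 3 * √L := by
    rw [Real.sqrt_eq_rpow, ← Real.rpow_natCast, ← Real.rpow_add_of_nonneg hL (by norm_num)
      (by norm_num)]
    norm_num
  have e3 : N ^ (1 / 6 * 3 : ℝ) = √N := by
    rw [Real.sqrt_eq_rpow]
    norm_num
  have hN' : √N ≠ 0 := (Real.sqrt_pos.2 hN).ne'
  rw [div_pow, mul_pow, mul_pow, h _ _ hD, h _ _ hL, h _ _ hN.le, e1, e2, e3]
  field_simp

/-- The hypothesis n^κ ≤ p gives log n ≤ κ⁻¹ log p. The summand 1 + κ⁻¹ then serves d log (pn), the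
summand (κ d₀)⁻¹ serves log n, and (d₀ log 2)⁻¹ serves the bound 1, through p ≥ 2. -/
theorem logs_le_mul_log_dim {κ d₀ d : ℝ} {n p : ℕ} (hκ : 0 < κ) (hd₀ : 0 < d₀) (hd : d₀ ≤ d)
    (hn : 1 ≤ n) (hp : 2 ≤ p) (hnp : (n : ℝ) ^ κ ≤ p) :
    1 ≤ ((1 + κ⁻¹) + (κ * d₀)⁻¹ + (d₀ * Real.log 2)⁻¹) * (d * Real.log p) ∧
    Real.log n ≤ ((1 + κ⁻¹) + (κ * d₀)⁻¹ + (d₀ * Real.log 2)⁻¹) * (d * Real.log p) ∧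
    d * Real.log ((p : ℝ) * n) ≤
      ((1 + κ⁻¹) + (κ * d₀)⁻¹ + (d₀ * Real.log 2)⁻¹) * (d * Real.log p) := by
  have hd0 : 0 < d := hd₀.trans_le hd
  have hn0 : (0 : ℝ) < n := by exact_mod_cast hn
  have hp2 : (2 : ℝ) ≤ p := by exact_mod_cast hp
  have hp0 : (0 : ℝ) < p := by linarith
  have hlog2 : 0 < Real.log 2 := Real.log_pos one_lt_two
  have hlp : Real.log 2 ≤ Real.log p := Real.log_le_log two_pos hp2
  have hlp0 : 0 < Real.log p := hlog2.trans_le hlp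
  have hln : κ * Real.log n ≤ Real.log p := by
    rw [← Real.log_rpow hn0]
    exact Real.log_le_log (Real.rpow_pos_of_pos hn0 κ) hnp
  have hln' : Real.log n ≤ κ⁻¹ * Real.log p := by
    rw [← div_eq_inv_mul, le_div_iff₀ hκ]
    linarith
  have e1 : 0 ≤ (1 + κ⁻¹) * (d * Real.log p) := by positivity
  have e2 : 0 ≤ (κ * d₀)⁻¹ * (d * Real.log p) := by positivity
  have e3 : 0 ≤ (d₀ * Real.log 2)⁻¹ * (d * Real.log p) := by positivity
  have a3 : 1 ≤ (d₀ * Real.log 2)⁻¹ * (d * Real.log p) := by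
    rw [← div_eq_inv_mul, one_le_div (by positivity)]
    gcongr
  have a2 : Real.log n ≤ (κ * d₀)⁻¹ * (d * Real.log p) := by
    refine hln'.trans ?_
    have h : κ⁻¹ * Real.log p = (κ * d₀)⁻¹ * (d₀ * Real.log p) := by field_simp
    rw [h]
    gcongr
  have a1 : d * Real.log ((p : ℝ) * n) ≤ (1 + κ⁻¹) * (d * Real.log p) := by
    rw [Real.log_mul hp0.ne' hn0.ne']
    have := mul_le_mul_of_nonneg_left hln' hd0.le
    linarith
  refine ⟨?_, ?_, ?_⟩ <;> linarith

/-- Gaussian approximation over simple convex sets for sums with a dependency graph. -/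
theorem rho_le_of_isDependencyGraph {Ω : Type*} [MeasurableSpace Ω] {μ : Measure Ω}
    [IsProbabilityMeasure μ] {n p : ℕ} {X : Fin n → Ω → Vec p} {G : SimpleGraph (Fin n)}
    {γ B K₄ a d l C₀ : ℝ} (hγ : 1 ≤ γ) (hB : 1 ≤ B) (hK₄ : 0 < K₄) (ha : 0 ≤ a) (hn1 : 1 ≤ n)
    (hp : 0 < p) (hl : 0 ≤ l) (hC₀ : 0 ≤ C₀) (hL : 1 ≤ C₀ * l) (hn : Real.log n ≤ C₀ * l)
    (hpn : d * Real.log ((p : ℝ) * n) ≤ C₀ * l)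
    (hXm : ∀ t, Measurable (X t)) (hX : ∀ t, MemLp (X t) 2 μ) (hX0 : ∀ t, ∫ ω, X t ω ∂μ = 0)
    (hG : IsDependencyGraph G X μ) {𝒜 : Set (Set (Vec p))} {PK : Set (Vec p) → Set (Vec p)}
    {VK : Set (Vec p) → Finset (Vec p)}
    (hA : ∀ A ∈ 𝒜, IsSimpleApprox n a d A (PK A) (VK A))
    (hpsi : ∀ A ∈ 𝒜, ∀ t, ∀ v ∈ VK A,
      psiNorm γ (fun ω => ⟪v, X t ω⟫) μ ≤ ENNReal.ofReal B)
    (hvar : ∀ A ∈ 𝒜, ∀ v ∈ VK A, K₄ ≤ longRunVar X μ v) :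
    rho X μ 𝒜 ≤ (nazarovConst K₄ * √C₀ + orthantConst K₄ * C₀ ^ (7 / 6 : ℝ)) *
      (a * l ^ (1 / 2 : ℝ) / n + B * ((maxDeg G : ℝ) * maxDeg₂ G) ^ (1 / 3 : ℝ) *
        l ^ (7 / 6 : ℝ) / (n : ℝ) ^ (1 / 6 : ℝ)) := by
  have : NeZero n := ⟨by omega⟩
  have hn0 : (0 : ℝ) < n := by exact_mod_cast hn1
  have hN0 := nazarovConst_nonneg K₄
  have hO0 := (orthantConst_pos K₄).le
  have hD1 : (1 : ℝ) ≤ maxDeg G := by exact_mod_cast one_le_maxDeg G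
  have hD2 : (maxDeg G : ℝ) ≤ maxDeg₂ G := by exact_mod_cast maxDeg_le_maxDeg₂ G
  set D := (maxDeg G : ℝ) with hD
  set L := C₀ * l with hLdef
  set r := B * D ^ (2 / 3 : ℝ) * L ^ (7 / 6 : ℝ) / (n : ℝ) ^ (1 / 6 : ℝ) with hr
  have hr0 : 0 < r := by positivity
  have hr3 : r ^ 3 * √(n : ℝ) = B ^ 3 * D ^ 2 * L ^ 3 * √L :=
    rate_pow_three_mul_sqrt (by linarith) (by linarith) hn0
  set R := B * (D * maxDeg₂ G) ^ (1 / 3 : ℝ) * l ^ (7 / 6 : ℝ) / (n : ℝ) ^ (1 / 6 : ℝ) with hR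
  set S := a * l ^ (1 / 2 : ℝ) / n with hS
  have hR0 : 0 ≤ R := by positivity
  have hS0 : 0 ≤ S := by positivity
  have hrR : r ≤ C₀ ^ (7 / 6 : ℝ) * R := by
    -- The argument yields the rate with D², which D ≤ D* turns into D D*.
    have h1 : D ^ (2 / 3 : ℝ) ≤ (D * maxDeg₂ G) ^ (1 / 3 : ℝ) := by
      have h2 : D ^ (2 / 3 : ℝ) = (D * D) ^ (1 / 3 : ℝ) := by
        rw [← pow_two, ← Real.rpow_natCast, ← Real.rpow_mul (by linarith)]
        norm_num
      rw [h2]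
      exact Real.rpow_le_rpow (by positivity) (by gcongr) (by norm_num)
    calc r ≤ B * (D * maxDeg₂ G) ^ (1 / 3 : ℝ) * L ^ (7 / 6 : ℝ) / (n : ℝ) ^ (1 / 6 : ℝ) := by
          rw [hr]
          gcongr
      _ = _ := by
          rw [hLdef, Real.mul_rpow hC₀ hl, hR]
          ring
  have hS' : √L * (a / n) = √C₀ * S := by
    rw [hLdef, Real.sqrt_mul hC₀, hS, ← Real.sqrt_eq_rpow]
    ring
  -- Nonnegativity of the bound takes care of an empty class, whose supremum is 0.
  refine Real.iSup_le (fun A => ?_) (by positivity)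
  refine (abs_real_normSum_sub_le_of_isSimpleApprox hγ hB hK₄ hL hn hpn hp ha hXm hX hX0 hG
    (hA A A.2) (hpsi A A.2) (hvar A A.2) hr0 hr3).trans ?_
  rw [mul_assoc, hS']
  have h1 : orthantConst K₄ * r ≤ orthantConst K₄ * (C₀ ^ (7 / 6 : ℝ) * R) := by gcongr
  have h2 : 0 ≤ nazarovConst K₄ * √C₀ * R := by positivity
  have h3 : 0 ≤ orthantConst K₄ * C₀ ^ (7 / 6 : ℝ) * S := by positivity
  linarith

end HDCLT

end

theorem theorem5 (κ γ₁ K₄ d₀ : ℝ) (hκ : 0 < κ) (hγ₁ : 1 ≤ γ₁) (hK₄ : 0 < K₄) (hd₀ : 0 < d₀) :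
    ∃ c : ℝ, 0 < c ∧
      ∀ (n p : ℕ), 1 ≤ n → 2 ≤ p → (n : ℝ) ^ κ ≤ p →
      ∀ (Ω : Type*) [MeasurableSpace Ω] (μ : Measure Ω) [IsProbabilityMeasure μ]
        (X : Fin n → Ω → Vec p),
        (∀ t, Measurable (X t)) → (∀ t, MemLp (X t) 2 μ) → (∀ t, ∫ ω, X t ω ∂μ = 0) →
      ∀ (a d B : ℝ), 0 ≤ a → d₀ ≤ d → 1 ≤ B →
      -- a subclass of `𝒜^si(a, d)`, with the operators `A ↦ A^K` and `A ↦ 𝒱(A^K)`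
      ∀ (𝒜 : Set (Set (Vec p))) (PK : Set (Vec p) → Set (Vec p))
        (VK : Set (Vec p) → Finset (Vec p)),
        (∀ A ∈ 𝒜, MeasurableSet A) →
        (∀ A ∈ 𝒜, IsSimpleApprox n a d A (PK A) (VK A)) →
        -- sub-exponential moments along the normals
        (∀ A ∈ 𝒜, ∀ t, ∀ v ∈ VK A, psiNorm γ₁ (fun ω => ⟪v, X t ω⟫) μ ≤ ENNReal.ofReal B) →
        -- non-degeneracy along the normals
        (∀ A ∈ 𝒜, ∀ v ∈ VK A, K₄ ≤ longRunVar X μ v) →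
      (∀ G : SimpleGraph (Fin n), IsDependencyGraph G X μ →
        rho X μ 𝒜 ≤ c * (a * (d * Real.log p) ^ (1 / 2 : ℝ) / n +
          B * ((maxDeg G : ℝ) * maxDeg₂ G) ^ (1 / 3 : ℝ) * (d * Real.log p) ^ (7 / 6 : ℝ) /
            (n : ℝ) ^ (1 / 6 : ℝ))) ∧
      (∀ m : ℕ, IsMDependent m X μ →
        rho X μ 𝒜 ≤ c * (a * (d * Real.log p) ^ (1 / 2 : ℝ) / n +
          B * (max m 1 : ℝ) ^ (2 / 3 : ℝ) * (d * Real.log p) ^ (7 / 6 : ℝ) /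
            (n : ℝ) ^ (1 / 6 : ℝ))) := by
  set C₀ := (1 + κ⁻¹) + (κ * d₀)⁻¹ + (d₀ * Real.log 2)⁻¹ with hC₀
  have hlog2 : 0 < Real.log 2 := Real.log_pos one_lt_two
  have hC₀0 : 0 < C₀ := by positivity
  set c := nazarovConst K₄ * √C₀ + orthantConst K₄ * C₀ ^ (7 / 6 : ℝ) with hc
  have hc0 : 0 < c := by
    have h1 := nazarovConst_nonneg K₄
    have h2 := orthantConst_pos K₄
    positivity
  -- The factor 15 is the price of bounding the band graph's degrees by m ∨ 1 in the second part;
  -- the first part holds already with c.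
  refine ⟨15 * c, by positivity, ?_⟩
  intro n p hn hp hnp Ω _ μ _ X hXm hX hX0 a d B ha hd hB 𝒜 PK VK _ hA hpsi hvar
  obtain ⟨hL1, hLn, hLp⟩ := logs_le_mul_log_dim hκ hd₀ hd hn hp hnp
  rw [← hC₀] at hL1 hLn hLp
  set l := d * Real.log p with hl
  have hl0 : 0 ≤ l := mul_nonneg (hd₀.le.trans hd) (Real.log_natCast_nonneg p)
  have main : ∀ G : SimpleGraph (Fin n), IsDependencyGraph G X μ →
      rho X μ 𝒜 ≤ c * (a * l ^ (1 / 2 : ℝ) / n + B * ((maxDeg G : ℝ) * maxDeg₂ G) ^ (1 / 3 : ℝ) *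
        l ^ (7 / 6 : ℝ) / (n : ℝ) ^ (1 / 6 : ℝ)) := fun G hG =>
    rho_le_of_isDependencyGraph hγ₁ hB hK₄ ha hn (by omega) hl0 hC₀0.le hL1 hLn hLp hXm hX hX0 hG
      hA hpsi hvar
  constructor
  · intro G hG
    refine (main G hG).trans (mul_le_mul_of_nonneg_right (by linarith) ?_)
    positivity
  · intro m hm
    refine (main _ (hm.isDependencyGraph hXm)).trans ?_
    rw [mul_comm 15 c, mul_assoc c 15]
    refine mul_le_mul_of_nonneg_left ?_ hc0.le
    have h1 := maxDeg_mul_bandGraph_rpow_le n m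
    have h2 : 0 ≤ a * l ^ (1 / 2 : ℝ) / n := by positivity
    calc _ ≤ a * l ^ (1 / 2 : ℝ) / n + B * (15 * (max m 1 : ℝ) ^ (2 / 3 : ℝ)) *
          l ^ (7 / 6 : ℝ) / (n : ℝ) ^ (1 / 6 : ℝ) := by gcongr
      _ = a * l ^ (1 / 2 : ℝ) / n + 15 * (B * (max m 1 : ℝ) ^ (2 / 3 : ℝ) *
          l ^ (7 / 6 : ℝ) / (n : ℝ) ^ (1 / 6 : ℝ)) := by ring
      _ ≤ _ := by linarith
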